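/- Let $n\ge 2$ and $N=2n$. Consider $N$ vortices of equal strength on the unit sphere $S^2\subset\mathbb R^3$, \[ \dot v_j=\sum_{i\ne j}\frac{v_i\times v_j}{|v_j-v_i|^2},\qquad j=1,\dots,N,\qquad\qquad H(v)=-\tfrac12\sum_{i<j}\ln|v_j-v_i|^2 , \] where $v=(v_1,\dots,v_N)\in (S^2)^N$ and $H$ is the conserved energy. Put $\zeta=2\pi/n$ and let $\mathbb D_n<\mathrm{SO}(3)$ be the dihedral group (of order $2n$) generated by the rotation by $\zeta$ about the $z$-axis and the rotation by $\pi$ about the $x$-axis. Let $g_1,\dots,g_{2n}$ be any ordering of $\mathbb D_n$ and let $\rho(u)=(g_1u,\dots,g_{2n}u)$ for $u\in S^2$. By a *one-parameter family of $\mathbb D_n$-symmetric periodic solutions around $v^0=\rho(u_0)$ parametrised by the energy* $h\in I$ ($I$ an interval) we mean collision-free solutions $v_h(t)$, $h\in I$, depending continuously on $(h,t)$, with $H(v_h(t))=h$, of minimal period $T(h)>0$ depending continuously on $h$, such that (a) $v_h(t)=\rho(u_h(t))$ for a curve $u_h$ in $S^2$, so all loops and the positions of the vortices in them are obtained from a single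 one by the action of $\mathbb D_n$; and (b) each vortex $v_{h,j}$ traverses, once in each period, a simple closed loop that lies in the open hemisphere centred at $v^0_j$ and goes once around $v^0_j$; two vortices $i,j$ traverse the same loop if $v^0_i=v^0_j$, and disjoint loops if $v^0_i\neq v^0_j$. Then: 1. (Anti-prism.) Let $T_k,U_k$ be the Chebyshev polynomials of the first and second kind. The polynomial $(3n-1)T_{2n}(\lambda)-nU_{2n}(\lambda)+2n-1$ has a unique root $\lambda_a>1$; let $z_a\in(0,1)$ with $z_a^2=1-1/\lambda_a^2$. For each of the points $u_0=\bigl(\sqrt{1-z_a^2}\cos\tfrac{(2j-1)\zeta}{4},\sqrt{1-z_a^2}\sin\tfrac{(2j-1)\zeta}{4},\pm z_a\bigr)$, $j=1,\dots,2n$, the configuration $v^0=\rho(u_0)$ is an equilibrium whose vortices occupy the vertices of an inscribed $n$-gon anti-prism of height $2z_a$ (a regular tetrahedron if $n=2$, a regular octahedron if $n=3$), and there are $h_1>H(v^0)$ and a one-parameter family as above around $v^0$, $h\in(H(v^0),h_1)$, that emanates from $v^0$: $v_h\to v^0$ uniformly in $t$ as $h\downarrow H(v^0)$. 2. (Polar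 collision.) For $u_0=(0,0,\pm1)$ the configuration $v^0=\rho(u_0)$ has $n$ vortices at each pole, and there are $h_1\in\mathbb R$ and a one-parameter family as above around $v^0$, $h\in(h_1,\infty)$, with $v_h\to v^0$ uniformly in $t$ and $T(h)\to0$ as $h\to\infty$. Along each solution the $n$ vortices around the north pole turn about the $z$-axis once per period in one direction, and the $n$ vortices around the south pole once in the opposite direction. 3. (Polygonal collisions.) For each of the points $u_0=\bigl(\cos\tfrac{(j-1)\zeta}{2},\sin\tfrac{(j-1)\zeta}{2},0\bigr)$, $j=1,\dots,2n$, the configuration $v^0=\rho(u_0)$ has exactly two vortices at each vertex of a regular $n$-gon on the equator (two antipodal points if $n=2$), and there are $h_1\in\mathbb R$ and a one-parameter family as above around $v^0$, $h\in(h_1,\infty)$, with $v_h\to v^0$ uniformly in $t$ and $T(h)\to0$ as $h\to\infty$; thus a pair of vortices travels along a common small closed loop around each vertex. -/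

import Mathlib

open Set Filter Topology

noncomputable section

namespace SphereVortex

/-- Euclidean three-space. -/
abbrev R3 : Type := EuclideanSpace ℝ (Fin 3)

/-- The vector product on Euclidean three-space. -/
def cross (x y : R3) : R3 := WithLp.toLp 2 (crossProduct x.ofLp y.ofLp)

/-! ### The equations of motion -/

/-- The product of `N` copies of the unit sphere. -/
def phaseSpace (N : ℕ) : Set (Fin N → R3) := {v | ∀ j, ‖v j‖ = 1}

/-- Configurations in which at least two vortices occupy the same position. -/
def collisionSet (N : ℕ) : Set (Fin N → R3) :=
  {v | v ∈ phaseSpace N ∧ ∃ i j, i ≠ j ∧ v i = v j}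

/-- The right-hand side `∑_{i ≠ j} (v_i × v_j) / |v_j - v_i|²` of the equations of motion. -/
def vortexField {N : ℕ} (v : Fin N → R3) : Fin N → R3 := fun j =>
  ∑ i ∈ Finset.univ.erase j, (‖v j - v i‖ ^ 2)⁻¹ • cross (v i) (v j)

/-- The Hamiltonian `H(v) = -(1/2) ∑_{i<j} ln |v_j - v_i|²`. -/
def energy {N : ℕ} (v : Fin N → R3) : ℝ :=
  -(1 / 2) * ∑ i, ∑ j ∈ Finset.Ioi i, Real.log (‖v j - v i‖ ^ 2)

/-- A (global in time, collision-free) solution of the equations of motion. -/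
def IsSolution {N : ℕ} (v : ℝ → Fin N → R3) : Prop :=
  ∀ t, v t ∈ phaseSpace N \ collisionSet N ∧ HasDerivAt v (vortexField (v t)) t

/-- A collision-free equilibrium of the equations of motion. -/
def IsEquilibrium {N : ℕ} (v : Fin N → R3) : Prop :=
  v ∈ phaseSpace N \ collisionSet N ∧ vortexField v = 0

/-! ### The dihedral group -/

/-- The matrix of the rotation by the angle `2π / n` about the third axis. -/
def matA (n : ℕ) : Matrix (Fin 3) (Fin 3) ℝ :=
  !![Real.cos (2 * Real.pi / n), -Real.sin (2 * Real.pi / n), 0;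
     Real.sin (2 * Real.pi / n), Real.cos (2 * Real.pi / n), 0;
     0, 0, 1]

/-- The matrix of the rotation by the angle `π` about the first axis. -/
def matB : Matrix (Fin 3) (Fin 3) ℝ := !![1, 0, 0; 0, -1, 0; 0, 0, -1]

theorem matA_mem (n : ℕ) : matA n ∈ Matrix.specialOrthogonalGroup (Fin 3) ℝ := by
  have h := Real.sin_sq_add_cos_sq (2 * Real.pi / n)
  rw [Matrix.mem_specialOrthogonalGroup_iff, Matrix.mem_orthogonalGroup_iff]
  constructor
  · ext i j
    fin_cases i <;> fin_cases j <;>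
      simp [matA, Matrix.mul_apply, Fin.sum_univ_three] <;> nlinarith
  · simp [matA, Matrix.det_fin_three]
    nlinarith

theorem matB_mem : matB ∈ Matrix.specialOrthogonalGroup (Fin 3) ℝ := by
  rw [Matrix.mem_specialOrthogonalGroup_iff, Matrix.mem_orthogonalGroup_iff]
  constructor
  · ext i j
    fin_cases i <;> fin_cases j <;>
      simp [matB, Matrix.mul_apply, Fin.sum_univ_three]
  · simp [matB, Matrix.det_fin_three]

/-- The dihedral subgroup of `SO(3)` generated by the two rotations above. -/
def dihedral (n : ℕ) : Subgroup (Matrix.specialOrthogonalGroup (Fin 3) ℝ) :=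
  Subgroup.closure {⟨matA n, matA_mem n⟩, ⟨matB, matB_mem⟩}

/-- The action of an element of the dihedral group on three-space. -/
def act {n : ℕ} (g : dihedral n) (u : R3) : R3 :=
  WithLp.toLp 2 ((g : Matrix (Fin 3) (Fin 3) ℝ).mulVec u.ofLp)

/-- The configuration whose `j`-th vortex is at `g_j u`, for an ordering `(g_j)` of the group. -/
def config {n : ℕ} (g : Fin (2 * n) ≃ dihedral n) (u : R3) : Fin (2 * n) → R3 :=
  fun j => act (g j) u

/-- The dihedrally symmetric configurations for an ordering `(g_j)` of the group:
every vortex is the image under `g_j` of the vortex labelled by the identity. -/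
def symmetricConfigs {n : ℕ} (g : Fin (2 * n) ≃ dihedral n) : Set (Fin (2 * n) → R3) :=
  {v | v ∈ phaseSpace (2 * n) ∧ ∀ j, v j = act (g j) (v (g.symm 1))}

/-! ### Equilibria and collisions -/

/-- The point of the unit sphere with longitude `θ` and height `z`. -/
def spherePoint (θ z : ℝ) : R3 :=
  !₂[Real.sqrt (1 - z ^ 2) * Real.cos θ, Real.sqrt (1 - z ^ 2) * Real.sin θ, z]

/-- The north pole. -/
def north : R3 := !₂[0, 0, 1]

/-- The south pole. -/
def south : R3 := !₂[0, 0, -1]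

/-- The polynomial `(3n-1) T_{2n} - n U_{2n} + 2n - 1`. -/
def antiprismPoly (n : ℕ) : Polynomial ℝ :=
  Polynomial.C (3 * (n : ℝ) - 1) * Polynomial.Chebyshev.T ℝ (2 * (n : ℤ))
    - Polynomial.C (n : ℝ) * Polynomial.Chebyshev.U ℝ (2 * (n : ℤ))
    + Polynomial.C (2 * (n : ℝ) - 1)

/-- `z ∈ (0,1)` and `z² = 1 - 1/λ²`, where `λ` is the unique root greater than `1` of the
polynomial above. -/
def IsAntiprismHalfHeight (n : ℕ) (z : ℝ) : Prop :=
  0 < z ∧ z < 1 ∧ ∃ lam : ℝ,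
    (1 < lam ∧ (antiprismPoly n).eval lam = 0) ∧
    (∀ mu : ℝ, 1 < mu → (antiprismPoly n).eval mu = 0 → mu = lam) ∧
    z ^ 2 = 1 - 1 / lam ^ 2

/-- The configurations generated by the points `A_j^±`, of longitude `(2j-1)ζ/4` with `ζ = 2π/n`
and height `±z`. -/
def antiprismConfigs {n : ℕ} (g : Fin (2 * n) ≃ dihedral n) (z : ℝ) :
    Set (Fin (2 * n) → R3) :=
  {v | ∃ (j : ℤ) (σ : ℝ), (σ = 1 ∨ σ = -1) ∧
    v = config g (spherePoint ((2 * j - 1) * (2 * Real.pi / n) / 4) (σ * z))}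

/-- The configurations generated by the poles. -/
def polarCollisions {n : ℕ} (g : Fin (2 * n) ≃ dihedral n) : Set (Fin (2 * n) → R3) :=
  {v | ∃ u : R3, (u = north ∨ u = south) ∧ v = config g u}

/-- The configurations generated by the points `C_j`, on the equator at longitude `(j-1)ζ/2`
with `ζ = 2π/n`. -/
def polygonalCollisions {n : ℕ} (g : Fin (2 * n) ≃ dihedral n) : Set (Fin (2 * n) → R3) :=
  {v | ∃ j : ℤ, v = config g (spherePoint ((j - 1) * (2 * Real.pi / n) / 2) 0)}

/-- The vertices of an `n`-gon anti-prism of height `2z` with vertical axis, inscribed in the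
unit sphere: two horizontal regular `n`-gons twisted by `π / n`. -/
def IsAntiprism (n : ℕ) (z : ℝ) (S : Set R3) : Prop :=
  ∃ α : ℝ, S =
    range (fun k : ℤ => spherePoint (α + k * (2 * Real.pi / n)) z) ∪
    range (fun k : ℤ => spherePoint (α + Real.pi / n + k * (2 * Real.pi / n)) (-z))

/-- The vertices of a regular `n`-gon on the equator (two antipodal points if `n = 2`). -/
def IsEquatorialPolygon (n : ℕ) (S : Set R3) : Prop :=
  ∃ α : ℝ, S = range (fun k : ℤ => spherePoint (α + k * (2 * Real.pi / n)) 0)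

/-- The vertices of a regular tetrahedron. -/
def IsRegularTetrahedron (S : Set R3) : Prop :=
  S.ncard = 4 ∧ ∃ l : ℝ, 0 < l ∧ S.Pairwise (fun x y => dist x y = l)

/-- The vertices of a regular octahedron inscribed in the unit sphere. -/
def IsRegularOctahedron (S : Set R3) : Prop :=
  ∃ a b c : R3, Orthonormal ℝ ![a, b, c] ∧ S = {a, -a, b, -b, c, -c}

/-! ### Closed loops -/

/-- `γ` is a simple closed curve traversed once in each interval of length `T`; in particular
`T` is the minimal period. -/
def IsSimpleLoop (γ : ℝ → R3) (T : ℝ) : Prop :=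
  0 < T ∧ Continuous γ ∧ Function.Periodic γ T ∧ InjOn γ (Ico 0 T)

/-- In one period `T` the curve `γ` turns `k` times about the oriented axis spanned by the unit
vector `p` (counted counterclockwise when looking from the tip of `p` to the origin). -/
def TurnsAbout (γ : ℝ → R3) (T : ℝ) (p : R3) (k : ℤ) : Prop :=
  ∃ e₁ e₂ : R3, Orthonormal ℝ ![e₁, e₂, p] ∧ cross e₁ e₂ = p ∧
    ∃ r θ : ℝ → ℝ, Continuous θ ∧ ∀ t, 0 < r t ∧
      inner ℝ e₁ (γ t) = r t * Real.cos (θ t) ∧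
      inner ℝ e₂ (γ t) = r t * Real.sin (θ t) ∧
      θ (t + T) = θ t + 2 * Real.pi * k

/-- `γ` is a simple loop, contained in the open hemisphere centred at `p`, that goes around `p`
(once, in one of the two directions). -/
def LoopsAround (γ : ℝ → R3) (T : ℝ) (p : R3) : Prop :=
  IsSimpleLoop γ T ∧ (∀ t, 0 < inner ℝ p (γ t)) ∧
    (TurnsAbout γ T p 1 ∨ TurnsAbout γ T p (-1))

/-! ### Families of periodic solutions -/

/-- `h ↦ v h`, `h ∈ I`, is a one-parameter family, parametrised by the energy, of dihedrally
symmetric periodic solutions with period `T h`, along which the `j`-th vortex travels along a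
closed loop around `v₀ j`. Vortices with the same centre share their loop, and loops with
different centres are disjoint. -/
structure IsSymmetricPeriodicFamily {n : ℕ} (g : Fin (2 * n) ≃ dihedral n)
    (v₀ : Fin (2 * n) → R3) (I : Set ℝ) (v : ℝ → ℝ → Fin (2 * n) → R3) (T : ℝ → ℝ) : Prop where
  continuousOn : ContinuousOn (fun p : ℝ × ℝ => v p.1 p.2) (I ×ˢ univ)
  continuousOn_period : ContinuousOn T I
  isSolution : ∀ h ∈ I, IsSolution (v h)
  energy_eq : ∀ h ∈ I, ∀ t, energy (v h t) = h
  symmetric : ∀ h ∈ I, ∀ t, v h t ∈ symmetricConfigs g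
  loopsAround : ∀ h ∈ I, ∀ j, LoopsAround (fun t => v h t j) (T h) (v₀ j)
  same_loop : ∀ h ∈ I, ∀ i j, v₀ i = v₀ j →
    range (fun t => v h t i) = range (fun t => v h t j)
  disjoint_loops : ∀ h ∈ I, ∀ i j, v₀ i ≠ v₀ j →
    Disjoint (range fun t => v h t i) (range fun t => v h t j)

end SphereVortex

end

noncomputable section
namespace SphereVortex

/-! ### The vector product and the action -/

/-! The configurations `config g u` form an invariant set: by equivariance the velocity of the
`j`-th vortex is `act (g j)` applied to `reducedField n u` (`vortexField_config`). Everything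
therefore happens on a single sphere. There the energy is `-(n / 2) * logSum n u` (`energy_config`),
and `reducedField` is a quarter of the gradient of `logSum` turned by a right angle
(`reducedField_eq`). Orbits run along level curves of the one function `logSum`, and the solutions
sought are its small closed level curves around a point `p`.

In geodesic polar coordinates around `p`, suppose that the radial derivative of `logSum` has a
constant sign for `0 < ρ < ρ₀`. A level attained on every ray is then a graph `ρ = R φ`, along which
the angle moves strictly monotonically; integrating the time along the curve gives the period and
the continuous dependence on the level (`exists_levelOrbits`). The group carries this curve to the
other vortices, and the stabilizer of `p` maps it to itself (`exists_symmetricPeriodicFamily`).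

The sign has two sources. If some `γ₀ ≠ 1` fixes `p`, its term is `2 log (sin ρ)` plus a function of
`φ`; the radial derivative `2 cot ρ` beats the terms that stay bounded (`logSumDeriv_ge`), and the
energy tends to infinity at `p`. This settles both kinds of collision
(`exists_family_of_stabilizer`). If `p` has trivial stabilizer and is a nondegenerate maximum of
`logSum`, the radial derivative is negative nearby (`exists_family_of_minimum`).

For the anti-prism, the factorization of `x ^ n - y ^ n` over roots of unity gives, up to a
constant, `logSum = (n - 1) log (1 - z²) + log (S² - 4Y²)`, where `S = (1 + z)^n + (1 - z)^n` and
`Y` is the imaginary part of the `n`-th power of the suitably rotated horizontal coordinate; `Y`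
vanishes on the anti-prism meridians. Hence `logSum` is at most a function of the height minus a
multiple of `Y²`, with equality at `Y = 0`, and only the one-variable `profile` has to be studied.
Its critical equation `critFun n z = 0` reads `n tanh (n s) = (2n - 1) tanh s` for `z = tanh s`,
which is the Chebyshev equation at `λ = cosh s`. On `[0, 1]` the function `critFun` is strictly
concave, starts at `0` with slope `(n - 1)²` and ends at `1 - n`, so it has exactly one zero inside,
with negative slope. -/

theorem cross_zero_coord (x y : R3) : cross x y 0 = x 1 * y 2 - x 2 * y 1 := by
  simp [cross, cross_apply]

theorem cross_one_coord (x y : R3) : cross x y 1 = x 2 * y 0 - x 0 * y 2 := by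
  simp [cross, cross_apply]

theorem cross_two_coord (x y : R3) : cross x y 2 = x 0 * y 1 - x 1 * y 0 := by
  simp [cross, cross_apply]

theorem inner_eq_sum (x y : R3) : inner ℝ x y = x 0 * y 0 + x 1 * y 1 + x 2 * y 2 := by
  simp [PiLp.inner_apply, Fin.sum_univ_three, mul_comm]

theorem ext_coord {x y : R3} (h0 : x 0 = y 0) (h1 : x 1 = y 1) (h2 : x 2 = y 2) : x = y := by
  ext i; fin_cases i <;> assumption

theorem cross_self_eq (x : R3) : cross x x = 0 := by
  apply ext_coord <;> simp only [cross_zero_coord, cross_one_coord, cross_two_coord] <;> simp <;> ring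

theorem cross_cross_right (x y z : R3) :
    cross x (cross y z) = inner ℝ x z • y - inner ℝ x y • z := by
  apply ext_coord <;> simp [cross_zero_coord, cross_one_coord, cross_two_coord, inner_eq_sum] <;> ring

theorem cross_smul_left (c : ℝ) (x y : R3) : cross (c • x) y = c • cross x y := by
  apply ext_coord <;> simp [cross_zero_coord, cross_one_coord, cross_two_coord] <;> ring

theorem cross_comm_neg (x y : R3) : cross y x = -cross x y := by
  apply ext_coord <;> simp [cross_zero_coord, cross_one_coord, cross_two_coord] <;> ring

variable {n : ℕ}

theorem act_coord (g : dihedral n) (u : R3) (i : Fin 3) :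
    act g u i = (g : Matrix (Fin 3) (Fin 3) ℝ) i 0 * u 0 + (g : Matrix (Fin 3) (Fin 3) ℝ) i 1 * u 1
      + (g : Matrix (Fin 3) (Fin 3) ℝ) i 2 * u 2 := by
  simp [act, Matrix.mulVec, dotProduct, Fin.sum_univ_three]

/-- The action of a group element as a continuous linear map. -/
def actL (g : dihedral n) : R3 →L[ℝ] R3 :=
  LinearMap.toContinuousLinearMap
    { toFun := act g
      map_add' := fun x y => by
        apply ext_coord <;> simp [act_coord] <;> ring
      map_smul' := fun c x => by
        apply ext_coord <;> simp [act_coord] <;> ring }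

theorem act_add (g : dihedral n) (x y : R3) : act g (x + y) = act g x + act g y :=
  (actL g).map_add x y

theorem act_sub (g : dihedral n) (x y : R3) : act g (x - y) = act g x - act g y :=
  (actL g).map_sub x y

theorem act_smul (g : dihedral n) (c : ℝ) (x : R3) : act g (c • x) = c • act g x :=
  (actL g).map_smul c x

theorem act_neg (g : dihedral n) (x : R3) : act g (-x) = -act g x := (actL g).map_neg x

theorem act_zero (g : dihedral n) : act g 0 = 0 := (actL g).map_zero

theorem act_sum {ι : Type*} (g : dihedral n) (s : Finset ι) (f : ι → R3) :
    act g (∑ i ∈ s, f i) = ∑ i ∈ s, act g (f i) := map_sum (actL g) f s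

theorem continuous_act (g : dihedral n) : Continuous (act g) := (actL g).continuous

theorem act_one (u : R3) : act (1 : dihedral n) u = u := by
  simp [act]

theorem act_mul (g h : dihedral n) (u : R3) : act (g * h) u = act g (act h u) := by
  simp [act, Matrix.mulVec_mulVec]

theorem act_inv_act (g : dihedral n) (u : R3) : act g⁻¹ (act g u) = u := by
  rw [← act_mul, inv_mul_cancel, act_one]

theorem act_act_inv (g : dihedral n) (u : R3) : act g (act g⁻¹ u) = u := by
  rw [← act_mul, mul_inv_cancel, act_one]

theorem act_injective (g : dihedral n) : Function.Injective (act g) :=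
  Function.LeftInverse.injective (act_inv_act g)

theorem coe_transpose_mul (g : dihedral n) :
    (g : Matrix (Fin 3) (Fin 3) ℝ).transpose * (g : Matrix (Fin 3) (Fin 3) ℝ) = 1 := by
  have h := (Matrix.mem_specialOrthogonalGroup_iff.mp g.1.2).1
  rw [Matrix.mem_orthogonalGroup_iff'] at h
  exact h

theorem coe_det (g : dihedral n) : (g : Matrix (Fin 3) (Fin 3) ℝ).det = 1 :=
  (Matrix.mem_specialOrthogonalGroup_iff.mp g.1.2).2

theorem inner_act_act (g : dihedral n) (x y : R3) :
    inner ℝ (act g x) (act g y) = inner ℝ x y := by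
  have key : ∀ x y : R3, inner ℝ x y = x.ofLp ⬝ᵥ y.ofLp := fun x y => by
    simp [inner_eq_sum, dotProduct, Fin.sum_univ_three]
  rw [key, key]
  simp only [act]
  rw [Matrix.dotProduct_mulVec, Matrix.vecMul_mulVec, coe_transpose_mul, Matrix.vecMul_one]

theorem norm_act (g : dihedral n) (x : R3) : ‖act g x‖ = ‖x‖ := by
  have h := inner_act_act g x x
  rw [real_inner_self_eq_norm_sq, real_inner_self_eq_norm_sq] at h
  exact (sq_eq_sq₀ (norm_nonneg _) (norm_nonneg _)).mp h

theorem dist_act (g : dihedral n) (x y : R3) : dist (act g x) (act g y) = dist x y := by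
  rw [dist_eq_norm, ← act_sub, norm_act, dist_eq_norm]

theorem inner_act_inv (g : dihedral n) (x y : R3) :
    inner ℝ (act g⁻¹ x) y = inner ℝ x (act g y) := by
  rw [← inner_act_act g, act_act_inv]

theorem cross_act (g : dihedral n) (x y : R3) :
    cross (act g x) (act g y) = act g (cross x y) := by
  set M : Matrix (Fin 3) (Fin 3) ℝ := (g : Matrix (Fin 3) (Fin 3) ℝ) with hM
  -- An orthogonal matrix of determinant one equals its cofactor matrix, and the cofactors are what
  -- the vector product of two images produces.
  have hadj : M.transpose = M.adjugate := by
    have h1 : M.transpose * M = 1 := coe_transpose_mul g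
    have h2 : M * M.adjugate = 1 := by rw [Matrix.mul_adjugate, coe_det, one_smul]
    calc M.transpose = M.transpose * (M * M.adjugate) := by rw [h2, mul_one]
      _ = M.adjugate := by rw [← mul_assoc, h1, one_mul]
  have e : ∀ i j, M i j = M.adjugate j i := fun i j => by rw [← hadj]; rfl
  have hc : ∀ i, act g (cross x y) i =
      M.adjugate 0 i * cross x y 0 + M.adjugate 1 i * cross x y 1
        + M.adjugate 2 i * cross x y 2 := by
    intro i
    rw [act_coord, ← hM, e i 0, e i 1, e i 2]
  apply ext_coord <;> rw [hc] <;>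
    simp [cross_zero_coord, cross_one_coord, cross_two_coord, act_coord, ← hM,
      Matrix.adjugate_fin_three] <;> ring

/-! ### The reduced vector field and the reduced energy -/

/-- The logarithm of the squared distances of a point to its images, summed over the group. -/
def logSum (n : ℕ) [Fintype (dihedral n)] (u : R3) : ℝ := ∑ γ : dihedral n, Real.log (‖u - act γ u‖ ^ 2)

/-- The velocity of a vortex interacting with its images under the group. -/
def reducedField (n : ℕ) [Fintype (dihedral n)] (u : R3) : R3 :=
  ∑ γ : dihedral n, (‖u - act γ u‖ ^ 2)⁻¹ • cross (act γ u) u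

/-- Reindex the sum by `γ = (g j)⁻¹ * g i` and use that rotations preserve distances and vector
products. The omitted index `i = j` can be restored because its vector product vanishes. -/
theorem vortexField_config [Fintype (dihedral n)] (g : Fin (2 * n) ≃ dihedral n) (u : R3)
    (j : Fin (2 * n)) : vortexField (config g u) j = act (g j) (reducedField n u) := by
  rw [vortexField, Finset.sum_erase]
  · rw [reducedField, act_sum, ← Equiv.sum_comp (Equiv.mulLeft (g j)⁻¹), ← g.sum_comp]
    refine Finset.sum_congr rfl fun i _ => ?_
    rw [act_smul, ← cross_act, ← act_mul, Equiv.coe_mulLeft, mul_inv_cancel_left,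
      ← norm_act (g j) (u - _), act_sub, ← act_mul, mul_inv_cancel_left]
    rfl
  · simp

theorem sum_Ioi_eq_half {N : ℕ} (f : Fin N → Fin N → ℝ) (hs : ∀ i j, f i j = f j i)
    (h0 : ∀ i, f i i = 0) : ∑ i, ∑ j ∈ Finset.Ioi i, f i j = 1 / 2 * ∑ i, ∑ j, f i j := by
  have h1 : ∑ i, ∑ j ∈ Finset.Ioi i, f i j = ∑ i, ∑ j, if i < j then f i j else 0 := by
    refine Finset.sum_congr rfl fun i _ => ?_
    rw [← Finset.sum_filter]
    exact Finset.sum_congr (by ext; simp) fun _ _ => rfl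
  have h2 : ∑ i, ∑ j, (if i < j then f i j else 0) = ∑ i, ∑ j, if j < i then f i j else 0 := by
    rw [Finset.sum_comm]
    refine Finset.sum_congr rfl fun i _ => Finset.sum_congr rfl fun j _ => ?_
    rw [hs]
  have h3 : ∑ i, ∑ j, f i j = ∑ i, ∑ j, (if i < j then f i j else 0)
      + ∑ i, ∑ j, (if j < i then f i j else 0) := by
    rw [← Finset.sum_add_distrib]
    refine Finset.sum_congr rfl fun i _ => ?_
    rw [← Finset.sum_add_distrib]
    refine Finset.sum_congr rfl fun j _ => ?_
    rcases lt_trichotomy i j with h | h | h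
    · simp [h, h.le]
    · simp [h, h0]
    · simp [h, h.le]
  rw [h3, ← h2, h1]
  ring

/-- With the diagonal terms `log 0 = 0` included, each of the `2n` rows of the symmetric double sum
equals `logSum n u`; the factor is `-(1/2) * (1/2) * 2n`. -/
theorem energy_config [Fintype (dihedral n)] (g : Fin (2 * n) ≃ dihedral n) (u : R3) :
    energy (config g u) = -(n / 2) * logSum n u := by
  rw [energy, sum_Ioi_eq_half (fun i j => Real.log (‖config g u j - config g u i‖ ^ 2))
    (fun i j => by rw [norm_sub_rev]) (fun i => by simp)]
  have : ∀ i, ∑ j, Real.log (‖config g u j - config g u i‖ ^ 2) = logSum n u := by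
    intro i
    rw [logSum, ← Equiv.sum_comp (Equiv.mulLeft (g i)⁻¹), ← g.sum_comp]
    refine Finset.sum_congr rfl fun j _ => ?_
    rw [Equiv.coe_mulLeft, ← norm_act (g i) (u - _), act_sub, ← act_mul, mul_inv_cancel_left,
      norm_sub_rev]
    rfl
  simp only [this, Finset.sum_const, Finset.card_univ, Fintype.card_fin, nsmul_eq_mul]
  push_cast
  ring

/-- Conjugation permutes the group, and `g u - (g γ g⁻¹) (g u) = g (u - γ u)`. This is why the
stabilizer of a centre preserves the level curves around it. -/
theorem logSum_act [Fintype (dihedral n)] (g : dihedral n) (u : R3) :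
    logSum n (act g u) = logSum n u := by
  rw [logSum, logSum, ← Equiv.sum_comp (MulAut.conj g).toEquiv]
  refine Finset.sum_congr rfl fun j _ => ?_
  simp only [MulEquiv.toEquiv_eq_coe, MulEquiv.coe_toEquiv, MulAut.conj_apply]
  rw [← act_mul, inv_mul_cancel_right, act_mul, ← act_sub, norm_act]

/-! ### The elements of the dihedral group -/

/-- The rotation matrix about the third axis. -/
def rotMat (α : ℝ) : Matrix (Fin 3) (Fin 3) ℝ :=
  !![Real.cos α, -Real.sin α, 0; Real.sin α, Real.cos α, 0; 0, 0, 1]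

/-- The matrix of the half-turn about the horizontal axis of longitude `α / 2`. -/
def flipMat (α : ℝ) : Matrix (Fin 3) (Fin 3) ℝ :=
  !![Real.cos α, Real.sin α, 0; Real.sin α, -Real.cos α, 0; 0, 0, -1]

theorem rotMat_mul_rotMat (α β : ℝ) : rotMat α * rotMat β = rotMat (α + β) := by
  ext i j
  fin_cases i <;> fin_cases j <;>
    simp [rotMat, Matrix.mul_apply, Fin.sum_univ_three, Real.cos_add, Real.sin_add] <;> ring

theorem rotMat_mul_flipMat (α β : ℝ) : rotMat α * flipMat β = flipMat (α + β) := by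
  ext i j
  fin_cases i <;> fin_cases j <;>
    simp [rotMat, flipMat, Matrix.mul_apply, Fin.sum_univ_three, Real.cos_add, Real.sin_add] <;> ring

theorem flipMat_mul_rotMat (α β : ℝ) : flipMat α * rotMat β = flipMat (α - β) := by
  ext i j
  fin_cases i <;> fin_cases j <;>
    simp [rotMat, flipMat, Matrix.mul_apply, Fin.sum_univ_three, Real.cos_sub, Real.sin_sub] <;> ring

theorem flipMat_mul_flipMat (α β : ℝ) : flipMat α * flipMat β = rotMat (α - β) := by
  ext i j
  fin_cases i <;> fin_cases j <;>
    simp [rotMat, flipMat, Matrix.mul_apply, Fin.sum_univ_three, Real.cos_sub, Real.sin_sub] <;> ring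

theorem rotMat_zero : rotMat 0 = 1 := by
  ext i j
  fin_cases i <;> fin_cases j <;> simp [rotMat]

theorem matA_eq (n : ℕ) : matA n = rotMat (2 * Real.pi / n) := rfl

theorem matB_eq : matB = flipMat 0 := by
  ext i j
  fin_cases i <;> fin_cases j <;> simp [flipMat, matB]

/-- The generating rotation. -/
def rotGen (n : ℕ) : dihedral n :=
  ⟨⟨matA n, matA_mem n⟩, Subgroup.subset_closure (by simp)⟩

/-- The generating half-turn. -/
def flipGen (n : ℕ) : dihedral n :=
  ⟨⟨matB, matB_mem⟩, Subgroup.subset_closure (by simp)⟩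

theorem coe_inj_mat {g h : dihedral n}
    (H : (g : Matrix (Fin 3) (Fin 3) ℝ) = (h : Matrix (Fin 3) (Fin 3) ℝ)) : g = h :=
  Subtype.ext (Subtype.ext H)

theorem coe_mul_mat (g h : dihedral n) : ((g * h : dihedral n) : Matrix (Fin 3) (Fin 3) ℝ) =
    (g : Matrix (Fin 3) (Fin 3) ℝ) * (h : Matrix (Fin 3) (Fin 3) ℝ) := rfl

theorem coe_rotGen_pow (n k : ℕ) :
    ((rotGen n ^ k : dihedral n) : Matrix (Fin 3) (Fin 3) ℝ) = rotMat (k * (2 * Real.pi / n)) := by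
  induction k with
  | zero => simp [rotMat_zero]
  | succ k ih =>
    rw [pow_succ, coe_mul_mat, ih]
    change _ * matA n = _
    rw [matA_eq, rotMat_mul_rotMat]
    congr 1; push_cast; ring

theorem coe_rotGen_pow_mul_flipGen (n k : ℕ) :
    ((rotGen n ^ k * flipGen n : dihedral n) : Matrix (Fin 3) (Fin 3) ℝ) =
      flipMat (k * (2 * Real.pi / n)) := by
  rw [coe_mul_mat, coe_rotGen_pow]
  change _ * matB = _
  rw [matB_eq, rotMat_mul_flipMat, add_zero]

theorem rotGen_pow_inj {k l : ℕ} (hk : k < n) (hl : l < n) (h : rotMat (k * (2 * Real.pi / n)) =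
    rotMat (l * (2 * Real.pi / n))) : k = l := by
  have hn : (0 : ℝ) < n := by exact_mod_cast (Nat.zero_le k).trans_lt hk
  have hc := congrFun (congrFun h 0) 0
  have hs := congrFun (congrFun h 1) 0
  simp only [rotMat, Matrix.cons_val', Matrix.of_apply, Matrix.cons_val_zero,
    Matrix.cons_val_one] at hc hs
  have h1 := (Real.Angle.cos_sin_inj hc hs)
  rw [Real.Angle.angle_eq_iff_two_pi_dvd_sub] at h1
  obtain ⟨m, hm⟩ := h1
  have hpi := Real.pi_pos
  have h2 : ((k : ℝ) - l) = n * m := by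
    field_simp at hm
    linarith
  have h3 : (k : ℤ) - l = n * m := by exact_mod_cast h2
  have h4 : |(k : ℤ) - l| < n := by rw [abs_lt]; omega
  rw [h3, abs_mul, Nat.abs_cast] at h4
  have h5 : |m| < 1 := by
    by_contra hcon
    push Not at hcon
    nlinarith
  rw [Int.abs_lt_one_iff] at h5
  subst h5
  omega

/-- The rotations and the half-turns. -/
def enumDihedral (n : ℕ) : Fin n ⊕ Fin n → dihedral n :=
  Sum.elim (fun k => rotGen n ^ (k : ℕ)) (fun k => rotGen n ^ (k : ℕ) * flipGen n)

theorem rotMat_add_mul_two_pi (α : ℝ) (m : ℤ) : rotMat (α + m * (2 * Real.pi)) = rotMat α := by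
  simp [rotMat, Real.cos_add_int_mul_two_pi, Real.sin_add_int_mul_two_pi]

theorem flipMat_add_mul_two_pi (α : ℝ) (m : ℤ) : flipMat (α + m * (2 * Real.pi)) = flipMat α := by
  simp [flipMat, Real.cos_add_int_mul_two_pi, Real.sin_add_int_mul_two_pi]

theorem coe_inv_mat (g : Matrix.specialOrthogonalGroup (Fin 3) ℝ) :
    ((g⁻¹ : Matrix.specialOrthogonalGroup (Fin 3) ℝ) : Matrix (Fin 3) (Fin 3) ℝ) =
      (g : Matrix (Fin 3) (Fin 3) ℝ).transpose := rfl

/-- Rotations and half-turns with parameters in `(2π / n) ℤ` contain the generators and are closed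
under products; transposition negates the angle of a rotation and fixes the symmetric matrix of a
half-turn. -/
theorem exists_int_rotMat_or_flipMat (g : dihedral n) :
    ∃ k : ℤ, (g : Matrix (Fin 3) (Fin 3) ℝ) = rotMat (k * (2 * Real.pi / n)) ∨
      (g : Matrix (Fin 3) (Fin 3) ℝ) = flipMat (k * (2 * Real.pi / n)) := by
  obtain ⟨g, hg⟩ := g
  induction hg using Subgroup.closure_induction with
  | mem x hx =>
    rcases hx with rfl | rfl
    · exact ⟨1, Or.inl (by simp [matA_eq])⟩
    · exact ⟨0, Or.inr (by simp [matB_eq])⟩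
  | one => exact ⟨0, Or.inl (by simp [rotMat_zero])⟩
  | mul x y hx hy ihx ihy =>
    obtain ⟨k, hk⟩ := ihx
    obtain ⟨l, hl⟩ := ihy
    simp only [Submonoid.coe_mul] at hk hl ⊢
    rcases hk with hk | hk <;> rcases hl with hl | hl <;> rw [hk, hl]
    · exact ⟨k + l, Or.inl (by rw [rotMat_mul_rotMat]; congr 1; push_cast; ring)⟩
    · exact ⟨k + l, Or.inr (by rw [rotMat_mul_flipMat]; congr 1; push_cast; ring)⟩
    · exact ⟨k - l, Or.inr (by rw [flipMat_mul_rotMat]; congr 1; push_cast; ring)⟩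
    · exact ⟨k - l, Or.inl (by rw [flipMat_mul_flipMat]; congr 1; push_cast; ring)⟩
  | inv x hx ih =>
    obtain ⟨k, hk⟩ := ih
    simp only [coe_inv_mat] at hk ⊢
    rcases hk with hk | hk <;> rw [hk]
    · refine ⟨-k, Or.inl ?_⟩
      ext i j
      fin_cases i <;> fin_cases j <;> simp [rotMat]
    · refine ⟨k, Or.inr ?_⟩
      ext i j
      fin_cases i <;> fin_cases j <;> simp [flipMat]

theorem exists_nat_lt_angle (hn : n ≠ 0) (k : ℤ) : ∃ l : ℕ, l < n ∧ ∃ m : ℤ,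
    k * (2 * Real.pi / n) = l * (2 * Real.pi / n) + m * (2 * Real.pi) := by
  have hn' : (n : ℤ) ≠ 0 := by exact_mod_cast hn
  refine ⟨(k % n).toNat, ?_, k / n, ?_⟩
  · have := Int.emod_lt_of_pos k (show (0 : ℤ) < n by omega)
    have := Int.emod_nonneg k hn'
    omega
  · have h1 : ((k % n).toNat : ℤ) = k % n := Int.toNat_of_nonneg (Int.emod_nonneg k hn')
    have h2 : (((k % n).toNat : ℤ) : ℝ) = ((k % n : ℤ) : ℝ) := by rw [h1]
    have h3 : (k : ℝ) = ((k % n : ℤ) : ℝ) + n * ((k / n : ℤ) : ℝ) := by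
      exact_mod_cast (Int.emod_add_mul_ediv k n).symm
    rw [Int.cast_natCast] at h2
    have hn0 : (n : ℝ) ≠ 0 := by exact_mod_cast hn
    rw [h2, h3]
    field_simp

theorem exists_rot_or_flip (hn : n ≠ 0) (g : dihedral n) :
    (∃ k < n, g = rotGen n ^ k) ∨ ∃ k < n, g = rotGen n ^ k * flipGen n := by
  obtain ⟨k, hk⟩ := exists_int_rotMat_or_flipMat g
  obtain ⟨l, hl, m, hm⟩ := exists_nat_lt_angle hn k
  rw [hm, rotMat_add_mul_two_pi, flipMat_add_mul_two_pi] at hk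
  rcases hk with hk | hk
  · exact Or.inl ⟨l, hl, coe_inj_mat (by rw [hk, coe_rotGen_pow])⟩
  · exact Or.inr ⟨l, hl, coe_inj_mat (by rw [hk, coe_rotGen_pow_mul_flipGen])⟩

theorem rotGen_pow_ne_mul_flipGen (k l : ℕ) : rotGen n ^ k ≠ rotGen n ^ l * flipGen n := by
  intro h
  have h1 : ((rotGen n ^ k : dihedral n) : Matrix (Fin 3) (Fin 3) ℝ) =
    ((rotGen n ^ l * flipGen n : dihedral n) : Matrix (Fin 3) (Fin 3) ℝ) := by rw [h]
  rw [coe_rotGen_pow, coe_rotGen_pow_mul_flipGen] at h1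
  have := congrFun (congrFun h1 2) 2
  simp [rotMat, flipMat] at this
  linarith

theorem bijective_enumDihedral (hn : n ≠ 0) : Function.Bijective (enumDihedral n) := by
  have key : ∀ k l : Fin n, rotGen n ^ (k : ℕ) = rotGen n ^ (l : ℕ) → k = l := by
    intro k l h
    have h1 : ((rotGen n ^ (k : ℕ) : dihedral n) : Matrix (Fin 3) (Fin 3) ℝ) =
      ((rotGen n ^ (l : ℕ) : dihedral n) : Matrix (Fin 3) (Fin 3) ℝ) := by rw [h]
    rw [coe_rotGen_pow, coe_rotGen_pow] at h1
    exact Fin.ext (rotGen_pow_inj k.2 l.2 h1)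
  constructor
  · rintro (k | k) (l | l) h
    · exact congrArg _ (key k l h)
    · exact absurd h (rotGen_pow_ne_mul_flipGen _ _)
    · exact absurd h.symm (rotGen_pow_ne_mul_flipGen _ _)
    · exact congrArg _ (key k l (mul_right_cancel h))
  · intro g
    rcases exists_rot_or_flip hn g with ⟨k, hk, rfl⟩ | ⟨k, hk, rfl⟩
    · exact ⟨Sum.inl ⟨k, hk⟩, rfl⟩
    · exact ⟨Sum.inr ⟨k, hk⟩, rfl⟩

theorem natCard_dihedral (hn : n ≠ 0) : Nat.card (dihedral n) = 2 * n := by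
  rw [← Nat.card_congr (Equiv.ofBijective _ (bijective_enumDihedral hn))]
  simp [two_mul]

theorem finite_dihedral (hn : n ≠ 0) : Finite (dihedral n) :=
  Finite.of_equiv _ (Equiv.ofBijective _ (bijective_enumDihedral hn))

theorem sum_dihedral [Fintype (dihedral n)] (hn : n ≠ 0) (f : dihedral n → ℝ) :
    ∑ γ, f γ = ∑ k : Fin n, f (rotGen n ^ (k : ℕ))
      + ∑ k : Fin n, f (rotGen n ^ (k : ℕ) * flipGen n) := by
  rw [← (Equiv.ofBijective _ (bijective_enumDihedral hn)).sum_comp, Fintype.sum_sum_type]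
  rfl


/-! ### Derivatives of the reduced energy -/

/-- Points with trivial stabilizer. -/
def IsFree (n : ℕ) (u : R3) : Prop := ∀ γ : dihedral n, γ ≠ 1 → act γ u ≠ u

/-- The derivative of `logSum` at `u` in the direction `a`. -/
def logSumDeriv (n : ℕ) [Fintype (dihedral n)] (u a : R3) : ℝ :=
  ∑ γ : dihedral n, 2 * inner ℝ (u - act γ u) (a - act γ a) / ‖u - act γ u‖ ^ 2

/-- The second derivative of `logSum` along the great circle through `u` with unit velocity `a`. -/
def logSumDeriv₂ (n : ℕ) [Fintype (dihedral n)] (u a : R3) : ℝ :=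
  ∑ γ : dihedral n, ((2 * inner ℝ (a - act γ a) (a - act γ a)
      + 2 * inner ℝ (u - act γ u) (-u - act γ (-u))) * ‖u - act γ u‖ ^ 2
      - 2 * inner ℝ (u - act γ u) (a - act γ a) * (2 * inner ℝ (u - act γ u) (a - act γ a)))
      / (‖u - act γ u‖ ^ 2) ^ 2

theorem IsFree.normSq_ne_zero {u : R3} (hu : IsFree n u) {γ : dihedral n} (hγ : γ ≠ 1) :
    ‖u - act γ u‖ ^ 2 ≠ 0 :=
  pow_ne_zero _ (norm_ne_zero_iff.mpr (sub_ne_zero.mpr (hu γ hγ).symm))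

theorem hasDerivAt_sub_act {c : ℝ → R3} {c' : R3} {t : ℝ} (hc : HasDerivAt c c' t)
    (γ : dihedral n) : HasDerivAt (fun s => c s - act γ (c s)) (c' - act γ c') t :=
  hc.sub ((actL γ).hasFDerivAt.comp_hasDerivAt t hc)

theorem hasDerivAt_normSq_sub_act {c : ℝ → R3} {c' : R3} {t : ℝ} (hc : HasDerivAt c c' t)
    (γ : dihedral n) : HasDerivAt (fun s => ‖c s - act γ (c s)‖ ^ 2)
      (2 * inner ℝ (c t - act γ (c t)) (c' - act γ c')) t :=
  (hasDerivAt_sub_act hc γ).norm_sq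

theorem hasDerivAt_logSum [Fintype (dihedral n)] {c : ℝ → R3} {c' : R3} {t : ℝ}
    (hc : HasDerivAt c c' t) (hf : IsFree n (c t)) :
    HasDerivAt (fun s => logSum n (c s)) (logSumDeriv n (c t) c') t := by
  refine HasDerivAt.fun_sum fun γ _ => ?_
  -- The identity contributes the constant `log 0 = 0`, so no singularity arises from it.
  by_cases hγ : γ = 1
  · subst hγ
    simpa [act_one] using hasDerivAt_const t (0 : ℝ)
  · exact (hasDerivAt_normSq_sub_act hc γ).log (hf.normSq_ne_zero hγ)

/-- The assumption on `a` is the equation `c'' = -c` of a great circle; it will be applied to the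
radial geodesics `polarPt` with velocity `radVec`. -/
theorem hasDerivAt_logSumDeriv [Fintype (dihedral n)] {c a : ℝ → R3} {t : ℝ}
    (hc : HasDerivAt c (a t) t) (ha : HasDerivAt a (-c t) t) (hf : IsFree n (c t)) :
    HasDerivAt (fun s => logSumDeriv n (c s) (a s)) (logSumDeriv₂ n (c t) (a t)) t := by
  refine HasDerivAt.fun_sum fun γ _ => ?_
  by_cases hγ : γ = 1
  · subst hγ
    simpa [act_one] using hasDerivAt_const t (0 : ℝ)
  · have h1 := ((hasDerivAt_sub_act hc γ).inner ℝ (hasDerivAt_sub_act ha γ)).const_mul 2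
    refine (h1.div (hasDerivAt_normSq_sub_act hc γ) (hf.normSq_ne_zero hγ)).congr_deriv ?_
    ring

theorem contDiffAt_logSum [Fintype (dihedral n)] {u : R3} (hf : IsFree n u) :
    ContDiffAt ℝ 1 (logSum n) u := by
  refine ContDiffAt.sum fun γ _ => ?_
  by_cases hγ : γ = 1
  · subst hγ
    simpa [act_one] using contDiffAt_const
  · refine ContDiffAt.log ?_ (hf.normSq_ne_zero hγ)
    exact (contDiffAt_id.sub (actL γ).contDiff.contDiffAt).norm_sq ℝ

theorem continuousAt_logSumDeriv [Fintype (dihedral n)] {X : Type*} [TopologicalSpace X]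
    {c a : X → R3} {x : X} (hc : ContinuousAt c x) (ha : ContinuousAt a x)
    (hf : IsFree n (c x)) : ContinuousAt (fun y => logSumDeriv n (c y) (a y)) x := by
  refine tendsto_finsetSum _ fun γ _ => ?_
  by_cases hγ : γ = 1
  · subst hγ
    simp [act_one]
  · have h1 : ContinuousAt (fun y => c y - act γ (c y)) x :=
      hc.sub ((continuous_act γ).continuousAt.comp hc)
    have h2 : ContinuousAt (fun y => a y - act γ (a y)) x :=
      ha.sub ((continuous_act γ).continuousAt.comp ha)
    exact ((h1.inner h2).const_mul 2).div (h1.norm.pow 2) (hf.normSq_ne_zero hγ)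

theorem continuousAt_logSumDeriv₂ [Fintype (dihedral n)] {X : Type*} [TopologicalSpace X]
    {c a : X → R3} {x : X} (hc : ContinuousAt c x) (ha : ContinuousAt a x)
    (hf : IsFree n (c x)) : ContinuousAt (fun y => logSumDeriv₂ n (c y) (a y)) x := by
  refine tendsto_finsetSum _ fun γ _ => ?_
  by_cases hγ : γ = 1
  · subst hγ
    simp [act_one]
  · have h1 : ContinuousAt (fun y => c y - act γ (c y)) x :=
      hc.sub ((continuous_act γ).continuousAt.comp hc)
    have h2 : ContinuousAt (fun y => a y - act γ (a y)) x :=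
      ha.sub ((continuous_act γ).continuousAt.comp ha)
    have h3 : ContinuousAt (fun y => -c y - act γ (-c y)) x :=
      hc.neg.sub ((continuous_act γ).continuousAt.comp hc.neg)
    have h12 := (h1.inner (𝕜 := ℝ) h2).const_mul 2
    exact (((((h2.inner h2).const_mul 2).add ((h1.inner h3).const_mul 2)).mul
      (h1.norm.pow 2)).sub (h12.mul h12)).div ((h1.norm.pow 2).pow 2)
      (pow_ne_zero 2 (hf.normSq_ne_zero hγ))

theorem logSumDeriv_smul [Fintype (dihedral n)] (c : ℝ) (u a : R3) :
    logSumDeriv n u (c • a) = c * logSumDeriv n u a := by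
  simp only [logSumDeriv, Finset.mul_sum, act_smul, ← smul_sub, inner_smul_right]
  exact Finset.sum_congr rfl fun _ _ => by ring

/-- For `a` orthogonal to `u`, the product of `u - γ u` and `a - γ a` is minus the sum of the
products of `a` with `γ u` and with `γ⁻¹ u`. As `γ` and `γ⁻¹` move `u` equally far, the two
resulting sums agree. -/
theorem logSumDeriv_eq [Fintype (dihedral n)] {u a : R3} (h : inner ℝ u a = 0) :
    logSumDeriv n u a = -4 * ∑ γ : dihedral n, inner ℝ (act γ u) a / ‖u - act γ u‖ ^ 2 := by
  have h1 : ∑ γ : dihedral n, inner ℝ (act γ⁻¹ u) a / ‖u - act γ⁻¹ u‖ ^ 2 =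
      ∑ γ : dihedral n, inner ℝ (act γ u) a / ‖u - act γ u‖ ^ 2 :=
    Equiv.sum_comp (Equiv.inv (dihedral n))
      fun γ => inner ℝ (act γ u) a / ‖u - act γ u‖ ^ 2
  have h2 : ∀ γ : dihedral n, 2 * inner ℝ (u - act γ u) (a - act γ a) / ‖u - act γ u‖ ^ 2 =
      -2 * (inner ℝ (act γ u) a / ‖u - act γ u‖ ^ 2)
        + -2 * (inner ℝ (act γ⁻¹ u) a / ‖u - act γ⁻¹ u‖ ^ 2) := by
    intro γ
    have h3 : ‖u - act γ⁻¹ u‖ = ‖u - act γ u‖ := by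
      rw [← norm_act γ, act_sub, act_act_inv, norm_sub_rev]
    rw [h3, inner_sub_left, inner_sub_right, inner_sub_right, inner_act_act, h, inner_act_inv]
    ring
  rw [logSumDeriv, Finset.sum_congr rfl fun γ _ => h2 γ, Finset.sum_add_distrib,
    ← Finset.mul_sum, ← Finset.mul_sum, h1]
  ring

/-- The Hamiltonian structure: in an orthonormal tangent frame with `a × b = u` the right-hand side
is a quarter of `u × ∇ logSum`. The triple product formula resolves `w × u` along `a` and `b`, and
`logSumDeriv_eq` identifies the coefficients. -/
theorem reducedField_eq [Fintype (dihedral n)] {u a b : R3} (hab : cross a b = u)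
    (ha : inner ℝ u a = 0) (hb : inner ℝ u b = 0) :
    reducedField n u = (logSumDeriv n u a / 4) • b - (logSumDeriv n u b / 4) • a := by
  have h : ∀ w : R3, cross w u = inner ℝ w b • a - inner ℝ w a • b := fun w => by
    rw [← cross_cross_right, hab]
  rw [logSumDeriv_eq ha, logSumDeriv_eq hb, reducedField]
  simp only [h, smul_sub, smul_smul, Finset.sum_sub_distrib, ← Finset.sum_smul]
  have e : ∀ w : R3, ∑ γ : dihedral n, inner ℝ (act γ u) w / ‖u - act γ u‖ ^ 2 =
      ∑ γ : dihedral n, (‖u - act γ u‖ ^ 2)⁻¹ * inner ℝ (act γ u) w := fun w =>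
    Finset.sum_congr rfl fun _ _ => by rw [div_eq_inv_mul]
  rw [e, e]
  module

/-! ### Geodesic polar coordinates -/

/-- Positively oriented orthonormal frames. -/
structure IsFrame (e₁ e₂ p : R3) : Prop where
  inner₁₁ : inner ℝ e₁ e₁ = 1
  inner₂₂ : inner ℝ e₂ e₂ = 1
  inner₁₂ : inner ℝ e₁ e₂ = 0
  cross_eq : cross e₁ e₂ = p

/-- The unit tangent vector making the angle `φ` with `e₁`. -/
def dirVec (e₁ e₂ : R3) (φ : ℝ) : R3 := Real.cos φ • e₁ + Real.sin φ • e₂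

/-- The point with geodesic polar coordinates `(ρ, φ)` around `p`. -/
def polarPt (e₁ e₂ p : R3) (ρ φ : ℝ) : R3 := Real.sin ρ • dirVec e₁ e₂ φ + Real.cos ρ • p

/-- The unit radial vector field of geodesic polar coordinates. -/
def radVec (e₁ e₂ p : R3) (ρ φ : ℝ) : R3 := Real.cos ρ • dirVec e₁ e₂ φ - Real.sin ρ • p

/-- The unit angular vector field of geodesic polar coordinates. -/
def angVec (e₁ e₂ : R3) (φ : ℝ) : R3 := -Real.sin φ • e₁ + Real.cos φ • e₂

theorem inner_cross_left (x y : R3) : inner ℝ x (cross x y) = 0 := by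
  simp only [inner_eq_sum, cross_zero_coord, cross_one_coord, cross_two_coord]; ring

theorem inner_cross_right (x y : R3) : inner ℝ y (cross x y) = 0 := by
  simp only [inner_eq_sum, cross_zero_coord, cross_one_coord, cross_two_coord]; ring

theorem inner_cross_self (x y : R3) : inner ℝ (cross x y) (cross x y) =
    inner ℝ x x * inner ℝ y y - inner ℝ x y ^ 2 := by
  simp only [inner_eq_sum, cross_zero_coord, cross_one_coord, cross_two_coord]; ring

theorem cross_add_left (x y z : R3) : cross (x + y) z = cross x z + cross y z := by
  apply ext_coord <;> simp [cross_zero_coord, cross_one_coord, cross_two_coord] <;> ring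

theorem cross_sub_left (x y z : R3) : cross (x - y) z = cross x z - cross y z := by
  apply ext_coord <;> simp [cross_zero_coord, cross_one_coord, cross_two_coord] <;> ring

theorem cross_add_right (x y z : R3) : cross z (x + y) = cross z x + cross z y := by
  apply ext_coord <;> simp [cross_zero_coord, cross_one_coord, cross_two_coord] <;> ring

theorem cross_smul_right (c : ℝ) (x y : R3) : cross x (c • y) = c • cross x y := by
  apply ext_coord <;> simp [cross_zero_coord, cross_one_coord, cross_two_coord] <;> ring

theorem norm_eq_one_of_inner_self {x : R3} (h : inner ℝ x x = 1) : ‖x‖ = 1 := by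
  rw [real_inner_self_eq_norm_sq] at h
  exact (pow_eq_one_iff_of_nonneg (norm_nonneg _) two_ne_zero).mp h

namespace IsFrame

variable {e₁ e₂ p : R3}

theorem inner₁₃ (hF : IsFrame e₁ e₂ p) : inner ℝ e₁ p = 0 := by rw [← hF.cross_eq, inner_cross_left]

theorem inner₂₃ (hF : IsFrame e₁ e₂ p) : inner ℝ e₂ p = 0 := by rw [← hF.cross_eq, inner_cross_right]

theorem inner₂₁ (hF : IsFrame e₁ e₂ p) : inner ℝ e₂ e₁ = 0 := by rw [real_inner_comm, hF.inner₁₂]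

theorem inner₃₁ (hF : IsFrame e₁ e₂ p) : inner ℝ p e₁ = 0 := by rw [real_inner_comm, hF.inner₁₃]

theorem inner₃₂ (hF : IsFrame e₁ e₂ p) : inner ℝ p e₂ = 0 := by rw [real_inner_comm, hF.inner₂₃]

theorem inner₃₃ (hF : IsFrame e₁ e₂ p) : inner ℝ p p = 1 := by
  rw [← hF.cross_eq, inner_cross_self, hF.inner₁₁, hF.inner₂₂, hF.inner₁₂]; norm_num

theorem norm₁ (hF : IsFrame e₁ e₂ p) : ‖e₁‖ = 1 := norm_eq_one_of_inner_self hF.inner₁₁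

theorem norm₂ (hF : IsFrame e₁ e₂ p) : ‖e₂‖ = 1 := norm_eq_one_of_inner_self hF.inner₂₂

theorem norm₃ (hF : IsFrame e₁ e₂ p) : ‖p‖ = 1 := norm_eq_one_of_inner_self hF.inner₃₃

theorem cross₂₃ (hF : IsFrame e₁ e₂ p) : cross e₂ p = e₁ := by
  rw [← hF.cross_eq, cross_cross_right, hF.inner₂₂, hF.inner₂₁]; simp

theorem cross₁₃ (hF : IsFrame e₁ e₂ p) : cross e₁ p = -e₂ := by
  rw [← hF.cross_eq, cross_cross_right, hF.inner₁₁, hF.inner₁₂]; simp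

theorem orthonormal (hF : IsFrame e₁ e₂ p) : Orthonormal ℝ ![e₁, e₂, p] := by
  rw [orthonormal_iff_ite]
  intro i j
  fin_cases i <;> fin_cases j <;>
    simp [hF.norm₁, hF.norm₂, hF.norm₃, hF.inner₁₂, hF.inner₁₃, hF.inner₂₃, hF.inner₂₁,
      hF.inner₃₁, hF.inner₃₂]

theorem inner_dirVec₃ (hF : IsFrame e₁ e₂ p) (φ : ℝ) : inner ℝ (dirVec e₁ e₂ φ) p = 0 := by
  simp [dirVec, inner_add_left, inner_smul_left, hF.inner₁₃, hF.inner₂₃]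

theorem inner_dirVec (hF : IsFrame e₁ e₂ p) (φ ψ : ℝ) : inner ℝ (dirVec e₁ e₂ φ) (dirVec e₁ e₂ ψ) =
    Real.cos (φ - ψ) := by
  simp only [dirVec, inner_add_left, inner_add_right, inner_smul_left, inner_smul_right,
    hF.inner₁₁, hF.inner₂₂, hF.inner₁₂, hF.inner₂₁, Real.cos_sub]
  simp
  ring

theorem inner_polarPt_polarPt (hF : IsFrame e₁ e₂ p) (ρ φ : ℝ) :
    inner ℝ (polarPt e₁ e₂ p ρ φ) (polarPt e₁ e₂ p ρ φ) = 1 := by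
  have h1 : inner ℝ p (dirVec e₁ e₂ φ) = 0 := by rw [real_inner_comm, hF.inner_dirVec₃]
  have h2 := hF.inner_dirVec φ φ
  have h := Real.sin_sq_add_cos_sq ρ
  simp only [polarPt, inner_add_left, inner_add_right, inner_smul_left, inner_smul_right, h1, h2,
    hF.inner_dirVec₃, hF.inner₃₃]
  simp
  linarith

theorem norm_polarPt (hF : IsFrame e₁ e₂ p) (ρ φ : ℝ) : ‖polarPt e₁ e₂ p ρ φ‖ = 1 :=
  norm_eq_one_of_inner_self (hF.inner_polarPt_polarPt ρ φ)

theorem inner_polarPt₃ (hF : IsFrame e₁ e₂ p) (ρ φ : ℝ) : inner ℝ p (polarPt e₁ e₂ p ρ φ) = Real.cos ρ := by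
  have h1 : inner ℝ p (dirVec e₁ e₂ φ) = 0 := by rw [real_inner_comm, hF.inner_dirVec₃]
  simp [polarPt, inner_add_right, inner_smul_right, h1, hF.norm₃]

theorem inner_polarPt₁ (hF : IsFrame e₁ e₂ p) (ρ φ : ℝ) :
    inner ℝ e₁ (polarPt e₁ e₂ p ρ φ) = Real.sin ρ * Real.cos φ := by
  simp only [polarPt, dirVec, inner_add_right, inner_smul_right, hF.inner₁₃, hF.inner₁₁,
    hF.inner₁₂]
  ring

theorem inner_polarPt₂ (hF : IsFrame e₁ e₂ p) (ρ φ : ℝ) :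
    inner ℝ e₂ (polarPt e₁ e₂ p ρ φ) = Real.sin ρ * Real.sin φ := by
  simp only [polarPt, dirVec, inner_add_right, inner_smul_right, hF.inner₂₃, hF.inner₂₁,
    hF.inner₂₂]
  ring

theorem cross_dirVec_angVec (hF : IsFrame e₁ e₂ p) (φ : ℝ) : cross (dirVec e₁ e₂ φ) (angVec e₁ e₂ φ) = p := by
  have h21 : cross e₂ e₁ = -p := by rw [cross_comm_neg, hF.cross_eq]
  simp only [dirVec, angVec, cross_add_left, cross_add_right, cross_smul_left, cross_smul_right,
    cross_self_eq, hF.cross_eq, h21]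
  have h := Real.sin_sq_add_cos_sq φ
  calc _ = (Real.sin φ ^ 2 + Real.cos φ ^ 2) • p := by module
    _ = p := by rw [h, one_smul]

theorem cross_radVec_angVec (hF : IsFrame e₁ e₂ p) (ρ φ : ℝ) :
    cross (radVec e₁ e₂ p ρ φ) (angVec e₁ e₂ φ) = polarPt e₁ e₂ p ρ φ := by
  have h31 : cross p e₁ = e₂ := by rw [cross_comm_neg, hF.cross₁₃, neg_neg]
  have h32 : cross p e₂ = -e₁ := by rw [cross_comm_neg, hF.cross₂₃]
  have h3 : cross p (angVec e₁ e₂ φ) = -dirVec e₁ e₂ φ := by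
    simp only [dirVec, angVec, cross_add_right, cross_smul_right, h31, h32]
    module
  rw [radVec, cross_sub_left, cross_smul_left, cross_smul_left, hF.cross_dirVec_angVec, h3,
    polarPt]
  module

theorem inner_polarPt_radVec (hF : IsFrame e₁ e₂ p) (ρ φ : ℝ) :
    inner ℝ (polarPt e₁ e₂ p ρ φ) (radVec e₁ e₂ p ρ φ) = 0 := by
  rw [real_inner_comm, ← hF.cross_radVec_angVec, inner_cross_left]

theorem inner_polarPt_angVec (hF : IsFrame e₁ e₂ p) (ρ φ : ℝ) :
    inner ℝ (polarPt e₁ e₂ p ρ φ) (angVec e₁ e₂ φ) = 0 := by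
  rw [real_inner_comm, ← hF.cross_radVec_angVec, inner_cross_right]

theorem norm_dirVec (hF : IsFrame e₁ e₂ p) (φ : ℝ) : ‖dirVec e₁ e₂ φ‖ = 1 :=
  norm_eq_one_of_inner_self (by rw [hF.inner_dirVec, sub_self, Real.cos_zero])

theorem norm_radVec (hF : IsFrame e₁ e₂ p) (ρ φ : ℝ) : ‖radVec e₁ e₂ p ρ φ‖ = 1 := by
  have h : radVec e₁ e₂ p ρ φ = polarPt e₁ e₂ p (ρ + Real.pi / 2) φ := by
    simp [radVec, polarPt, Real.sin_add_pi_div_two, Real.cos_add_pi_div_two]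
    module
  rw [h, hF.norm_polarPt]

/-- A chord is no longer than its arc: the squared chord `2 - 2 cos ρ` is at most `ρ²`. -/
theorem dist_polarPt_center (hF : IsFrame e₁ e₂ p) (ρ φ : ℝ) : dist (polarPt e₁ e₂ p ρ φ) p ≤ |ρ| := by
  have h1 : ‖polarPt e₁ e₂ p ρ φ - p‖ ^ 2 ≤ ρ ^ 2 := by
    rw [norm_sub_sq_real, real_inner_comm, hF.inner_polarPt₃, hF.norm_polarPt, hF.norm₃]
    nlinarith [Real.one_sub_sq_div_two_le_cos (x := ρ)]
  rw [dist_eq_norm, ← abs_norm]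
  exact sq_le_sq.mp h1

/-- Expansion of a vector in an orthonormal frame. -/
theorem expansion (hF : IsFrame e₁ e₂ p) (w : R3) :
    w = inner ℝ e₁ w • e₁ + inner ℝ e₂ w • e₂ + inner ℝ p w • p := by
  have hc : Fintype.card (Fin 3) = Module.finrank ℝ R3 := by simp
  let b := (basisOfOrthonormalOfCardEqFinrank hF.orthonormal hc)
  have hb : ⇑b = ![e₁, e₂, p] := coe_basisOfOrthonormalOfCardEqFinrank _ _
  let b' := b.toOrthonormalBasis (by rw [hb]; exact hF.orthonormal)
  have h := b'.sum_repr' w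
  have hb' : ⇑b' = ![e₁, e₂, p] := by rw [Module.Basis.coe_toOrthonormalBasis, hb]
  rw [hb', Fin.sum_univ_three] at h
  exact h.symm

/-- An isometry fixing `p` preserves the unit circle of the tangent plane; `ψ` is the argument of
the image, read as a complex number in the basis `e₁, e₂`. -/
theorem exists_act_dirVec (hF : IsFrame e₁ e₂ p) {g : dihedral n} (hg : SphereVortex.act g p = p) (φ : ℝ) :
    ∃ ψ, SphereVortex.act g (dirVec e₁ e₂ φ) = dirVec e₁ e₂ ψ := by
  set w := SphereVortex.act g (dirVec e₁ e₂ φ) with hw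
  have h3 : inner ℝ p w = 0 := by
    rw [← hg, hw, inner_act_act, real_inner_comm, hF.inner_dirVec₃]
  have h := hF.expansion w
  rw [h3, zero_smul, add_zero] at h
  have hn : inner ℝ w w = 1 := by rw [hw, inner_act_act, hF.inner_dirVec]; simp
  have hsq : inner ℝ e₁ w ^ 2 + inner ℝ e₂ w ^ 2 = 1 := by
    nth_rw 2 [h] at hn
    rw [inner_add_right, inner_smul_right, inner_smul_right, real_inner_comm e₁,
      real_inner_comm e₂] at hn
    linarith
  set z : ℂ := ⟨inner ℝ e₁ w, inner ℝ e₂ w⟩ with hz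
  have hz1 : ‖z‖ = 1 := by
    rw [Complex.norm_def, Complex.normSq_apply]
    simp only [hz]
    rw [← sq, ← sq, hsq, Real.sqrt_one]
  refine ⟨Complex.arg z, ?_⟩
  have hz0 : z ≠ 0 := by intro h0; rw [h0] at hz1; simp at hz1
  rw [h, dirVec, Complex.cos_arg hz0, Complex.sin_arg, hz1]
  simp [hz]

theorem exists_act_polarPt (hF : IsFrame e₁ e₂ p) {g : dihedral n} (hg : SphereVortex.act g p = p) (φ : ℝ) :
    ∃ ψ, ∀ ρ, SphereVortex.act g (polarPt e₁ e₂ p ρ φ) = polarPt e₁ e₂ p ρ ψ := by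
  obtain ⟨ψ, hψ⟩ := hF.exists_act_dirVec hg φ
  exact ⟨ψ, fun ρ => by rw [polarPt, act_add, act_smul, act_smul, hψ, hg, polarPt]⟩

end IsFrame

/-! ### Derivatives, continuity and periodicity of polar coordinates -/

section Calculus

variable (e₁ e₂ p : R3)

theorem hasDerivAt_dirVec (φ : ℝ) : HasDerivAt (dirVec e₁ e₂) (angVec e₁ e₂ φ) φ :=
  ((Real.hasDerivAt_cos φ).smul_const e₁).add ((Real.hasDerivAt_sin φ).smul_const e₂)

theorem hasDerivAt_polarPt_left (ρ φ : ℝ) :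
    HasDerivAt (fun r => polarPt e₁ e₂ p r φ) (radVec e₁ e₂ p ρ φ) ρ :=
  (((Real.hasDerivAt_sin ρ).smul_const _).add ((Real.hasDerivAt_cos ρ).smul_const p)).congr_deriv
    (by rw [radVec]; module)

theorem hasDerivAt_radVec_left (ρ φ : ℝ) :
    HasDerivAt (fun r => radVec e₁ e₂ p r φ) (-polarPt e₁ e₂ p ρ φ) ρ :=
  (((Real.hasDerivAt_cos ρ).smul_const _).sub ((Real.hasDerivAt_sin ρ).smul_const p)).congr_deriv
    (by rw [polarPt]; module)

theorem hasDerivAt_polarPt_right (ρ φ : ℝ) :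
    HasDerivAt (fun r => polarPt e₁ e₂ p ρ r) (Real.sin ρ • angVec e₁ e₂ φ) φ :=
  ((hasDerivAt_dirVec e₁ e₂ φ).const_smul (Real.sin ρ)).add_const _

theorem contDiff_polarPt : ContDiff ℝ 1 (fun x : ℝ × ℝ => polarPt e₁ e₂ p x.1 x.2) := by
  unfold polarPt dirVec
  fun_prop

theorem continuous_polarPt : Continuous (fun x : ℝ × ℝ => polarPt e₁ e₂ p x.1 x.2) :=
  (contDiff_polarPt e₁ e₂ p).continuous

theorem continuous_radVec : Continuous (fun x : ℝ × ℝ => radVec e₁ e₂ p x.1 x.2) := by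
  unfold radVec dirVec
  fun_prop

theorem dirVec_add_two_pi (φ : ℝ) : dirVec e₁ e₂ (φ + 2 * Real.pi) = dirVec e₁ e₂ φ := by
  simp [dirVec]

theorem polarPt_add_two_pi (ρ φ : ℝ) :
    polarPt e₁ e₂ p ρ (φ + 2 * Real.pi) = polarPt e₁ e₂ p ρ φ := by
  simp [polarPt, dirVec_add_two_pi]

theorem radVec_add_two_pi (ρ φ : ℝ) :
    radVec e₁ e₂ p ρ (φ + 2 * Real.pi) = radVec e₁ e₂ p ρ φ := by
  simp [radVec, dirVec_add_two_pi]

end Calculus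


/-! ### Level functions and changes of time -/

/-- An implicit function statement by monotonicity alone: if `b < R y`, then `F b y < 0`, a
condition that persists for `z` near `y` and forces `b < R z`; similarly from above. It yields the
continuity both of the radius and of the inverse time function jointly with the parameter. -/
theorem continuous_of_apply_eq_zero {Y : Type*} [TopologicalSpace Y] {S : Set ℝ} (hS : IsOpen S)
    {F : ℝ → Y → ℝ} {R : Y → ℝ} (hRS : ∀ y, R y ∈ S) (hF : ∀ r ∈ S, Continuous (F r))
    (hmono : ∀ y, StrictMonoOn (fun r => F r y) S) (h0 : ∀ y, F (R y) y = 0) :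
    Continuous R := by
  rw [continuous_iff_continuousAt]
  intro y
  obtain ⟨l, u, hlu, hsub⟩ := mem_nhds_iff_exists_Ioo_subset.mp (hS.mem_nhds (hRS y))
  refine tendsto_order.mpr ⟨fun a ha => ?_, fun a ha => ?_⟩
  · obtain ⟨b, hb1, hb2⟩ := exists_between (max_lt ha hlu.1)
    have hbS : b ∈ S := hsub ⟨(le_max_right _ _).trans_lt hb1, hb2.trans hlu.2⟩
    have h1 : F b y < 0 := by rw [← h0 y]; exact hmono y hbS (hRS y) hb2
    filter_upwards [(hF b hbS).continuousAt.eventually_lt_const h1] with z hz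
    rw [← h0 z] at hz
    exact ((le_max_left _ _).trans_lt hb1).trans (((hmono z).lt_iff_lt hbS (hRS z)).mp hz)
  · obtain ⟨b, hb1, hb2⟩ := exists_between (lt_min ha hlu.2)
    have hbS : b ∈ S := hsub ⟨hlu.1.trans hb1, hb2.trans_le (min_le_right _ _)⟩
    have h1 : 0 < F b y := by rw [← h0 y]; exact hmono y (hRS y) hbS hb1
    filter_upwards [(hF b hbS).continuousAt.eventually_const_lt h1] with z hz
    rw [← h0 z] at hz
    exact (((hmono z).lt_iff_lt (hRS z) hbS).mp hz).trans (hb2.trans_le (min_le_left _ _))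

/-- `w x φ` is the time spent per unit of angle. The time to reach the angle `φ` is its primitive,
which increases by `T x` with every turn; `Φ x` is the inverse function. -/
theorem exists_timeChange {X : Type*} [TopologicalSpace X] [FirstCountableTopology X]
    {w : X → ℝ → ℝ} (hw : Continuous (Function.uncurry w)) (hpos : ∀ x φ, 0 < w x φ)
    (hper : ∀ x φ, w x (φ + 2 * Real.pi) = w x φ) :
    ∃ (Φ : X → ℝ → ℝ) (T : X → ℝ), Continuous (Function.uncurry Φ) ∧ Continuous T ∧
      (∀ x, T x = ∫ φ in (0 : ℝ)..(2 * Real.pi), w x φ) ∧ (∀ x, 0 < T x) ∧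
      (∀ x t, HasDerivAt (Φ x) (w x (Φ x t))⁻¹ t) ∧
      (∀ x t, Φ x (t + T x) = Φ x t + 2 * Real.pi) ∧ (∀ x, StrictMono (Φ x)) ∧
      ∀ x, Function.Surjective (Φ x) := by
  have hpi := Real.two_pi_pos
  have hwx : ∀ x, Continuous (w x) := fun x => hw.comp (Continuous.prodMk_right x)
  set τ : X → ℝ → ℝ := fun x φ => ∫ ψ in (0 : ℝ)..φ, w x ψ with hτ
  have hint : ∀ x a b, IntervalIntegrable (w x) MeasureTheory.volume a b :=
    fun x a b => (hwx x).intervalIntegrable a b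
  have hτc : Continuous (Function.uncurry τ) :=
    intervalIntegral.continuous_parametric_primitive_of_continuous hw
  have hτd : ∀ x φ, HasDerivAt (τ x) (w x φ) φ := fun x φ =>
    (hwx x).integral_hasStrictDerivAt 0 φ |>.hasDerivAt
  have hτm : ∀ x, StrictMono (τ x) := fun x =>
    strictMono_of_hasDerivAt_pos (hτd x) (hpos x)
  have hτx : ∀ x, Continuous (τ x) := fun x => hτc.comp (Continuous.prodMk_right x)
  set T : X → ℝ := fun x => τ x (2 * Real.pi) with hT
  have hτ0 : ∀ x, τ x 0 = 0 := fun x => by simp [hτ]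
  have hTpos : ∀ x, 0 < T x := fun x => by rw [← hτ0 x]; exact hτm x hpi
  have hτadd : ∀ x φ, τ x (φ + 2 * Real.pi) = τ x φ + T x := by
    intro x φ
    have h1 := intervalIntegral.integral_add_adjacent_intervals (hint x 0 φ)
      (hint x φ (φ + 2 * Real.pi))
    have h2 := Function.Periodic.intervalIntegral_add_eq (f := w x) (hper x) φ 0
    rw [zero_add] at h2
    simp only [hτ, hT]
    rw [← h1, h2]
  have hsurj : ∀ x, Function.Surjective (τ x) := by
    intro x
    refine (hτx x).surjective ?_ ?_
    · exact Function.Periodic.tendsto_atTop_intervalIntegral_of_pos (T := 2 * Real.pi) (hper x)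
        (hTpos x) hpi
    · exact Function.Periodic.tendsto_atBot_intervalIntegral_of_pos (T := 2 * Real.pi) (hper x)
        (hTpos x) hpi
  set Φ : X → ℝ → ℝ := fun x => Function.surjInv (hsurj x) with hΦ
  have hτΦ : ∀ x t, τ x (Φ x t) = t := fun x t => Function.surjInv_eq (hsurj x) t
  have hΦτ : ∀ x φ, Φ x (τ x φ) = φ := fun x φ => (hτm x).injective (hτΦ x _)
  have hΦc : Continuous (Function.uncurry Φ) := by
    refine continuous_of_apply_eq_zero isOpen_univ (F := fun r y => τ y.1 r - y.2)
      (fun _ => mem_univ _) (fun r _ => ?_) (fun y => ?_) fun y => ?_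
    · exact (hτc.comp (continuous_fst.prodMk continuous_const)).sub continuous_snd
    · intro a _ b _ hab
      simpa using hτm y.1 hab
    · simp only [Function.uncurry, hτΦ, sub_self]
  refine ⟨Φ, T, hΦc, hτc.comp (continuous_id.prodMk continuous_const), fun _ => rfl, hTpos,
    fun x t => ?_, fun x t => ?_, fun x => ?_, fun x φ => ⟨_, hΦτ x φ⟩⟩
  · exact HasDerivAt.of_local_left_inverse (hΦc.comp (Continuous.prodMk_right x)).continuousAt
      (hτd x _) (hpos x _).ne' (Eventually.of_forall (hτΦ x))
  · apply (hτm x).injective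
    rw [hτΦ, hτadd, hτΦ]
  · intro a b hab
    rw [← hτΦ x a, ← hτΦ x b] at hab
    exact (hτm x).lt_iff_lt.mp hab

/-- Only continuity of `R` is assumed: local uniqueness in the implicit function theorem identifies
it with the differentiable solution. Differentiating the constant `F (R ψ, ψ)` then gives the slope.
-/
theorem hasDerivAt_of_level {F : ℝ × ℝ → ℝ} {R : ℝ → ℝ} {φ A B : ℝ}
    (hF : ContDiffAt ℝ 1 F (R φ, φ)) (hA : HasDerivAt (fun r => F (r, φ)) A (R φ))
    (hB : HasDerivAt (fun ψ => F (R φ, ψ)) B φ) (hA0 : A ≠ 0) (hR : ContinuousAt R φ)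
    (hlev : ∀ᶠ ψ in 𝓝 φ, F (R ψ, ψ) = F (R φ, φ)) : HasDerivAt R (-(B / A)) φ := by
  -- The variables are swapped since the implicit function theorem in use solves for the second one.
  set G : ℝ × ℝ → ℝ := fun x => F (x.2, x.1) with hG
  have hGc : ContDiffAt ℝ 1 G (φ, R φ) :=
    ContDiffAt.comp (φ, R φ) (g := F) hF (contDiff_snd.prodMk contDiff_fst).contDiffAt
  have hs := hGc.hasStrictFDerivAt one_ne_zero
  set G' := fderiv ℝ G (φ, R φ) with hG'
  have h2 : G' (0, 1) = A := by
    have := hs.hasFDerivAt.comp_hasDerivAt (R φ)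
      ((hasDerivAt_const (R φ) φ).prodMk (hasDerivAt_id (R φ)))
    exact this.unique hA
  have h1 : G' (1, 0) = B := by
    have := hs.hasFDerivAt.comp_hasDerivAt φ
      ((hasDerivAt_id φ).prodMk (hasDerivAt_const φ (R φ)))
    exact this.unique hB
  have hinv : (G' ∘L .inr ℝ ℝ ℝ).IsInvertible := by
    refine ⟨ContinuousLinearEquiv.unitsEquivAut ℝ (Units.mk0 A hA0), ?_⟩
    ext
    simp [h2]
  have hev := hs.eventually_apply_eq_iff_implicitFunctionOfProdDomain hinv
  have hd := (hs.hasStrictFDerivAt_implicitFunctionOfProdDomain hinv).hasFDerivAt.differentiableAt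
  have htend : Tendsto (fun ψ => (ψ, R ψ)) (𝓝 φ) (𝓝 (φ, R φ)) := continuousAt_id.prodMk hR
  have heq : hs.implicitFunctionOfProdDomain hinv =ᶠ[𝓝 φ] R := by
    filter_upwards [htend.eventually hev, hlev] with ψ h3 h4
    exact h3.mp h4
  have hRd : DifferentiableAt ℝ R φ := heq.differentiableAt_iff.mp hd
  have hcomp := hs.hasFDerivAt.comp_hasDerivAt φ ((hasDerivAt_id φ).prodMk hRd.hasDerivAt)
  have hzero : HasDerivAt (G ∘ fun ψ => (id ψ, R ψ)) 0 φ := by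
    refine (hasDerivAt_const φ (F (R φ, φ))).congr_of_eventuallyEq ?_
    filter_upwards [hlev] with ψ h3
    exact h3
  have h5 := hcomp.unique hzero
  have h6 : G' (1, deriv R φ) = B + deriv R φ * A := by
    have : ((1 : ℝ), deriv R φ) = (1, 0) + deriv R φ • ((0 : ℝ), (1 : ℝ)) := by simp
    rw [this, map_add, map_smul, h1, h2, smul_eq_mul]
  rw [h6] at h5
  have h7 : deriv R φ = -(B / A) := by field_simp; linarith
  rw [← h7]
  exact hRd.hasDerivAt


/-! ### Closed level curves in geodesic polar coordinates -/

theorem hasDerivAt_polarPt_comp (e₁ e₂ p : R3) {r θ : ℝ → ℝ} {r' θ' t : ℝ}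
    (hr : HasDerivAt r r' t) (hθ : HasDerivAt θ θ' t) :
    HasDerivAt (fun s => polarPt e₁ e₂ p (r s) (θ s))
      (r' • radVec e₁ e₂ p (r t) (θ t) + (θ' * Real.sin (r t)) • angVec e₁ e₂ (θ t)) t := by
  have h1 := hr.sin.smul ((hasDerivAt_dirVec e₁ e₂ (θ t)).scomp t hθ)
  have h2 := hr.cos.smul_const p
  refine (h1.add h2).congr_deriv ?_
  simp only [radVec, Function.comp]
  module

theorem strictMonoOn_logSum_polarPt [Fintype (dihedral n)] {e₁ e₂ p : R3} {ρ₀ σ : ℝ}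
    (hfree : ∀ ρ ∈ Ioo 0 ρ₀, ∀ φ, IsFree n (polarPt e₁ e₂ p ρ φ))
    (hmono : ∀ ρ ∈ Ioo 0 ρ₀, ∀ φ,
      0 < σ * logSumDeriv n (polarPt e₁ e₂ p ρ φ) (radVec e₁ e₂ p ρ φ)) (φ : ℝ) :
    StrictMonoOn (fun ρ => σ * logSum n (polarPt e₁ e₂ p ρ φ)) (Ioo 0 ρ₀) := by
  have hd : ∀ ρ ∈ Ioo 0 ρ₀, HasDerivAt (fun ρ => σ * logSum n (polarPt e₁ e₂ p ρ φ))
      (σ * logSumDeriv n (polarPt e₁ e₂ p ρ φ) (radVec e₁ e₂ p ρ φ)) ρ := fun ρ hρ =>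
    (hasDerivAt_logSum (hasDerivAt_polarPt_left e₁ e₂ p ρ φ) (hfree ρ hρ φ)).const_mul σ
  refine strictMonoOn_of_deriv_pos (convex_Ioo 0 ρ₀)
    (fun ρ hρ => (hd ρ hρ).continuousAt.continuousWithinAt) fun ρ hρ => ?_
  rw [interior_Ioo] at hρ
  rw [(hd ρ hρ).deriv]
  exact hmono ρ hρ φ

/-- A continuous family of closed orbits of the reduced field around `p`, one on each level curve
of the reduced energy, in geodesic polar coordinates: on the `x`-th curve the radius is `R x φ` at
the angle `φ`, and the angle is `Θ x t` at the time `t`. -/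
structure LevelOrbits (n : ℕ) [Fintype (dihedral n)] (e₁ e₂ p : R3) (ρ₀ σ : ℝ) {X : Type*}
    [TopologicalSpace X] (c : X → ℝ) (R Θ : X → ℝ → ℝ) (T : X → ℝ) : Prop where
  continuous_radius : Continuous (Function.uncurry R)
  continuous_angle : Continuous (Function.uncurry Θ)
  continuous_period : Continuous T
  period_pos : ∀ x, 0 < T x
  radius_mem : ∀ x φ, R x φ ∈ Ioo 0 ρ₀
  level : ∀ x φ, logSum n (polarPt e₁ e₂ p (R x φ) φ) = c x
  radius_unique : ∀ x φ, ∀ ρ ∈ Ioo 0 ρ₀, logSum n (polarPt e₁ e₂ p ρ φ) = c x → ρ = R x φ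
  radius_add : ∀ x φ, R x (φ + 2 * Real.pi) = R x φ
  angle_add : ∀ x t, Θ x (t + T x) = Θ x t + 2 * Real.pi * σ
  angle_mono : ∀ x, StrictMono fun t => σ * Θ x t
  angle_surj : ∀ x, Function.Surjective (Θ x)
  hasDerivAt : ∀ x t, HasDerivAt (fun s => polarPt e₁ e₂ p (R x (Θ x s)) (Θ x s))
    (reducedField n (polarPt e₁ e₂ p (R x (Θ x t)) (Θ x t))) t
  period_le : ∀ x ε κ, 0 < κ → (∀ φ, R x φ ≤ ε) → (∀ ρ ∈ Ioo 0 ρ₀, ∀ φ,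
    κ ≤ σ * logSumDeriv n (polarPt e₁ e₂ p ρ φ) (radVec e₁ e₂ p ρ φ)) →
    T x ≤ 8 * Real.pi * ε / κ

/-- Strict radial monotonicity makes each level curve a graph over the angle. By `reducedField_eq`
in the frame of `radVec` and `angVec`, its tangential motion has angular speed `D / (4 sin R)`,
where `D` is the radial derivative; `D` has the sign `σ`, so the angle never turns back. -/
theorem exists_levelOrbits [Fintype (dihedral n)] {e₁ e₂ p : R3} (hF : IsFrame e₁ e₂ p)
    {ρ₀ σ : ℝ} (hρ₀ : ρ₀ < Real.pi / 2) (hσ : σ = 1 ∨ σ = -1)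
    (hfree : ∀ ρ ∈ Ioo 0 ρ₀, ∀ φ, IsFree n (polarPt e₁ e₂ p ρ φ))
    (hmono : ∀ ρ ∈ Ioo 0 ρ₀, ∀ φ,
      0 < σ * logSumDeriv n (polarPt e₁ e₂ p ρ φ) (radVec e₁ e₂ p ρ φ))
    {X : Type*} [TopologicalSpace X] [FirstCountableTopology X] {c : X → ℝ} (hc : Continuous c)
    (hlev : ∀ x φ, ∃ ρ ∈ Ioo 0 ρ₀, logSum n (polarPt e₁ e₂ p ρ φ) = c x) :
    ∃ R Θ T, LevelOrbits n e₁ e₂ p ρ₀ σ c R Θ T := by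
  have hσ2 : σ * σ = 1 := by rcases hσ with rfl | rfl <;> norm_num
  have hσ0 : σ ≠ 0 := by rintro rfl; simp at hσ2
  have hsm := strictMonoOn_logSum_polarPt hfree hmono
  choose R hR hRl using hlev
  have huniq : ∀ x φ, ∀ ρ ∈ Ioo 0 ρ₀, logSum n (polarPt e₁ e₂ p ρ φ) = c x → ρ = R x φ := by
    intro x φ ρ hρ h
    refine (hsm φ).injOn hρ (hR x φ) ?_
    simp only [h, hRl]
  have hadd : ∀ x φ, R x (φ + 2 * Real.pi) = R x φ := by
    intro x φ
    refine huniq x φ _ (hR x _) ?_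
    rw [← hRl x (φ + 2 * Real.pi), polarPt_add_two_pi]
  have hRc : Continuous (Function.uncurry R) := by
    refine continuous_of_apply_eq_zero (isOpen_Ioo (a := 0) (b := ρ₀))
      (F := fun r y => σ * logSum n (polarPt e₁ e₂ p r y.2) - σ * c y.1)
      (fun y => hR y.1 y.2) (fun r hr => ?_) (fun y => ?_) fun y => ?_
    · refine Continuous.sub (continuous_const.mul ?_) (continuous_const.mul (hc.comp continuous_fst))
      rw [continuous_iff_continuousAt]
      intro y
      refine ContinuousAt.comp (f := fun y : X × ℝ => polarPt e₁ e₂ p r y.2)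
        (contDiffAt_logSum (hfree r hr y.2)).continuousAt ?_
      exact ((continuous_polarPt e₁ e₂ p).comp
        (continuous_const.prodMk continuous_snd)).continuousAt
    · intro a ha b hb hab
      exact sub_lt_sub_right (hsm y.2 ha hb hab) _
    · simp only [Function.uncurry, hRl, sub_self]
  set Q : X → ℝ → R3 := fun x φ => polarPt e₁ e₂ p (R x φ) φ with hQ
  set D : X → ℝ → ℝ := fun x φ => logSumDeriv n (Q x φ) (radVec e₁ e₂ p (R x φ) φ) with hD
  have hDpos : ∀ x φ, 0 < σ * D x φ := fun x φ => hmono _ (hR x φ) φ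
  have hD0 : ∀ x φ, D x φ ≠ 0 := fun x φ h => by have := hDpos x φ; rw [h] at this; simp at this
  have hsin : ∀ x φ, 0 < Real.sin (R x φ) := fun x φ =>
    Real.sin_pos_of_pos_of_lt_pi (hR x φ).1 (by linarith [(hR x φ).2, Real.pi_pos])
  have hpair : Continuous fun y : X × ℝ => (R y.1 y.2, y.2) := hRc.prodMk continuous_snd
  have hDc : Continuous (Function.uncurry D) := by
    rw [continuous_iff_continuousAt]
    intro y
    exact continuousAt_logSumDeriv
      (c := fun y : X × ℝ => polarPt e₁ e₂ p (R y.1 y.2) y.2)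
      ((continuous_polarPt e₁ e₂ p).comp hpair).continuousAt
      ((continuous_radVec e₁ e₂ p).comp hpair).continuousAt (hfree _ (hR y.1 y.2) y.2)
  -- The reciprocal of the absolute angular speed.
  set w : X → ℝ → ℝ := fun x φ => 4 * Real.sin (R x φ) / (σ * D x φ) with hw
  have hwc : Continuous (Function.uncurry w) :=
    (continuous_const.mul (Real.continuous_sin.comp hRc)).div (continuous_const.mul hDc)
      fun y => (hDpos y.1 y.2).ne'
  have hwpos : ∀ x φ, 0 < w x φ := fun x φ => div_pos (mul_pos (by norm_num) (hsin x φ)) (hDpos x φ)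
  have hwper : ∀ x φ, w x (φ + 2 * Real.pi) = w x φ := by
    intro x φ
    simp only [hw, hD, hQ, hadd, polarPt_add_two_pi, radVec_add_two_pi]
  obtain ⟨Φ, T, hΦc, hTc, hTeq, hTpos, hΦd, hΦadd, hΦm, hΦs⟩ := exists_timeChange hwc hwpos hwper
  -- `Φ` advances with positive speed; for `σ = -1` the true angle is obtained by reversing time.
  refine ⟨R, fun x t => Φ x (σ * t), T, hRc, ?_, hTc, hTpos, hR, hRl, huniq, hadd, ?_, ?_, ?_, ?_, ?_⟩
  · exact hΦc.comp (continuous_fst.prodMk (continuous_const.mul continuous_snd))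
  · intro x t
    rcases hσ with rfl | rfl
    · simp only [one_mul, hΦadd, mul_one]
    · have := hΦadd x (-1 * (t + T x))
      rw [show -1 * (t + T x) + T x = -1 * t by ring] at this
      change Φ x (-1 * (t + T x)) = Φ x (-1 * t) + _
      rw [this]
      ring
  · intro x a b hab
    rcases hσ with rfl | rfl
    · simpa using hΦm x hab
    · simpa using hΦm x (neg_lt_neg hab)
  · intro x φ
    obtain ⟨t, ht⟩ := hΦs x φ
    exact ⟨σ * t, by simp only [← mul_assoc, hσ2, one_mul, ht]⟩
  · intro x t
    set θ := Φ x (σ * t) with hθ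
    have hRx : Continuous (R x) := hRc.uncurry_left x
    have hfr := hfree _ (hR x θ) θ
    -- The slope of the level curve makes the radial component of the velocity agree with that of
    -- `reducedField`, once the angular component does.
    have hRd : HasDerivAt (R x)
        (-((Real.sin (R x θ) * logSumDeriv n (Q x θ) (angVec e₁ e₂ θ)) / D x θ)) θ := by
      refine hasDerivAt_of_level (F := fun y => logSum n (polarPt e₁ e₂ p y.1 y.2)) ?_ ?_ ?_
        (hD0 x θ) hRx.continuousAt (Eventually.of_forall fun ψ => by simp only [hRl])
      · exact ContDiffAt.comp (R x θ, θ) (g := logSum n) (contDiffAt_logSum hfr)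
          (contDiff_polarPt e₁ e₂ p).contDiffAt
      · exact hasDerivAt_logSum (hasDerivAt_polarPt_left e₁ e₂ p _ _) hfr
      · rw [← logSumDeriv_smul]
        exact hasDerivAt_logSum (hasDerivAt_polarPt_right e₁ e₂ p _ _) hfr
    have hθd : HasDerivAt (fun s => Φ x (σ * s)) (D x θ / (4 * Real.sin (R x θ))) t := by
      have h1 : HasDerivAt (fun s => σ * s) σ t := by simpa using (hasDerivAt_id t).const_mul σ
      refine ((hΦd x (σ * t)).comp t h1).congr_deriv ?_
      simp only [hw, inv_div]
      rw [← hθ]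
      linear_combination (D x θ / (4 * Real.sin (R x θ))) * hσ2
    have hRθ := HasDerivAt.comp_of_eq (h₂ := R x) (h := fun s => Φ x (σ * s)) t hRd hθd hθ.symm
    refine (hasDerivAt_polarPt_comp e₁ e₂ p hRθ hθd).congr_deriv ?_
    rw [reducedField_eq (hF.cross_radVec_angVec _ _) (hF.inner_polarPt_radVec _ _)
      (hF.inner_polarPt_angVec _ _)]
    rw [Function.comp_apply, ← hθ]
    have e1 : D x θ / (4 * Real.sin (R x θ)) * Real.sin (R x θ) = D x θ / 4 := by
      field_simp [(hsin x θ).ne']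
    have e2 : -(Real.sin (R x θ) * logSumDeriv n (Q x θ) (angVec e₁ e₂ θ) / D x θ) *
        (D x θ / (4 * Real.sin (R x θ))) = -(logSumDeriv n (Q x θ) (angVec e₁ e₂ θ) / 4) := by
      field_simp [(hsin x θ).ne', hD0 x θ]
    rw [e1, e2, neg_smul]
    exact neg_add_eq_sub _ _
  · intro x ε κ hκ hε hκD
    have hpi := Real.two_pi_pos
    -- Here `sin R ≤ R ≤ ε` bounds the numerator and `κ` the denominator; integration over a full
    -- turn gives `8π ε / κ`.
    have hle : ∀ φ, w x φ ≤ 4 * ε / κ := by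
      intro φ
      have h1 : κ ≤ σ * D x φ := hκD _ (hR x φ) φ
      have h2 := Real.sin_le (hR x φ).1.le
      have h3 := hε φ
      have h4 := (hR x φ).1
      change 4 * Real.sin (R x φ) / (σ * D x φ) ≤ _
      generalize R x φ = r at h2 h3 h4 ⊢
      generalize σ * D x φ = d at h1 ⊢
      exact div_le_div₀ (by linarith) (by linarith) hκ h1
    have hwx : Continuous (w x) := hwc.uncurry_left x
    rw [hTeq]
    calc ∫ φ in (0 : ℝ)..(2 * Real.pi), w x φ ≤ ∫ _ in (0 : ℝ)..(2 * Real.pi), 4 * ε / κ :=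
          intervalIntegral.integral_mono hpi.le (hwx.intervalIntegrable _ _) (by simp) hle
      _ = 8 * Real.pi * ε / κ := by
        rw [intervalIntegral.integral_const, smul_eq_mul]
        ring


/-! ### Symmetric families from level curves -/

theorem TurnsAbout.act {γ : ℝ → R3} {T : ℝ} {p : R3} {k : ℤ} (h : TurnsAbout γ T p k)
    (g : dihedral n) : TurnsAbout (fun t => act g (γ t)) T (act g p) k := by
  obtain ⟨e₁, e₂, ho, hc, r, θ, hθ, H⟩ := h
  refine ⟨SphereVortex.act g e₁, SphereVortex.act g e₂, ?_, by rw [cross_act, hc], r, θ, hθ,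
    fun t => ?_⟩
  · rw [orthonormal_iff_ite] at ho ⊢
    intro i j
    rw [← ho i j]
    fin_cases i <;> fin_cases j <;> exact inner_act_act g _ _
  · rw [inner_act_act, inner_act_act]
    exact H t

/-- Exchanging `e₁` and `e₂` gives a positive frame for `-p`, in which the angle is `π / 2 - θ`. -/
theorem TurnsAbout.neg {γ : ℝ → R3} {T : ℝ} {p : R3} {k : ℤ} (h : TurnsAbout γ T p k) :
    TurnsAbout γ T (-p) (-k) := by
  obtain ⟨e₁, e₂, ho, hc, r, θ, hθ, H⟩ := h
  refine ⟨e₂, e₁, ?_, by rw [cross_comm_neg, hc], r, fun t => Real.pi / 2 - θ t,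
    continuous_const.sub hθ, fun t => ?_⟩
  · have h01 : inner ℝ e₁ e₂ = 0 := ho.2 (show (0 : Fin 3) ≠ 1 by decide)
    have h02 : inner ℝ e₁ p = 0 := ho.2 (show (0 : Fin 3) ≠ 2 by decide)
    have h12 : inner ℝ e₂ p = 0 := ho.2 (show (1 : Fin 3) ≠ 2 by decide)
    have h0 : ‖e₁‖ = 1 := ho.1 0
    have h1 : ‖e₂‖ = 1 := ho.1 1
    have h2 : ‖p‖ = 1 := ho.1 2
    have h10 : inner ℝ e₂ e₁ = 0 := (real_inner_comm e₁ e₂).trans h01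
    have h20 : inner ℝ p e₁ = 0 := (real_inner_comm e₁ p).trans h02
    have h21 : inner ℝ p e₂ = 0 := (real_inner_comm e₂ p).trans h12
    rw [orthonormal_iff_ite]
    intro i j
    fin_cases i <;> fin_cases j <;> simp [h0, h1, h2, h01, h02, h12, h10, h20, h21]
  · obtain ⟨hr, h1, h2, h3⟩ := H t
    refine ⟨hr, ?_, ?_, ?_⟩
    · rw [h2, Real.cos_pi_div_two_sub]
    · rw [h1, Real.sin_pi_div_two_sub]
    · simp only [h3]
      push_cast
      ring

theorem config_injective_of_isFree (g : Fin (2 * n) ≃ dihedral n) {u : R3} (hu : IsFree n u)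
    {i j : Fin (2 * n)} (h : config g u i = config g u j) : i = j := by
  have h1 : act ((g j)⁻¹ * g i) u = u := by
    rw [act_mul]
    have : act (g i) u = act (g j) u := h
    rw [this, act_inv_act]
  have h2 : (g j)⁻¹ * g i = 1 := by
    by_contra hne
    exact hu _ hne h1
  exact g.injective (inv_mul_eq_one.mp h2).symm

theorem config_mem (g : Fin (2 * n) ≃ dihedral n) {u : R3} (hu : IsFree n u) (h1 : ‖u‖ = 1) :
    config g u ∈ phaseSpace (2 * n) \ collisionSet (2 * n) := by
  refine ⟨fun j => (norm_act _ _).trans h1, ?_⟩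
  rintro ⟨-, i, j, hij, h⟩
  exact hij (config_injective_of_isFree g hu h)

theorem isSolution_config [Fintype (dihedral n)] (g : Fin (2 * n) ≃ dihedral n) {u : ℝ → R3}
    (hfree : ∀ t, IsFree n (u t)) (hnorm : ∀ t, ‖u t‖ = 1)
    (hu : ∀ t, HasDerivAt u (reducedField n (u t)) t) : IsSolution fun t => config g (u t) := by
  refine fun t => ⟨config_mem g (hfree t) (hnorm t), ?_⟩
  rw [hasDerivAt_pi]
  intro j
  rw [vortexField_config]
  exact (actL (g j)).hasFDerivAt.comp_hasDerivAt t (hu t)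

theorem config_mem_symmetricConfigs (g : Fin (2 * n) ≃ dihedral n) {u : R3} (h1 : ‖u‖ = 1) :
    config g u ∈ symmetricConfigs g := by
  refine ⟨fun j => (norm_act _ _).trans h1, fun j => ?_⟩
  simp [config, act_one]

/-! ### Level orbits as simple closed loops -/

namespace LevelOrbits

variable [Fintype (dihedral n)] {e₁ e₂ p : R3} {ρ₀ : ℝ} {X : Type*} [TopologicalSpace X]
  {c : X → ℝ} {R Θ : X → ℝ → ℝ} {T : X → ℝ} {k : ℤ}

theorem sin_pos {σ : ℝ} (H : LevelOrbits n e₁ e₂ p ρ₀ σ c R Θ T) (hρ₀ : ρ₀ < Real.pi / 2)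
    (x : X) (φ : ℝ) : 0 < Real.sin (R x φ) :=
  Real.sin_pos_of_pos_of_lt_pi (H.radius_mem x φ).1
    (by linarith [(H.radius_mem x φ).2, Real.pi_pos])

theorem turnsAbout (H : LevelOrbits n e₁ e₂ p ρ₀ k c R Θ T) (hF : IsFrame e₁ e₂ p)
    (hρ₀ : ρ₀ < Real.pi / 2) (x : X) :
    TurnsAbout (fun t => polarPt e₁ e₂ p (R x (Θ x t)) (Θ x t)) (T x) p k :=
  ⟨e₁, e₂, hF.orthonormal, hF.cross_eq, fun t => Real.sin (R x (Θ x t)), Θ x,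
    H.continuous_angle.uncurry_left x, fun t => ⟨H.sin_pos hρ₀ x _, hF.inner_polarPt₁ _ _,
      hF.inner_polarPt₂ _ _, H.angle_add x t⟩⟩

theorem radius_add_int {σ : ℝ} (H : LevelOrbits n e₁ e₂ p ρ₀ σ c R Θ T) (x : X) (φ : ℝ) :
    R x (φ - 2 * Real.pi) = R x φ := by
  rw [← H.radius_add x (φ - 2 * Real.pi), sub_add_cancel]

theorem continuous_orbit {σ : ℝ} (H : LevelOrbits n e₁ e₂ p ρ₀ σ c R Θ T) :
    Continuous (Function.uncurry fun x t => polarPt e₁ e₂ p (R x (Θ x t)) (Θ x t)) := by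
  have h2 : Continuous fun y : X × ℝ => (y.1, Function.uncurry Θ y) :=
    continuous_fst.prodMk H.continuous_angle
  have h3 := (H.continuous_radius.comp h2).prodMk H.continuous_angle
  refine ((continuous_polarPt e₁ e₂ p).comp h3).congr fun y => ?_
  simp only [Function.comp_apply, Function.uncurry]

/-- Within one period the strictly monotone angle varies by less than `2π` between two times.
Coinciding points have the same radius, `cos` being injective on `[0, π]`, and hence the same angle
modulo `2π`, which excludes distinct times. -/
theorem isSimpleLoop (H : LevelOrbits n e₁ e₂ p ρ₀ k c R Θ T) (hF : IsFrame e₁ e₂ p)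
    (hρ₀ : ρ₀ < Real.pi / 2) (hk : k = 1 ∨ k = -1) (x : X) :
    IsSimpleLoop (fun t => polarPt e₁ e₂ p (R x (Θ x t)) (Θ x t)) (T x) := by
  have hpi := Real.pi_pos
  refine ⟨H.period_pos x, ?_, fun t => ?_, ?_⟩
  · exact H.continuous_orbit.uncurry_left x
  · simp only [H.angle_add]
    rcases hk with rfl | rfl
    · simp only [Int.cast_one, mul_one, H.radius_add, polarPt_add_two_pi]
    · have h1 : Θ x t + 2 * Real.pi * ((-1 : ℤ) : ℝ) = Θ x t - 2 * Real.pi := by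
        push_cast; ring
      rw [h1, H.radius_add_int, ← polarPt_add_two_pi _ _ _ _ (Θ x t - _), sub_add_cancel]
  · have key : ∀ s ∈ Ico 0 (T x), ∀ t ∈ Ico 0 (T x), s < t →
        polarPt e₁ e₂ p (R x (Θ x s)) (Θ x s) ≠ polarPt e₁ e₂ p (R x (Θ x t)) (Θ x t) := by
      intro s hs t ht hst heq
      have h1 : (k : ℝ) * Θ x s < k * Θ x t := H.angle_mono x hst
      have h2 : (k : ℝ) * Θ x t < k * Θ x (s + T x) := H.angle_mono x (by linarith [ht.2, hs.1])
      rw [H.angle_add] at h2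
      have hk2 : (k : ℝ) * k = 1 := by rcases hk with rfl | rfl <;> norm_num
      have h3 : (k : ℝ) * (Θ x s + 2 * Real.pi * k) = k * Θ x s + 2 * Real.pi := by
        linear_combination 2 * Real.pi * hk2
      rw [h3] at h2
      have e1 := congrArg (fun w => inner ℝ e₁ w) heq
      have e2 := congrArg (fun w => inner ℝ e₂ w) heq
      have e3 := congrArg (fun w => inner ℝ p w) heq
      simp only [hF.inner_polarPt₁, hF.inner_polarPt₂, hF.inner_polarPt₃] at e1 e2 e3
      have hR : R x (Θ x s) = R x (Θ x t) := by
        refine Real.injOn_cos ⟨(H.radius_mem x _).1.le, ?_⟩ ⟨(H.radius_mem x _).1.le, ?_⟩ e3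
        · linarith [(H.radius_mem x (Θ x s)).2]
        · linarith [(H.radius_mem x (Θ x t)).2]
      have hs0 := (H.sin_pos hρ₀ x (Θ x t)).ne'
      rw [hR] at e1 e2
      have h4 := Real.Angle.cos_sin_inj (mul_left_cancel₀ hs0 e1) (mul_left_cancel₀ hs0 e2)
      rw [Real.Angle.angle_eq_iff_two_pi_dvd_sub] at h4
      obtain ⟨m, hm⟩ := h4
      have h5 : -(2 * Real.pi) < 2 * Real.pi * (k * m) := by
        have : 2 * Real.pi * (k * m) = k * Θ x s - k * Θ x t := by
          linear_combination -(k : ℝ) * hm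
        rw [this]; linarith
      have h6 : 2 * Real.pi * (k * m) < 0 := by
        have : 2 * Real.pi * (k * m) = k * Θ x s - k * Θ x t := by
          linear_combination -(k : ℝ) * hm
        rw [this]; linarith
      have h7 : (-1 : ℝ) < ((k * m : ℤ) : ℝ) := by
        push_cast
        by_contra hcon
        push Not at hcon
        nlinarith
      have h8 : ((k * m : ℤ) : ℝ) < 0 := by
        push_cast
        by_contra hcon
        push Not at hcon
        nlinarith
      have h9 : (-1 : ℤ) < k * m := by exact_mod_cast h7
      have h10 : k * m < (0 : ℤ) := by exact_mod_cast h8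
      omega
    intro s hs t ht heq
    rcases lt_trichotomy s t with h | h | h
    · exact absurd heq (key s hs t ht h)
    · exact h
    · exact absurd heq.symm (key t ht s hs h)

/-- A stabilizing element preserves both the distance to `p` and the value of `logSum`. As a ray
meets the level only once, the image lies on the same curve, and the orbit passes through every
angle. -/
theorem act_mem_range {σ : ℝ} (H : LevelOrbits n e₁ e₂ p ρ₀ σ c R Θ T) (hF : IsFrame e₁ e₂ p)
    {γ : dihedral n} (hγ : act γ p = p) (x : X) (t : ℝ) :
    ∃ s, act γ (polarPt e₁ e₂ p (R x (Θ x t)) (Θ x t)) =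
      polarPt e₁ e₂ p (R x (Θ x s)) (Θ x s) := by
  obtain ⟨ψ, hψ⟩ := hF.exists_act_polarPt hγ (Θ x t)
  obtain ⟨s, hs⟩ := H.angle_surj x ψ
  refine ⟨s, ?_⟩
  rw [hψ, hs, ← H.radius_unique x ψ _ (H.radius_mem x (Θ x t))]
  rw [← hψ, logSum_act, H.level]

end LevelOrbits

/-- The level `-(2 / n) * h` corresponds to the energy `h`. The separation `hsep` keeps the discs of
radius `ρ₀` around different centres disjoint. The final clause is the quantitative output for the
limits: a curve within radius `ε` on every ray stays `ε`-close to the centre and, if the radial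
derivative is at least `κ`, has period at most `8π ε / κ`. -/
theorem exists_symmetricPeriodicFamily [Fintype (dihedral n)] (hn : n ≠ 0)
    (g : Fin (2 * n) ≃ dihedral n) {e₁ e₂ p : R3} (hF : IsFrame e₁ e₂ p)
    {ρ₀ : ℝ} (hρ₀ : ρ₀ < Real.pi / 2) {k : ℤ} (hk : k = 1 ∨ k = -1)
    (hfree : ∀ ρ ∈ Ioo 0 ρ₀, ∀ φ, IsFree n (polarPt e₁ e₂ p ρ φ))
    (hmono : ∀ ρ ∈ Ioo 0 ρ₀, ∀ φ,
      0 < k * logSumDeriv n (polarPt e₁ e₂ p ρ φ) (radVec e₁ e₂ p ρ φ))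
    (hsep : ∀ γ : dihedral n, act γ p ≠ p → 2 * ρ₀ ≤ dist (act γ p) p)
    {I : Set ℝ} (hlev : ∀ h ∈ I, ∀ φ, ∃ ρ ∈ Ioo 0 ρ₀,
      logSum n (polarPt e₁ e₂ p ρ φ) = -(2 / n) * h) :
    ∃ (v : ℝ → ℝ → Fin (2 * n) → R3) (T : ℝ → ℝ),
      IsSymmetricPeriodicFamily g (config g p) I v T ∧
      (∀ h ∈ I, ∀ j, TurnsAbout (fun t => v h t j) (T h) (config g p j) k) ∧
      ∀ h ∈ I, ∀ ε ≤ ρ₀, (∀ φ, ∃ ρ ∈ Ioo 0 ε,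
        logSum n (polarPt e₁ e₂ p ρ φ) = -(2 / n) * h) →
        (∀ t j, dist (v h t j) (config g p j) ≤ ε) ∧
        ∀ κ > 0, (∀ ρ ∈ Ioo 0 ρ₀, ∀ φ,
          κ ≤ k * logSumDeriv n (polarPt e₁ e₂ p ρ φ) (radVec e₁ e₂ p ρ φ)) →
          T h ≤ 8 * Real.pi * ε / κ := by
  classical
  have hn0 : (n : ℝ) ≠ 0 := by exact_mod_cast hn
  obtain ⟨R, Θ, T, H⟩ := exists_levelOrbits (X := I) (σ := k) (c := fun x => -(2 / n) * (x : ℝ)) hF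
    hρ₀ (by rcases hk with rfl | rfl <;> simp) hfree hmono
    (continuous_const.mul continuous_subtype_val) fun x => hlev x x.2
  -- From here on only these properties of the single orbit `u` matter; its polar description is no
  -- longer needed.
  obtain ⟨u, huc, hufree, hunorm, hud, hulev, huturn, huloop, hupos, huact, hudist, hudist'⟩ :
      ∃ u : I → ℝ → R3, Continuous (Function.uncurry u) ∧ (∀ x t, IsFree n (u x t)) ∧
      (∀ x t, ‖u x t‖ = 1) ∧ (∀ x t, HasDerivAt (u x) (reducedField n (u x t)) t) ∧
      (∀ x t, logSum n (u x t) = -(2 / n) * (x : ℝ)) ∧ (∀ x, TurnsAbout (u x) (T x) p k) ∧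
      (∀ x, IsSimpleLoop (u x) (T x)) ∧ (∀ x t, 0 < inner ℝ p (u x t)) ∧
      (∀ γ : dihedral n, act γ p = p → ∀ x t, ∃ s, act γ (u x t) = u x s) ∧
      (∀ x t, dist (u x t) p < ρ₀) ∧
      ∀ x t ε, (∀ φ, R x φ ≤ ε) → dist (u x t) p ≤ ε := by
    have hd : ∀ x φ, dist (polarPt e₁ e₂ p (R x φ) φ) p ≤ R x φ := fun x φ =>
      (hF.dist_polarPt_center _ _).trans_eq (abs_of_pos (H.radius_mem x _).1)
    refine ⟨fun x t => polarPt e₁ e₂ p (R x (Θ x t)) (Θ x t), H.continuous_orbit,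
      fun x t => hfree _ (H.radius_mem _ _) _, fun x t => hF.norm_polarPt _ _, H.hasDerivAt,
      fun x t => H.level _ _, H.turnsAbout hF hρ₀, H.isSimpleLoop hF hρ₀ hk, fun x t => ?_,
      fun γ hγ => H.act_mem_range hF hγ, fun x t => (hd _ _).trans_lt (H.radius_mem _ _).2,
      fun x t ε h => (hd _ _).trans (h _)⟩
    rw [hF.inner_polarPt₃]
    have hm := H.radius_mem x (Θ x t)
    exact Real.cos_pos_of_mem_Ioo ⟨by linarith [hm.1, Real.pi_pos], by linarith [hm.2]⟩
  have hdistj : ∀ (x : I) (t : ℝ) (j), dist (act (g j) (u x t)) (config g p j) < ρ₀ := fun x t j =>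
    (dist_act (g j) _ _).trans_lt (hudist x t)
  -- The value `0` outside `I` is arbitrary; the parameter there does not enter any claim.
  set v : ℝ → ℝ → Fin (2 * n) → R3 := fun h t =>
    if hh : h ∈ I then config g (u ⟨h, hh⟩ t) else 0 with hv
  set S : ℝ → ℝ := fun h => if hh : h ∈ I then T ⟨h, hh⟩ else 0 with hS
  have hveq : ∀ (h : ℝ) (hh : h ∈ I), v h = fun t => config g (u ⟨h, hh⟩ t) := fun h hh => by
    funext t; simp only [hv, dif_pos hh]
  have hSeq : ∀ (h : ℝ) (hh : h ∈ I), S h = T ⟨h, hh⟩ := fun h hh => dif_pos hh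
  have hturn : ∀ h ∈ I, ∀ j, TurnsAbout (fun t => v h t j) (S h) (config g p j) k := by
    intro h hh j
    rw [hveq h hh, hSeq h hh]
    exact (huturn ⟨h, hh⟩).act (g j)
  refine ⟨v, S, ⟨?_, ?_, ?_, ?_, ?_, ?_, ?_, ?_⟩, hturn, ?_⟩
  · rw [continuousOn_iff_continuous_domRestrict]
    have h0 : Continuous fun y : ↥(I ×ˢ (univ : Set ℝ)) => ((⟨y.1.1, y.2.1⟩ : I), y.1.2) :=
      ((continuous_fst.comp continuous_subtype_val).subtype_mk _).prodMk
        (continuous_snd.comp continuous_subtype_val)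
    have h1 : Continuous fun y : ↥(I ×ˢ (univ : Set ℝ)) =>
        config g (u ⟨y.1.1, y.2.1⟩ y.1.2) :=
      continuous_pi fun j => (continuous_act (g j)).comp (huc.comp h0)
    refine h1.congr fun y => ?_
    simp only [domRestrict_apply, hveq y.1.1 y.2.1]
  · rw [continuousOn_iff_continuous_domRestrict]
    exact H.continuous_period.congr fun y => (hSeq y.1 y.2).symm
  · intro h hh
    rw [hveq h hh]
    exact isSolution_config g (hufree _) (hunorm _) (hud _)
  · intro h hh t
    rw [hveq h hh, energy_config, hulev]
    field_simp
  · intro h hh t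
    rw [hveq h hh]
    exact config_mem_symmetricConfigs g (hunorm _ _)
  · intro h hh j
    refine ⟨?_, fun t => ?_, ?_⟩
    · rw [hveq h hh, hSeq h hh]
      obtain ⟨h1, h2, h3, h4⟩ := huloop ⟨h, hh⟩
      exact ⟨h1, (continuous_act _).comp h2, fun t => congrArg (act (g j)) (h3 t),
        fun s hs t ht hst => h4 hs ht (act_injective (g j) hst)⟩
    · rw [hveq h hh]
      change 0 < inner ℝ (act (g j) p) (act (g j) _)
      rw [inner_act_act]
      exact hupos _ _
    · have := hturn h hh j
      rcases hk with rfl | rfl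
      · exact Or.inl this
      · exact Or.inr this
  · intro h hh i j hij
    rw [hveq h hh]
    have key : ∀ i j, config g p i = config g p j →
        range (fun t => config g (u ⟨h, hh⟩ t) i) ⊆ range (fun t => config g (u ⟨h, hh⟩ t) j) := by
      rintro i j hij _ ⟨t, rfl⟩
      -- Vortices with equal centres differ by an element of the stabilizer of `p`, which maps the
      -- basic loop to itself.
      have hst : act ((g j)⁻¹ * g i) p = p := by
        rw [act_mul]
        have : act (g i) p = act (g j) p := hij
        rw [this, act_inv_act]
      obtain ⟨s, hs⟩ := huact _ hst ⟨h, hh⟩ t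
      refine ⟨s, ?_⟩
      change act (g j) _ = act (g i) _
      rw [← hs, ← act_mul, mul_inv_cancel_left]
    exact (key i j hij).antisymm (key j i hij.symm)
  · intro h hh i j hij
    rw [hveq h hh, Set.disjoint_left]
    rintro _ ⟨s, rfl⟩ ⟨t, ht⟩
    have h1 : act ((g j)⁻¹ * g i) p ≠ p := by
      intro h2
      apply hij
      change act (g i) p = act (g j) p
      calc act (g i) p = act (g j * ((g j)⁻¹ * g i)) p := by rw [mul_inv_cancel_left]
        _ = act (g j) p := by rw [act_mul, h2]
    have h3 := hsep _ h1
    have h4 : dist (act ((g j)⁻¹ * g i) p) p = dist (config g p i) (config g p j) := by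
      rw [← dist_act (g j), ← act_mul, mul_inv_cancel_left]
      rfl
    have h5 := hdistj ⟨h, hh⟩ s i
    have h6 := hdistj ⟨h, hh⟩ t j
    have h7 : act (g j) (u ⟨h, hh⟩ t) = act (g i) (u ⟨h, hh⟩ s) := ht
    rw [h7] at h6
    -- A common point would lie at distance less than `ρ₀` from two centres that are at least `2ρ₀`
    -- apart.
    have h8 := dist_triangle_left (config g p i) (config g p j) (act (g i) (u ⟨h, hh⟩ s))
    linarith
  · intro h hh ε hε hlev'
    have hRε : ∀ φ, R ⟨h, hh⟩ φ ≤ ε := by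
      intro φ
      obtain ⟨ρ, hρ, hρl⟩ := hlev' φ
      rw [← H.radius_unique ⟨h, hh⟩ φ ρ ⟨hρ.1, hρ.2.trans_le hε⟩ hρl]
      exact hρ.2.le
    refine ⟨fun t j => ?_, fun κ hκ hκD => ?_⟩
    · rw [hveq h hh]
      exact (dist_act (g j) _ _).trans_le (hudist' _ _ _ hRε)
    · rw [hSeq h hh]
      exact H.period_le ⟨h, hh⟩ ε κ hκ hRε hκD


/-! ### Families around collisions -/

theorem eq_one_of_act_eq {γ : dihedral n} (h : ∀ w, act γ w = w) : γ = 1 := by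
  apply coe_inj_mat
  ext i j
  have h1 := congrArg (fun w : R3 => w i) (h (EuclideanSpace.single j 1))
  simp only [act_coord] at h1
  change _ = (1 : Matrix (Fin 3) (Fin 3) ℝ) i j
  rw [Matrix.one_apply]
  fin_cases i <;> fin_cases j <;> simpa using h1

theorem IsFrame.rotate {e₁ e₂ p : R3} (hF : IsFrame e₁ e₂ p) (φ : ℝ) :
    IsFrame (dirVec e₁ e₂ φ) (angVec e₁ e₂ φ) p := by
  have h : angVec e₁ e₂ φ = dirVec e₁ e₂ (φ + Real.pi / 2) := by
    simp [angVec, dirVec, Real.cos_add_pi_div_two, Real.sin_add_pi_div_two]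
  refine ⟨by rw [hF.inner_dirVec]; simp, ?_, ?_, hF.cross_dirVec_angVec φ⟩
  · rw [h, hF.inner_dirVec]; simp
  · rw [h, hF.inner_dirVec]; simp

/-- Rotations respect the vector product, so one fixing `p` and a tangent direction also fixes the
direction orthogonal to both, and is the identity. -/
theorem IsFrame.act_dirVec_ne {e₁ e₂ p : R3} (hF : IsFrame e₁ e₂ p) {γ : dihedral n} (hγ : γ ≠ 1)
    (hp : SphereVortex.act γ p = p) (φ : ℝ) :
    SphereVortex.act γ (dirVec e₁ e₂ φ) ≠ dirVec e₁ e₂ φ := by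
  intro h
  have hR := hF.rotate φ
  have hb : SphereVortex.act γ (angVec e₁ e₂ φ) = angVec e₁ e₂ φ := by
    have h31 : cross p (dirVec e₁ e₂ φ) = angVec e₁ e₂ φ := by
      rw [cross_comm_neg, hR.cross₁₃, neg_neg]
    rw [← h31, ← cross_act, h, hp]
  refine hγ (eq_one_of_act_eq fun w => ?_)
  rw [hR.expansion w, act_add, act_add, act_smul, act_smul, act_smul, h, hb, hp]

/-- For a stabilizing element the radius factors out of the displacement. Its term in `logSum`
therefore splits into `2 log (sin ρ)` and a function of `φ`. -/
theorem polarPt_sub_act {e₁ e₂ p : R3} {γ : dihedral n} (hp : act γ p = p) (ρ φ : ℝ) :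
    polarPt e₁ e₂ p ρ φ - act γ (polarPt e₁ e₂ p ρ φ) =
      Real.sin ρ • (dirVec e₁ e₂ φ - act γ (dirVec e₁ e₂ φ)) := by
  rw [polarPt, act_add, act_smul, act_smul, hp]
  module

theorem radVec_sub_act {e₁ e₂ p : R3} {γ : dihedral n} (hp : act γ p = p) (ρ φ : ℝ) :
    radVec e₁ e₂ p ρ φ - act γ (radVec e₁ e₂ p ρ φ) =
      Real.cos ρ • (dirVec e₁ e₂ φ - act γ (dirVec e₁ e₂ φ)) := by
  rw [radVec, act_sub, act_smul, act_smul, hp]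
  module

theorem exists_separation [Finite (dihedral n)] (p : R3) :
    ∃ d > 0, ∀ γ : dihedral n, act γ p ≠ p → d ≤ dist (act γ p) p := by
  have h : ∀ᶠ d in 𝓝[>] (0 : ℝ), ∀ γ : dihedral n, act γ p ≠ p → d ≤ dist (act γ p) p := by
    rw [eventually_all]
    intro γ
    by_cases hγ : act γ p = p
    · exact Eventually.of_forall fun d h => absurd hγ h
    · filter_upwards [Ioo_mem_nhdsGT (dist_pos.mpr hγ)] with d hd _
      exact hd.2.le
  obtain ⟨d, hd, hd0⟩ := (h.and self_mem_nhdsWithin).exists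
  exact ⟨d, hd0, hd⟩

/-- Moving the point and its image back to `p` and `γ p` costs at most `d / 4` each. -/
theorem norm_sub_act_ge {e₁ e₂ p : R3} (hF : IsFrame e₁ e₂ p) {d : ℝ} {γ : dihedral n}
    (hd : d ≤ dist (act γ p) p) {ρ : ℝ} (hρ : |ρ| ≤ d / 4) (φ : ℝ) :
    d / 2 ≤ ‖polarPt e₁ e₂ p ρ φ - act γ (polarPt e₁ e₂ p ρ φ)‖ := by
  have h1 := hF.dist_polarPt_center ρ φ
  have h2 := dist_act γ (polarPt e₁ e₂ p ρ φ) p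
  have h3 := dist_triangle4 (act γ p) (act γ (polarPt e₁ e₂ p ρ φ)) (polarPt e₁ e₂ p ρ φ) p
  rw [dist_comm (act γ p) (act γ _), h2, dist_comm (act γ _) (polarPt e₁ e₂ p ρ φ)] at h3
  rw [← dist_eq_norm]
  linarith

theorem isFree_polarPt {e₁ e₂ p : R3} (hF : IsFrame e₁ e₂ p) {d : ℝ}
    (hd : ∀ γ : dihedral n, act γ p ≠ p → d ≤ dist (act γ p) p) {ρ : ℝ} (h0 : 0 < ρ)
    (h1 : ρ ≤ d / 4) (hpi : ρ < Real.pi) (φ : ℝ) : IsFree n (polarPt e₁ e₂ p ρ φ) := by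
  intro γ hγ heq
  by_cases hp : act γ p = p
  · have h2 := polarPt_sub_act (e₁ := e₁) (e₂ := e₂) hp ρ φ
    rw [heq, sub_self] at h2
    rcases smul_eq_zero.mp h2.symm with h3 | h3
    · exact (Real.sin_pos_of_pos_of_lt_pi h0 hpi).ne' h3
    · exact hF.act_dirVec_ne hγ hp φ (sub_eq_zero.mp h3).symm
  · have h2 := norm_sub_act_ge hF (hd γ hp) (by rwa [abs_of_pos h0]) φ
    rw [heq, sub_self, norm_zero] at h2
    linarith

theorem exists_level_of_le_of_le [Fintype (dihedral n)] {e₁ e₂ p : R3} {ε φ c : ℝ}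
    (hfree : ∀ ρ ∈ Ioo 0 ε, IsFree n (polarPt e₁ e₂ p ρ φ)) {r s : ℝ} (hr : r ∈ Ioo 0 ε)
    (hs : s ∈ Ioo 0 ε) (h1 : logSum n (polarPt e₁ e₂ p r φ) ≤ c)
    (h2 : c ≤ logSum n (polarPt e₁ e₂ p s φ)) :
    ∃ ρ ∈ Ioo 0 ε, logSum n (polarPt e₁ e₂ p ρ φ) = c := by
  have hc : ContinuousOn (fun ρ => logSum n (polarPt e₁ e₂ p ρ φ)) (Ioo 0 ε) := fun ρ hρ =>
    (hasDerivAt_logSum (hasDerivAt_polarPt_left e₁ e₂ p ρ φ)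
      (hfree ρ hρ)).continuousAt.continuousWithinAt
  exact isPreconnected_Ioo.intermediate_value hr hs hc ⟨h1, h2⟩

theorem exists_extrema_logSum [Fintype (dihedral n)] {e₁ e₂ p : R3} {r : ℝ}
    (hfree : ∀ φ, IsFree n (polarPt e₁ e₂ p r φ)) :
    ∃ φ₀ φ₁, ∀ φ, logSum n (polarPt e₁ e₂ p r φ₀) ≤ logSum n (polarPt e₁ e₂ p r φ) ∧
      logSum n (polarPt e₁ e₂ p r φ) ≤ logSum n (polarPt e₁ e₂ p r φ₁) := by
  have hc : Continuous fun φ => logSum n (polarPt e₁ e₂ p r φ) := by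
    rw [continuous_iff_continuousAt]
    exact fun φ => (hasDerivAt_logSum (hasDerivAt_polarPt_right e₁ e₂ p r φ)
      (hfree φ)).continuousAt
  have hper : Function.Periodic (fun φ => logSum n (polarPt e₁ e₂ p r φ)) (2 * Real.pi) :=
    fun φ => by simp only [polarPt_add_two_pi]
  have hne : (Icc 0 (2 * Real.pi)).Nonempty := nonempty_Icc.mpr Real.two_pi_pos.le
  obtain ⟨φ₀, -, h₀⟩ := isCompact_Icc.exists_isMinOn hne hc.continuousOn
  obtain ⟨φ₁, -, h₁⟩ := isCompact_Icc.exists_isMaxOn hne hc.continuousOn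
  refine ⟨φ₀, φ₁, fun φ => ?_⟩
  obtain ⟨ψ, hψ, he⟩ := hper.exists_mem_Ico₀ Real.two_pi_pos φ
  rw [he]
  exact ⟨h₀ (Ico_subset_Icc_self hψ), h₁ (Ico_subset_Icc_self hψ)⟩

/-- Every nontrivial stabilizing element contributes exactly `2 cot ρ > 0`; only that of `γ₀` is
kept. An element moving `p` contributes at least `-4 / N`, where `N ≥ d / 2` is the displacement.
The bound `-8 / d` is charged to all elements for uniformity. -/
theorem logSumDeriv_ge [Fintype (dihedral n)] {e₁ e₂ p : R3} (hF : IsFrame e₁ e₂ p) {d : ℝ}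
    (hd0 : 0 < d) (hd : ∀ γ : dihedral n, act γ p ≠ p → d ≤ dist (act γ p) p)
    {γ₀ : dihedral n} (hγ₀ : γ₀ ≠ 1) (hγ₀p : act γ₀ p = p) {ρ : ℝ} (h0 : 0 < ρ) (h1 : ρ ≤ d / 4)
    (h2 : ρ < Real.pi / 2) (φ : ℝ) :
    2 * (Real.cos ρ / Real.sin ρ) - Fintype.card (dihedral n) * (8 / d) ≤
      logSumDeriv n (polarPt e₁ e₂ p ρ φ) (radVec e₁ e₂ p ρ φ) := by
  classical
  have hpi := Real.pi_pos
  have hs : 0 < Real.sin ρ := Real.sin_pos_of_pos_of_lt_pi h0 (by linarith)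
  have hcos : 0 < Real.cos ρ := Real.cos_pos_of_mem_Ioo ⟨by linarith, h2⟩
  have hcot : 0 < Real.cos ρ / Real.sin ρ := div_pos hcos hs
  have h8 : 0 < 8 / d := by positivity
  have key : ∀ γ : dihedral n, (if γ = γ₀ then 2 * (Real.cos ρ / Real.sin ρ) else 0) - 8 / d ≤
      2 * inner ℝ (polarPt e₁ e₂ p ρ φ - act γ (polarPt e₁ e₂ p ρ φ))
        (radVec e₁ e₂ p ρ φ - act γ (radVec e₁ e₂ p ρ φ)) /
        ‖polarPt e₁ e₂ p ρ φ - act γ (polarPt e₁ e₂ p ρ φ)‖ ^ 2 := by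
    intro γ
    by_cases hp : act γ p = p
    · by_cases hγ : γ = 1
      · subst hγ
        rw [if_neg hγ₀.symm, act_one, sub_self, inner_zero_left]
        simp
        exact h8.le
      · have hne := hF.act_dirVec_ne hγ hp φ
        rw [polarPt_sub_act hp, radVec_sub_act hp, inner_smul_left, inner_smul_right,
          real_inner_self_eq_norm_sq, norm_smul, mul_pow, Real.norm_eq_abs, sq_abs]
        have hN : ‖dirVec e₁ e₂ φ - act γ (dirVec e₁ e₂ φ)‖ ^ 2 ≠ 0 :=
          pow_ne_zero _ (norm_ne_zero_iff.mpr (sub_ne_zero.mpr hne.symm))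
        generalize ‖dirVec e₁ e₂ φ - act γ (dirVec e₁ e₂ φ)‖ ^ 2 = N at hN ⊢
        have e : 2 * ((starRingEnd ℝ) (Real.sin ρ) * (Real.cos ρ * N)) / (Real.sin ρ ^ 2 * N) =
            2 * (Real.cos ρ / Real.sin ρ) := by
          simp only [conj_trivial]
          field_simp
        rw [e]
        split_ifs <;> linarith
    · have hγ : γ ≠ γ₀ := by rintro rfl; exact hp hγ₀p
      rw [if_neg hγ, zero_sub]
      have hg := norm_sub_act_ge hF (hd γ hp) (by rwa [abs_of_pos h0]) φ
      have ha : ‖radVec e₁ e₂ p ρ φ - act γ (radVec e₁ e₂ p ρ φ)‖ ≤ 2 := by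
        refine (norm_sub_le _ _).trans ?_
        rw [norm_act, hF.norm_radVec]; norm_num
      have hi := (abs_le.mp (abs_real_inner_le_norm
        (polarPt e₁ e₂ p ρ φ - act γ (polarPt e₁ e₂ p ρ φ))
        (radVec e₁ e₂ p ρ φ - act γ (radVec e₁ e₂ p ρ φ)))).1
      set N := ‖polarPt e₁ e₂ p ρ φ - act γ (polarPt e₁ e₂ p ρ φ)‖
      have hN : 0 < N := by linarith
      have h3 : -(2 * N) ≤ inner ℝ (polarPt e₁ e₂ p ρ φ - act γ (polarPt e₁ e₂ p ρ φ))
          (radVec e₁ e₂ p ρ φ - act γ (radVec e₁ e₂ p ρ φ)) := by nlinarith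
      rw [le_div_iff₀ (by positivity)]
      have h4 : 4 * N ≤ 8 / d * N ^ 2 := by
        rw [div_mul_eq_mul_div, le_div_iff₀ hd0]
        nlinarith
      linarith
  have hsum := Finset.sum_le_sum fun γ (_ : γ ∈ Finset.univ) => key γ
  rw [Finset.sum_sub_distrib, Finset.sum_ite_eq' Finset.univ γ₀] at hsum
  simp only [Finset.mem_univ, if_true, Finset.sum_const, Finset.card_univ, nsmul_eq_mul] at hsum
  exact hsum

/-- Every squared chord is at most `4`, and that of `γ₀` is at most `4ρ²`. Vanishing chords count as
`log 0 = 0`, which respects the bound. -/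
theorem logSum_le [Fintype (dihedral n)] {e₁ e₂ p : R3} (hF : IsFrame e₁ e₂ p)
    {γ₀ : dihedral n} (hγ₀ : γ₀ ≠ 1) (hγ₀p : act γ₀ p = p) {ρ : ℝ} (h0 : 0 < ρ)
    (h2 : ρ < Real.pi) (φ : ℝ) :
    logSum n (polarPt e₁ e₂ p ρ φ) ≤
      2 * Real.log ρ + Fintype.card (dihedral n) * Real.log 4 := by
  classical
  have hs : 0 < Real.sin ρ := Real.sin_pos_of_pos_of_lt_pi h0 h2
  have h4 : 0 < Real.log 4 := Real.log_pos (by norm_num)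
  have hb : ∀ (γ : dihedral n) (w : R3), ‖w‖ = 1 → ‖w - act γ w‖ ^ 2 ≤ 4 := fun γ w hw => by
    have : ‖w - act γ w‖ ≤ 2 := by
      refine (norm_sub_le _ _).trans ?_
      rw [norm_act, hw]; norm_num
    nlinarith [norm_nonneg (w - act γ w)]
  have key : ∀ γ : dihedral n, Real.log (‖polarPt e₁ e₂ p ρ φ - act γ (polarPt e₁ e₂ p ρ φ)‖ ^ 2) ≤
      (if γ = γ₀ then 2 * Real.log ρ else 0) + Real.log 4 := by
    intro γ
    by_cases hγ : γ = γ₀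
    · subst hγ
      have hne := hF.act_dirVec_ne hγ₀ hγ₀p φ
      have hN : 0 < ‖dirVec e₁ e₂ φ - act γ (dirVec e₁ e₂ φ)‖ ^ 2 :=
        pow_pos (norm_pos_iff.mpr (sub_ne_zero.mpr hne.symm)) 2
      rw [if_pos rfl, polarPt_sub_act hγ₀p, norm_smul, mul_pow, Real.norm_eq_abs, sq_abs]
      have : 2 * Real.log ρ + Real.log 4 = Real.log (ρ ^ 2 * 4) := by
        rw [Real.log_mul (by positivity) (by norm_num), Real.log_pow]; norm_num
      rw [this]
      refine Real.log_le_log (by positivity) ?_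
      exact mul_le_mul (pow_le_pow_left₀ hs.le (Real.sin_le h0.le) 2)
        (hb γ _ (hF.norm_dirVec φ)) hN.le (by positivity)
    · rw [if_neg hγ, zero_add]
      rcases (sq_nonneg ‖polarPt e₁ e₂ p ρ φ - act γ (polarPt e₁ e₂ p ρ φ)‖).eq_or_lt with h | h
      · rw [← h, Real.log_zero]; exact h4.le
      · exact Real.log_le_log h (hb γ _ (hF.norm_polarPt ρ φ))
  have hsum := Finset.sum_le_sum fun γ (_ : γ ∈ Finset.univ) => key γ
  rw [Finset.sum_add_distrib, Finset.sum_ite_eq' Finset.univ γ₀] at hsum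
  simp only [Finset.mem_univ, if_true, Finset.sum_const, Finset.card_univ, nsmul_eq_mul] at hsum
  exact hsum

/-- At a point with a nontrivial stabilizer `logSum` tends to `-∞` and increases radially, so all
sufficiently high energies occur on closed curves that shrink to `p`. The radial derivative stays
above `1`, so the periods shrink as well. -/
theorem exists_family_of_stabilizer [Fintype (dihedral n)] (hn : n ≠ 0)
    (g : Fin (2 * n) ≃ dihedral n) {e₁ e₂ p : R3} (hF : IsFrame e₁ e₂ p)
    {γ₀ : dihedral n} (hγ₀ : γ₀ ≠ 1) (hγ₀p : act γ₀ p = p) :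
    ∃ (h₁ : ℝ) (v : ℝ → ℝ → Fin (2 * n) → R3) (T : ℝ → ℝ),
      IsSymmetricPeriodicFamily g (config g p) (Ioi h₁) v T ∧
      (∀ h ∈ Ioi h₁, ∀ j, TurnsAbout (fun t => v h t j) (T h) (config g p j) 1) ∧
      TendstoUniformly v (fun _ => config g p) atTop ∧ Tendsto T atTop (𝓝 0) := by
  obtain ⟨d, hd0, hd⟩ := exists_separation (n := n) p
  set C : ℝ := Fintype.card (dihedral n) * (8 / d) with hC
  have hC0 : 0 ≤ C := by positivity
  have hnpos : (0 : ℝ) < n := by exact_mod_cast Nat.pos_of_ne_zero hn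
  have hpi := Real.pi_gt_three
  -- The bound `d / 4` serves separation, `1` gives `cos ρ ≥ 1/2`, and `1 / (1 + C)` gives `2 cot ρ
  -- ≥ 1 + C`, whence a radial derivative of at least `1`.
  set ρ₀ : ℝ := min (d / 4) (min 1 (1 / (1 + C))) with hρ₀
  have hρd : ρ₀ ≤ d / 4 := min_le_left _ _
  have hρ1 : ρ₀ ≤ 1 := (min_le_right _ _).trans (min_le_left _ _)
  have hρC : ρ₀ ≤ 1 / (1 + C) := (min_le_right _ _).trans (min_le_right _ _)
  have hρpos : 0 < ρ₀ := lt_min (by positivity) (lt_min one_pos (by positivity))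
  have hfree : ∀ ρ ∈ Ioo 0 ρ₀, ∀ φ, IsFree n (polarPt e₁ e₂ p ρ φ) := fun ρ hρ φ =>
    isFree_polarPt hF hd hρ.1 (hρ.2.le.trans hρd) (by linarith [hρ.2]) φ
  have hκ : ∀ ρ ∈ Ioo 0 ρ₀, ∀ φ,
      1 ≤ ((1 : ℤ) : ℝ) * logSumDeriv n (polarPt e₁ e₂ p ρ φ) (radVec e₁ e₂ p ρ φ) := by
    intro ρ hρ φ
    have hρ1' : ρ < 1 := hρ.2.trans_le hρ1
    have h1 := logSumDeriv_ge hF hd0 hd hγ₀ hγ₀p hρ.1 (hρ.2.le.trans hρd) (by linarith) φ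
    have hs : 0 < Real.sin ρ := Real.sin_pos_of_pos_of_lt_pi hρ.1 (by linarith)
    have hcos : 1 / 2 ≤ Real.cos ρ := by
      nlinarith [Real.one_sub_sq_div_two_le_cos (x := ρ), hρ.1]
    have h2 : 1 + C ≤ 2 * (Real.cos ρ / Real.sin ρ) := by
      have h3 : ρ * (1 + C) ≤ 1 := by
        rw [← le_div_iff₀ (by positivity)]
        exact hρ.2.le.trans hρC
      rw [← mul_div_assoc, le_div_iff₀ hs]
      nlinarith [Real.sin_le hρ.1.le]
    rw [Int.cast_one, one_mul]
    linarith
  have hlev : ∀ ε ∈ Ioc 0 ρ₀, ∃ h', ∀ h > h', ∀ φ, ∃ ρ ∈ Ioo 0 ε,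
      logSum n (polarPt e₁ e₂ p ρ φ) = -(2 / n) * h := by
    intro ε hε
    have hmem : ε / 2 ∈ Ioo 0 ρ₀ := ⟨by linarith [hε.1], by linarith [hε.1, hε.2]⟩
    obtain ⟨φ₀, φ₁, hm⟩ := exists_extrema_logSum (hfree (ε / 2) hmem)
    set m := logSum n (polarPt e₁ e₂ p (ε / 2) φ₀)
    -- Energies above this value correspond to levels below the minimum `m` on the circle of radius
    -- `ε / 2`; each ray attains such a level between that circle and `p`.
    refine ⟨-(n / 2) * m, fun h hh φ => ?_⟩
    have hc : -(2 / (n : ℝ)) * h < m := by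
      have : h > -(n / 2) * m := hh
      have h3 : -(2 / (n : ℝ)) * h < -(2 / n) * (-(n / 2) * m) :=
        mul_lt_mul_of_neg_left this (by simp [hnpos])
      have h4 : -(2 / (n : ℝ)) * (-(n / 2) * m) = m := by field_simp
      linarith
    have ht : Tendsto (fun ρ => 2 * Real.log ρ + Fintype.card (dihedral n) * Real.log 4)
        (𝓝[>] 0) atBot :=
      tendsto_atBot_add_const_right _ _
        (Real.tendsto_log_nhdsGT_zero.const_mul_atBot (by norm_num))
    obtain ⟨r, hr1, hr2⟩ := ((ht.eventually_le_atBot (-(2 / (n : ℝ)) * h)).and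
      (Ioo_mem_nhdsGT hε.1)).exists
    refine exists_level_of_le_of_le
      (fun ρ hρ => hfree ρ ⟨hρ.1, hρ.2.trans_le hε.2⟩ φ) hr2
      (s := ε / 2) ⟨by linarith [hε.1], by linarith [hε.1]⟩ ?_ (hc.le.trans (hm φ).1)
    exact (logSum_le hF hγ₀ hγ₀p hr2.1 (by linarith [hr2.2, hε.2]) φ).trans hr1
  obtain ⟨h₁, hh₁⟩ := hlev ρ₀ ⟨hρpos, le_rfl⟩
  obtain ⟨v, T, hfam, hturn, hest⟩ := exists_symmetricPeriodicFamily hn g hF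
    (by linarith) (Or.inl rfl) hfree (fun ρ hρ φ => one_pos.trans_le (hκ ρ hρ φ))
    (fun γ hγ => by linarith [hd γ hγ]) (I := Ioi h₁) hh₁
  have hsmall : ∀ ε > 0, ∀ᶠ h in atTop, (∀ t j, dist (v h t j) (config g p j) ≤ ε) ∧
      T h ≤ 8 * Real.pi * ε / 1 ∧ 0 < T h := by
    intro ε hε
    obtain ⟨h', hh'⟩ := hlev (min ε ρ₀) ⟨lt_min hε hρpos, min_le_right _ _⟩
    filter_upwards [eventually_gt_atTop h', eventually_gt_atTop h₁] with h h1 h2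
    obtain ⟨h3, h4⟩ := hest h h2 (min ε ρ₀) (min_le_right _ _) (hh' h h1)
    refine ⟨fun t j => (h3 t j).trans (min_le_left _ _), (h4 1 one_pos hκ).trans ?_, ?_⟩
    · have := min_le_left ε ρ₀
      gcongr
    · exact (hfam.loopsAround h h2 ⟨0, by omega⟩).1.1
  refine ⟨h₁, v, T, hfam, hturn, ?_, ?_⟩
  · rw [Metric.tendstoUniformly_iff]
    intro ε hε
    filter_upwards [hsmall (ε / 2) (half_pos hε)] with h hh t
    rw [dist_comm]
    exact ((dist_pi_le_iff (by positivity)).mpr (hh.1 t)).trans_lt (half_lt_self hε)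
  · rw [Metric.tendsto_nhds]
    intro ε hε
    filter_upwards [hsmall (ε / (16 * Real.pi)) (by positivity)] with h hh
    rw [Real.dist_eq, sub_zero, abs_of_pos hh.2.2]
    refine hh.2.1.trans_lt ?_
    have : 8 * Real.pi * (ε / (16 * Real.pi)) / 1 = ε / 2 := by
      field_simp; norm_num
    rw [this]
    exact half_lt_self hε


/-! ### Families around nondegenerate minima of the energy -/

theorem polarPt_zero (e₁ e₂ p : R3) (φ : ℝ) : polarPt e₁ e₂ p 0 φ = p := by simp [polarPt]

theorem radVec_zero (e₁ e₂ p : R3) (φ : ℝ) : radVec e₁ e₂ p 0 φ = dirVec e₁ e₂ φ := by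
  simp [radVec]

theorem isFree_polarPt_of_isFree {e₁ e₂ p : R3} (hF : IsFrame e₁ e₂ p) {d : ℝ} (hd0 : 0 < d)
    (hd : ∀ γ : dihedral n, act γ p ≠ p → d ≤ dist (act γ p) p) (hp : IsFree n p) {ρ : ℝ}
    (h1 : |ρ| ≤ d / 4) (φ : ℝ) : IsFree n (polarPt e₁ e₂ p ρ φ) := by
  intro γ hγ heq
  have h2 := norm_sub_act_ge hF (hd γ (hp γ hγ)) h1 φ
  rw [heq, sub_self, norm_zero] at h2
  linarith

/-- The second radial derivative is negative at `p` in every direction, hence, the circle of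
directions being compact, in a whole disc. The first one vanishes at `ρ = 0` and so decreases to
negative values. -/
theorem exists_forall_logSumDeriv_neg [Fintype (dihedral n)] {e₁ e₂ p : R3} {δ : ℝ} (hδ : 0 < δ)
    (hfree : ∀ ρ, |ρ| ≤ δ → ∀ φ, IsFree n (polarPt e₁ e₂ p ρ φ))
    (hcrit : ∀ φ, logSumDeriv n p (dirVec e₁ e₂ φ) = 0)
    (hneg : ∀ φ, logSumDeriv₂ n p (dirVec e₁ e₂ φ) < 0) :
    ∃ ρ₀ ∈ Ioc 0 δ, ∀ ρ ∈ Ioo 0 ρ₀, ∀ φ,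
      logSumDeriv n (polarPt e₁ e₂ p ρ φ) (radVec e₁ e₂ p ρ φ) < 0 := by
  have hev : ∀ᶠ ρ in 𝓝 (0 : ℝ), ∀ φ ∈ Icc 0 (2 * Real.pi),
      logSumDeriv₂ n (polarPt e₁ e₂ p ρ φ) (radVec e₁ e₂ p ρ φ) < 0 := by
    refine isCompact_Icc.eventually_forall_of_forall_eventually fun φ _ => ?_
    have hc : ContinuousAt (fun y : ℝ × ℝ => logSumDeriv₂ n (polarPt e₁ e₂ p y.1 y.2)
        (radVec e₁ e₂ p y.1 y.2)) (0, φ) :=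
      continuousAt_logSumDeriv₂ (continuous_polarPt e₁ e₂ p).continuousAt
        (continuous_radVec e₁ e₂ p).continuousAt (hfree 0 (by simpa using hδ.le) φ)
    refine hc.eventually_lt_const ?_
    simp only [polarPt_zero, radVec_zero]
    exact hneg φ
  obtain ⟨r, hr, hball⟩ := Metric.eventually_nhds_iff.mp hev
  refine ⟨min r δ, ⟨lt_min hr hδ, min_le_right _ _⟩, fun ρ hρ φ => ?_⟩
  have hd : ∀ s, |s| ≤ δ →
      HasDerivAt (fun s => logSumDeriv n (polarPt e₁ e₂ p s φ) (radVec e₁ e₂ p s φ))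
        (logSumDeriv₂ n (polarPt e₁ e₂ p s φ) (radVec e₁ e₂ p s φ)) s := fun s hs =>
    hasDerivAt_logSumDeriv (hasDerivAt_polarPt_left e₁ e₂ p s φ)
      (hasDerivAt_radVec_left e₁ e₂ p s φ) (hfree s hs φ)
  have hb : ∀ s ∈ Icc 0 ρ, |s| ≤ δ ∧ |s| < r := fun s hs => by
    rw [abs_of_nonneg hs.1]
    exact ⟨(hs.2.trans hρ.2.le).trans (min_le_right _ _),
      (hs.2.trans_lt hρ.2).trans_le (min_le_left _ _)⟩
  have hanti : StrictAntiOn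
      (fun s => logSumDeriv n (polarPt e₁ e₂ p s φ) (radVec e₁ e₂ p s φ)) (Icc 0 ρ) := by
    refine strictAntiOn_of_deriv_neg (convex_Icc 0 ρ)
      (fun s hs => (hd s (hb s hs).1).continuousAt.continuousWithinAt) fun s hs => ?_
    rw [interior_Icc] at hs
    have hs' := hb s (Ioo_subset_Icc_self hs)
    rw [(hd s hs'.1).deriv]
    have hper : Function.Periodic
        (fun φ => logSumDeriv₂ n (polarPt e₁ e₂ p s φ) (radVec e₁ e₂ p s φ)) (2 * Real.pi) :=
      fun φ => by simp only [polarPt_add_two_pi, radVec_add_two_pi]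
    obtain ⟨ψ, hψ, he⟩ := hper.exists_mem_Ico₀ Real.two_pi_pos φ
    rw [he]
    exact hball (by rw [Real.dist_eq, sub_zero]; exact hs'.2) ψ (Ico_subset_Icc_self hψ)
  have := hanti (left_mem_Icc.mpr hρ.1.le) (right_mem_Icc.mpr hρ.1.le) hρ.1
  simpa only [polarPt_zero, radVec_zero, hcrit] using this

theorem isEquilibrium_config [Fintype (dihedral n)] (g : Fin (2 * n) ≃ dihedral n)
    {e₁ e₂ p : R3} (hF : IsFrame e₁ e₂ p) (hp : IsFree n p)
    (hcrit : ∀ φ, logSumDeriv n p (dirVec e₁ e₂ φ) = 0) : IsEquilibrium (config g p) := by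
  refine ⟨config_mem g hp hF.norm₃, ?_⟩
  have h1 : logSumDeriv n p e₁ = 0 := by simpa [dirVec] using hcrit 0
  have h2 : logSumDeriv n p e₂ = 0 := by simpa [dirVec] using hcrit (Real.pi / 2)
  funext j
  rw [vortexField_config, reducedField_eq hF.cross_eq hF.inner₃₁ hF.inner₃₂, h1, h2]
  simp [act_zero]

/-- A nondegenerate maximum of `logSum` is a minimum of the energy; the nearby levels are closed
curves. Since `logSum` decreases outwards, they are traversed with `k = -1`. -/
theorem exists_family_of_minimum [Fintype (dihedral n)] (hn : n ≠ 0)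
    (g : Fin (2 * n) ≃ dihedral n) {e₁ e₂ p : R3} (hF : IsFrame e₁ e₂ p) (hp : IsFree n p)
    (hcrit : ∀ φ, logSumDeriv n p (dirVec e₁ e₂ φ) = 0)
    (hneg : ∀ φ, logSumDeriv₂ n p (dirVec e₁ e₂ φ) < 0) :
    ∃ h₁ : ℝ, energy (config g p) < h₁ ∧
    ∃ (v : ℝ → ℝ → Fin (2 * n) → R3) (T : ℝ → ℝ),
      IsSymmetricPeriodicFamily g (config g p) (Ioo (energy (config g p)) h₁) v T ∧
      TendstoUniformly v (fun _ => config g p) (𝓝[>] (energy (config g p))) := by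
  obtain ⟨d, hd0, hd⟩ := exists_separation (n := n) p
  have hnpos : (0 : ℝ) < n := by exact_mod_cast Nat.pos_of_ne_zero hn
  have hpi := Real.pi_gt_three
  have hδ : 0 < min (d / 4) 1 := lt_min (by positivity) one_pos
  obtain ⟨ρ₀, hρ₀, hder⟩ := exists_forall_logSumDeriv_neg hδ
    (fun ρ hρ φ => isFree_polarPt_of_isFree hF hd0 hd hp (hρ.trans (min_le_left _ _)) φ)
    hcrit hneg
  have hρd : ρ₀ ≤ d / 4 := hρ₀.2.trans (min_le_left _ _)
  have hρ1 : ρ₀ ≤ 1 := hρ₀.2.trans (min_le_right _ _)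
  have hfree0 : ∀ ρ ∈ Ico 0 ρ₀, ∀ φ, IsFree n (polarPt e₁ e₂ p ρ φ) := fun ρ hρ φ =>
    isFree_polarPt_of_isFree hF hd0 hd hp (by rw [abs_of_nonneg hρ.1]; linarith [hρ.2]) φ
  have hfree : ∀ ρ ∈ Ioo 0 ρ₀, ∀ φ, IsFree n (polarPt e₁ e₂ p ρ φ) := fun ρ hρ =>
    hfree0 ρ (Ioo_subset_Ico_self hρ)
  have hd1 : ∀ φ, ∀ ρ ∈ Ico 0 ρ₀, HasDerivAt (fun s => logSum n (polarPt e₁ e₂ p s φ))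
      (logSumDeriv n (polarPt e₁ e₂ p ρ φ) (radVec e₁ e₂ p ρ φ)) ρ := fun φ ρ hρ =>
    hasDerivAt_logSum (hasDerivAt_polarPt_left e₁ e₂ p ρ φ) (hfree0 ρ hρ φ)
  have hlt : ∀ ρ ∈ Ioo 0 ρ₀, ∀ φ, logSum n (polarPt e₁ e₂ p ρ φ) < logSum n p := by
    intro ρ hρ φ
    have hanti : StrictAntiOn (fun s => logSum n (polarPt e₁ e₂ p s φ)) (Icc 0 ρ) := by
      refine strictAntiOn_of_deriv_neg (convex_Icc 0 ρ) (fun s hs =>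
        (hd1 φ s ⟨hs.1, hs.2.trans_lt hρ.2⟩).continuousAt.continuousWithinAt) fun s hs => ?_
      rw [interior_Icc] at hs
      rw [(hd1 φ s ⟨hs.1.le, hs.2.trans hρ.2⟩).deriv]
      exact hder s ⟨hs.1, hs.2.trans hρ.2⟩ φ
    have := hanti (left_mem_Icc.mpr hρ.1.le) (right_mem_Icc.mpr hρ.1.le) hρ.1
    simpa only [polarPt_zero] using this
  have hE : energy (config g p) = -(n / 2) * logSum n p := energy_config g p
  have hlev : ∀ ε ∈ Ioc 0 ρ₀, ∃ h' > energy (config g p), ∀ h ∈ Ioo (energy (config g p)) h', ∀ φ,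
      ∃ ρ ∈ Ioo 0 ε, logSum n (polarPt e₁ e₂ p ρ φ) = -(2 / n) * h := by
    intro ε hε
    have hmem : ε / 2 ∈ Ioo 0 ρ₀ := ⟨by linarith [hε.1], by linarith [hε.1, hε.2]⟩
    obtain ⟨φ₀, φ₁, hm⟩ := exists_extrema_logSum (hfree (ε / 2) hmem)
    have hM := hlt _ hmem φ₁
    set M := logSum n (polarPt e₁ e₂ p (ε / 2) φ₁)
    have h2n : (0 : ℝ) < n / 2 := by positivity
    -- This is the energy of the largest value `M` of `logSum` on the circle of radius `ε / 2`. A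
    -- level strictly between `M` and the value at `p` is met on each ray at a positive radius below
    -- `ε`.
    refine ⟨-(n / 2) * M, by rw [hE]; nlinarith, fun h hh φ => ?_⟩
    have hch : h = -(n / 2) * (-(2 / (n : ℝ)) * h) := by field_simp
    set c := -(2 / (n : ℝ)) * h
    rw [hE, hch] at hh
    have hc1 : M < c := by nlinarith [hh.2]
    have hc2 : c < logSum n p := by nlinarith [hh.1]
    have hcont : ContinuousAt (fun s => logSum n (polarPt e₁ e₂ p s φ)) 0 :=
      (hd1 φ 0 ⟨le_rfl, hρ₀.1⟩).continuousAt
    have hev : ∀ᶠ s in 𝓝[>] (0 : ℝ), c < logSum n (polarPt e₁ e₂ p s φ) :=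
      (hcont.eventually_const_lt (by simpa only [polarPt_zero] using hc2)).filter_mono
        nhdsWithin_le_nhds
    obtain ⟨s, hs1, hs2⟩ := (hev.and (Ioo_mem_nhdsGT hε.1)).exists
    exact exists_level_of_le_of_le (fun ρ hρ => hfree ρ ⟨hρ.1, hρ.2.trans_le hε.2⟩ φ)
      (r := ε / 2) ⟨by linarith [hε.1], by linarith [hε.1]⟩ hs2 ((hm φ).2.trans hc1.le) hs1.le
  obtain ⟨h₁, hh₀, hh₁⟩ := hlev ρ₀ ⟨hρ₀.1, le_rfl⟩
  obtain ⟨v, T, hfam, -, hest⟩ := exists_symmetricPeriodicFamily hn g hF (k := -1)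
    (by linarith) (Or.inr rfl) hfree (fun ρ hρ φ => by
      have := hder ρ hρ φ
      push_cast
      linarith)
    (fun γ hγ => by linarith [hd γ hγ]) hh₁
  refine ⟨h₁, hh₀, v, T, hfam, ?_⟩
  rw [Metric.tendstoUniformly_iff]
  intro ε hε
  obtain ⟨h', hh0, hh'⟩ := hlev (min (ε / 2) ρ₀) ⟨lt_min (half_pos hε) hρ₀.1, min_le_right _ _⟩
  filter_upwards [Ioo_mem_nhdsGT hh0, Ioo_mem_nhdsGT hh₀] with h h1 h2 t
  obtain ⟨h3, -⟩ := hest h h2 _ (min_le_right _ _) (hh' h h1)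
  rw [dist_comm]
  exact ((dist_pi_le_iff (by positivity)).mpr
    fun j => (h3 t j).trans (min_le_left _ _)).trans_lt (half_lt_self hε)

/-- Second derivatives are bounded by the quadratic growth of a bound for the function. -/
theorem second_deriv_le_of_le {k k₁ F : ℝ → ℝ} {k₂ L : ℝ}
    (hk : ∀ᶠ ρ in 𝓝 0, HasDerivAt k (k₁ ρ) ρ) (hk₁ : HasDerivAt k₁ k₂ 0) (h0 : k₁ 0 = 0)
    (hle : ∀ᶠ ρ in 𝓝 0, k ρ - k 0 ≤ -F ρ) (hF : Tendsto (fun ρ => F ρ / ρ ^ 2) (𝓝[≠] 0) (𝓝 L)) :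
    k₂ ≤ -(2 * L) := by
  by_contra! hcon
  obtain ⟨q, hq1, hq2⟩ := exists_between hcon
  -- If `k₂ > q > -2L`, then `D` has a strict second-order minimum at `0`, so `k` grows at least
  -- like `q ρ² / 2`; the bound by `-F` then forces `L ≤ -q / 2`, a contradiction.
  set D : ℝ → ℝ := fun ρ => k ρ - q / 2 * ρ ^ 2 with hD
  have hD1 : ∀ᶠ ρ in 𝓝 0, HasDerivAt D (k₁ ρ - q * ρ) ρ := by
    filter_upwards [hk] with ρ hρ
    refine (hρ.sub ((hasDerivAt_pow 2 ρ).const_mul (q / 2))).congr_deriv ?_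
    norm_num
    ring
  have hdD : deriv D =ᶠ[𝓝 0] fun ρ => k₁ ρ - q * ρ := by
    filter_upwards [hD1] with ρ hρ
    exact hρ.deriv
  have hD2 : HasDerivAt (fun ρ => k₁ ρ - q * ρ) (k₂ - q) 0 := by
    exact (hk₁.sub ((hasDerivAt_id (0 : ℝ)).const_mul q)).congr_deriv (by ring)
  have hmin : IsLocalMin D 0 := by
    refine isLocalMin_of_deriv_deriv_pos ?_ ?_ hD1.self_of_nhds.continuousAt
    · rw [hdD.deriv_eq, hD2.deriv]; linarith
    · rw [hD1.self_of_nhds.deriv, h0]; ring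
  have hFle : ∀ᶠ ρ in 𝓝[≠] (0 : ℝ), F ρ / ρ ^ 2 ≤ -q / 2 := by
    filter_upwards [hmin.filter_mono nhdsWithin_le_nhds, hle.filter_mono nhdsWithin_le_nhds,
      self_mem_nhdsWithin] with ρ h1 h2 h3
    have h4 : 0 < ρ ^ 2 := by
      have : ρ ≠ 0 := h3
      positivity
    rw [div_le_iff₀ h4]
    simp only [hD] at h1
    nlinarith
  have := le_of_tendsto hF hFle
  linarith


/-! ### Closed form of the reduced energy -/

theorem act_rotGen_pow_coord (k : ℕ) (u : R3) :
    act (rotGen n ^ k) u 0 = Real.cos (k * (2 * Real.pi / n)) * u 0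
      - Real.sin (k * (2 * Real.pi / n)) * u 1 ∧
    act (rotGen n ^ k) u 1 = Real.sin (k * (2 * Real.pi / n)) * u 0
      + Real.cos (k * (2 * Real.pi / n)) * u 1 ∧
    act (rotGen n ^ k) u 2 = u 2 := by
  refine ⟨?_, ?_, ?_⟩ <;> (rw [act_coord, coe_rotGen_pow]; simp [rotMat]; try ring)

theorem act_flip_coord (k : ℕ) (u : R3) :
    act (rotGen n ^ k * flipGen n) u 0 = Real.cos (k * (2 * Real.pi / n)) * u 0
      + Real.sin (k * (2 * Real.pi / n)) * u 1 ∧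
    act (rotGen n ^ k * flipGen n) u 1 = Real.sin (k * (2 * Real.pi / n)) * u 0
      - Real.cos (k * (2 * Real.pi / n)) * u 1 ∧
    act (rotGen n ^ k * flipGen n) u 2 = -u 2 := by
  refine ⟨?_, ?_, ?_⟩ <;> (rw [act_coord, coe_rotGen_pow_mul_flipGen]; simp [flipMat, sub_eq_add_neg])

theorem normSq_eq_sum (x : R3) : ‖x‖ ^ 2 = x 0 ^ 2 + x 1 ^ 2 + x 2 ^ 2 := by
  rw [← real_inner_self_eq_norm_sq, inner_eq_sum]; ring

theorem normSq_sub_rot (k : ℕ) (u : R3) : ‖u - act (rotGen n ^ k) u‖ ^ 2 =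
    (2 - 2 * Real.cos (k * (2 * Real.pi / n))) * (u 0 ^ 2 + u 1 ^ 2) := by
  obtain ⟨h0, h1, h2⟩ := act_rotGen_pow_coord (n := n) k u
  rw [normSq_eq_sum]
  simp only [PiLp.sub_apply, h0, h1, h2]
  have := Real.sin_sq_add_cos_sq (k * (2 * Real.pi / n))
  linear_combination (u 0 ^ 2 + u 1 ^ 2) * this

theorem normSq_sub_flip (k : ℕ) {u : R3} (hu : ‖u‖ = 1) :
    ‖u - act (rotGen n ^ k * flipGen n) u‖ ^ 2 =
    2 + 2 * u 2 ^ 2 - 2 * (Real.cos (k * (2 * Real.pi / n)) * (u 0 ^ 2 - u 1 ^ 2)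
      + Real.sin (k * (2 * Real.pi / n)) * (2 * u 0 * u 1)) := by
  obtain ⟨h0, h1, h2⟩ := act_flip_coord (n := n) k u
  have hu2 : u 0 ^ 2 + u 1 ^ 2 + u 2 ^ 2 = 1 := by rw [← normSq_eq_sum, hu]; norm_num
  rw [normSq_eq_sum]
  simp only [PiLp.sub_apply, h0, h1, h2]
  have := Real.sin_sq_add_cos_sq (k * (2 * Real.pi / n))
  linear_combination (u 0 ^ 2 + u 1 ^ 2) * this + 2 * hu2

theorem prod_sub_rootsOfUnity (hn : n ≠ 0) (x y : ℂ) :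
    ∏ k : Fin n, (x - Complex.exp (2 * Real.pi * Complex.I / n) ^ (k : ℕ) * y) = x ^ n - y ^ n := by
  classical
  have hprim := Complex.isPrimitiveRoot_exp n hn
  have hpos := Nat.pos_of_ne_zero hn
  rw [hprim.pow_sub_pow_eq_prod_sub_mul x y hpos]
  refine Finset.prod_bij (fun k _ => Complex.exp (2 * Real.pi * Complex.I / n) ^ (k : ℕ)) ?_ ?_ ?_ ?_
  · intro k _
    rw [Polynomial.mem_nthRootsFinset hpos, pow_right_comm, hprim.pow_eq_one, one_pow]
  · intro k _ l _ h
    exact Fin.ext (hprim.pow_inj k.2 l.2 h)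
  · intro b hb
    rw [Polynomial.mem_nthRootsFinset hpos] at hb
    have : NeZero n := ⟨hn⟩
    obtain ⟨i, hi, rfl⟩ := hprim.eq_pow_of_pow_eq_one hb
    exact ⟨⟨i, hi⟩, Finset.mem_univ _, rfl⟩
  · intro k _
    rfl

/-- Let `z = u 2`, `ω = (u 0 + i u 1)²`, `x = 1 + z` and `y = conj ω / x`, so that `|y| = 1 - z`.
The `k`-th factor is `|x - μ^k y|²` with `μ` the primitive root of unity, so the product is `|x^n -
y^n|²` and depends on the longitude through `Re ω^n` alone. The twist by `e` makes the square of `q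
= ((u 0 + i u 1) e)^n` equal to `-ω^n`, so `Re ω^n = 2 (Im q)² - |q|²`: this exhibits the product as
a perfect square minus a term vanishing on the anti-prism meridians. -/
theorem prod_flip (hn : n ≠ 0) {u : R3} (hu : ‖u‖ = 1) (hz : u 2 ^ 2 < 1) {e : ℂ} (he : ‖e‖ = 1)
    (he2 : e ^ (2 * n) = -1) :
    ∏ k : Fin n, ‖u - act (rotGen n ^ (k : ℕ) * flipGen n) u‖ ^ 2 =
      ((1 + u 2) ^ n + (1 - u 2) ^ n) ^ 2
        - 4 * ((((u 0 : ℂ) + u 1 * Complex.I) * e) ^ n).im ^ 2 := by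
  have hu2 : u 0 ^ 2 + u 1 ^ 2 + u 2 ^ 2 = 1 := by rw [← normSq_eq_sum, hu]; norm_num
  set z := u 2 with hzdef
  have h1z : 0 < 1 + z := by nlinarith
  set ω : ℂ := ((u 0 : ℂ) + u 1 * Complex.I) ^ 2 with hω
  have hωre : ω.re = u 0 ^ 2 - u 1 ^ 2 := by simp [hω, sq]
  have hωim : ω.im = 2 * u 0 * u 1 := by simp [hω, sq]; ring
  set x : ℂ := ((1 + z : ℝ) : ℂ) with hx
  set y : ℂ := (starRingEnd ℂ) ω / x with hy
  have hx0 : x ≠ 0 := by rw [hx]; exact_mod_cast h1z.ne'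
  have hnormω : Complex.normSq ω = (1 - z ^ 2) ^ 2 := by
    rw [Complex.normSq_apply, hωre, hωim]
    have : u 0 ^ 2 + u 1 ^ 2 = 1 - z ^ 2 := by linarith
    rw [← this]; ring
  have hnormy : Complex.normSq y = (1 - z) ^ 2 := by
    rw [hy, Complex.normSq_div, Complex.normSq_conj, hnormω, hx, Complex.normSq_ofReal]
    field_simp
    ring
  have hxy : x * y = (starRingEnd ℂ) ω := by rw [hy]; field_simp
  have hterm : ∀ k : Fin n, ‖u - act (rotGen n ^ (k : ℕ) * flipGen n) u‖ ^ 2 =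
      Complex.normSq (x - Complex.exp (2 * Real.pi * Complex.I / n) ^ (k : ℕ) * y) := by
    intro k
    have hμ : Complex.exp (2 * Real.pi * Complex.I / n) ^ (k : ℕ) =
        Complex.exp (((k : ℕ) * (2 * Real.pi / n) : ℝ) * Complex.I) := by
      rw [← Complex.exp_nat_mul]
      congr 1
      push_cast
      ring
    rw [normSq_sub_flip _ hu, hμ, Complex.normSq_sub, Complex.normSq_mul, hnormy]
    set α : ℝ := (k : ℕ) * (2 * Real.pi / n)
    have h1 : Complex.normSq (Complex.exp (α * Complex.I)) = 1 := by
      rw [Complex.normSq_eq_norm_sq, Complex.norm_exp_ofReal_mul_I]; norm_num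
    have h2 : (x * (starRingEnd ℂ) (Complex.exp (α * Complex.I) * y)).re =
        Real.cos α * (u 0 ^ 2 - u 1 ^ 2) + Real.sin α * (2 * u 0 * u 1) := by
      have h3 : x * (starRingEnd ℂ) (Complex.exp (α * Complex.I) * y) =
          (starRingEnd ℂ) (Complex.exp (α * Complex.I)) * ω := by
        have hxc : (starRingEnd ℂ) x = x := by rw [hx]; exact Complex.conj_ofReal _
        have h4 : x * (starRingEnd ℂ) y = ω := by
          rw [← hxc, ← map_mul, hxy, Complex.conj_conj]
        rw [map_mul, ← h4]
        ring
      rw [h3, Complex.mul_re, hωre, hωim, Complex.conj_re, Complex.conj_im,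
        Complex.exp_ofReal_mul_I_re, Complex.exp_ofReal_mul_I_im]
      ring
    rw [h1, h2, hx, Complex.normSq_ofReal]
    ring
  set q : ℂ := (((u 0 : ℂ) + u 1 * Complex.I) * e) ^ n with hq
  have hq2 : q ^ 2 = -ω ^ n := by
    have : q ^ 2 = ω ^ n * e ^ (2 * n) := by
      rw [hq, hω, ← pow_mul _ 2 n, ← mul_pow, ← pow_mul, mul_comm n 2]
    rw [this, he2]; ring
  have hqn : Complex.normSq q = (1 - z ^ 2) ^ n := by
    have h1 : Complex.normSq e = 1 := by rw [Complex.normSq_eq_norm_sq, he]; norm_num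
    rw [hq, map_pow, map_mul, h1, mul_one, Complex.normSq_add_mul_I]
    congr 1
    linarith
  have hre : (ω ^ n).re = 2 * q.im ^ 2 - (1 - z ^ 2) ^ n := by
    have h1 : (ω ^ n).re = -(q ^ 2).re := by rw [hq2]; simp
    rw [h1, ← hqn, Complex.normSq_apply, sq, Complex.mul_re]
    ring
  rw [Finset.prod_congr rfl fun k _ => hterm k, ← map_prod, prod_sub_rootsOfUnity hn,
    Complex.normSq_sub, map_pow, map_pow, hnormy]
  have h5 : (x ^ n * (starRingEnd ℂ) (y ^ n)).re = (ω ^ n).re := by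
    have hxc : (starRingEnd ℂ) x = x := by rw [hx]; exact Complex.conj_ofReal _
    have h4 : x * (starRingEnd ℂ) y = ω := by
      rw [← hxc, ← map_mul, hxy, Complex.conj_conj]
    rw [map_pow, ← mul_pow, h4]
  rw [h5, hre, hx, Complex.normSq_ofReal]
  have h6 : (1 - z ^ 2) ^ n = (1 + z) ^ n * (1 - z) ^ n := by rw [← mul_pow]; congr 1; ring
  rw [h6, mul_pow, pow_right_comm (1 - z) 2 n]
  ring

theorem two_sub_cos_ne_zero {k : ℕ} (hk0 : k ≠ 0) (hk : k < n) :
    2 - 2 * Real.cos (k * (2 * Real.pi / n)) ≠ 0 := by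
  intro h
  have h1 : Real.cos (k * (2 * Real.pi / n)) = 1 := by linarith
  have h2 : Real.sin (k * (2 * Real.pi / n)) = 0 := by
    have := Real.sin_sq_add_cos_sq (k * (2 * Real.pi / n))
    rw [h1] at this
    nlinarith
  refine hk0 (rotGen_pow_inj hk (l := 0) (Nat.pos_of_ne_zero (by omega)) ?_)
  simp only [rotMat, h1, h2]
  simp

theorem logSum_eq_log [Fintype (dihedral n)] (hn : n ≠ 0) {u : R3} (hfree : IsFree n u)
    (hu : ‖u‖ = 1) (hz : u 2 ^ 2 < 1) {e : ℂ} (he : ‖e‖ = 1) (he2 : e ^ (2 * n) = -1) :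
    logSum n u = ∑ k : Fin n, Real.log (2 - 2 * Real.cos ((k : ℕ) * (2 * Real.pi / n)))
      + (n - 1) * Real.log (1 - u 2 ^ 2)
      + Real.log (((1 + u 2) ^ n + (1 - u 2) ^ n) ^ 2
        - 4 * ((((u 0 : ℂ) + u 1 * Complex.I) * e) ^ n).im ^ 2) := by
  have hu2 : u 0 ^ 2 + u 1 ^ 2 + u 2 ^ 2 = 1 := by rw [← normSq_eq_sum, hu]; norm_num
  have h01 : u 0 ^ 2 + u 1 ^ 2 = 1 - u 2 ^ 2 := by linarith
  rw [logSum, sum_dihedral hn, ← prod_flip hn hu hz he he2, Real.log_prod]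
  · congr 1
    -- The summand `k = 0` is `log 0 = 0`; the subtracted indicator corrects it and leaves `n - 1`
    -- copies of `log (1 - z²)`.
    have hterm : ∀ k : Fin n, Real.log (‖u - act (rotGen n ^ (k : ℕ)) u‖ ^ 2) =
        Real.log (2 - 2 * Real.cos ((k : ℕ) * (2 * Real.pi / n)))
          + (Real.log (1 - u 2 ^ 2) - if (k : ℕ) = 0 then Real.log (1 - u 2 ^ 2) else 0) := by
      intro k
      rw [normSq_sub_rot, h01]
      by_cases hk : (k : ℕ) = 0
      · simp [hk]
      · rw [Real.log_mul (two_sub_cos_ne_zero hk k.2) (by linarith), if_neg hk, sub_zero]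
    obtain ⟨m, rfl⟩ := Nat.exists_eq_succ_of_ne_zero hn
    rw [Finset.sum_congr rfl fun k _ => hterm k, Finset.sum_add_distrib, Finset.sum_sub_distrib]
    congr 1
    rw [Fin.sum_univ_succ (fun k : Fin (m + 1) => if (k : ℕ) = 0 then _ else _)]
    simp
    ring
  · intro k _
    exact hfree.normSq_ne_zero fun h =>
      rotGen_pow_ne_mul_flipGen (n := n) 0 k (by rw [pow_zero, h])


/-! ### The height of the anti-prism -/

/-- The sum `(1 + z)^n + (1 - z)^n`. -/
def powSum (n : ℕ) (z : ℝ) : ℝ := (1 + z) ^ n + (1 - z) ^ n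

/-- The function whose zeros are the critical heights. -/
def critFun (n : ℕ) (z : ℝ) : ℝ :=
  n * (((1 + z) ^ n - (1 - z) ^ n) / powSum n z) - (2 * n - 1) * z

/-- The derivative of `critFun`. -/
def critFunDeriv (n : ℕ) (z : ℝ) : ℝ :=
  n * (4 * n * (1 - z ^ 2) ^ (n - 1) / powSum n z ^ 2) - (2 * n - 1)

/-- The reduced energy on the meridians of the anti-prism, up to a constant. -/
def profile (n : ℕ) (z : ℝ) : ℝ := (n - 1) * Real.log (1 - z ^ 2) + 2 * Real.log (powSum n z)

theorem powSum_pos {z : ℝ} (hz : z ∈ Ioc (-1) 1) : 0 < powSum n z := by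
  have h1 : 0 < 1 + z := by linarith [hz.1]
  have h2 : 0 ≤ 1 - z := by linarith [hz.2]
  unfold powSum
  positivity

theorem hasDerivAt_one_add_pow (n : ℕ) (z : ℝ) :
    HasDerivAt (fun z : ℝ => (1 + z) ^ n) (n * (1 + z) ^ (n - 1)) z := by
  simpa using ((hasDerivAt_id z).const_add 1).fun_pow n

theorem hasDerivAt_one_sub_pow (n : ℕ) (z : ℝ) :
    HasDerivAt (fun z : ℝ => (1 - z) ^ n) (-(n * (1 - z) ^ (n - 1))) z := by
  simpa using ((hasDerivAt_id z).const_sub 1).fun_pow n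

theorem hasDerivAt_powSum (n : ℕ) (z : ℝ) :
    HasDerivAt (powSum n) (n * ((1 + z) ^ (n - 1) - (1 - z) ^ (n - 1))) z :=
  ((hasDerivAt_one_add_pow n z).add (hasDerivAt_one_sub_pow n z)).congr_deriv (by ring)

theorem hasDerivAt_critFun (hn : n ≠ 0) {z : ℝ} (hz : z ∈ Ioc (-1) 1) :
    HasDerivAt (critFun n) (critFunDeriv n z) z := by
  have h0 := (powSum_pos (n := n) hz).ne'
  have h1 := (((hasDerivAt_one_add_pow n z).sub (hasDerivAt_one_sub_pow n z)).div
    (hasDerivAt_powSum n z) h0).const_mul (n : ℝ)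
  refine (h1.sub ((hasDerivAt_id z).const_mul (2 * (n : ℝ) - 1))).congr_deriv ?_
  obtain ⟨m, rfl⟩ := Nat.exists_eq_succ_of_ne_zero hn
  have e1 : (1 - z ^ 2) ^ m = (1 + z) ^ m * (1 - z) ^ m := by rw [← mul_pow]; congr 1; ring
  simp only [critFunDeriv, Nat.succ_eq_add_one, Nat.add_sub_cancel, e1, mul_one]
  congr 2
  congr 1
  simp only [powSum, Pi.sub_apply, pow_succ]
  ring

theorem critFun_zero (n : ℕ) : critFun n 0 = 0 := by simp [critFun]

/-- The numerator `(1 - z²)^(n-1)` decreases strictly, as `n ≥ 2`, while `powSum` does not decrease.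
Thus `critFun` is strictly concave on `[0, 1]`. -/
theorem strictAntiOn_critFunDeriv (hn : 2 ≤ n) : StrictAntiOn (critFunDeriv n) (Icc 0 1) := by
  have hmono : MonotoneOn (powSum n) (Icc 0 1) := by
    refine monotoneOn_of_deriv_nonneg (convex_Icc 0 1)
      (fun z _ => (hasDerivAt_powSum n z).continuousAt.continuousWithinAt)
      (fun z _ => (hasDerivAt_powSum n z).differentiableAt.differentiableWithinAt) fun z hz => ?_
    rw [interior_Icc] at hz
    rw [(hasDerivAt_powSum n z).deriv]
    have : (1 - z) ^ (n - 1) ≤ (1 + z) ^ (n - 1) :=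
      pow_le_pow_left₀ (by linarith [hz.2]) (by linarith [hz.1]) _
    exact mul_nonneg (Nat.cast_nonneg n) (by linarith)
  intro x hx y hy hxy
  have hnpos : (0 : ℝ) < n := by exact_mod_cast (by omega : 0 < n)
  have h1 : (1 - y ^ 2) ^ (n - 1) < (1 - x ^ 2) ^ (n - 1) :=
    pow_lt_pow_left₀ (by nlinarith [hx.1]) (by nlinarith [hy.1, hy.2]) (by omega)
  have h0 : 0 ≤ (1 - y ^ 2) ^ (n - 1) := pow_nonneg (by nlinarith [hy.1, hy.2]) _
  have hxp : 0 < powSum n x := powSum_pos ⟨by linarith [hx.1], hx.2⟩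
  have h2 : powSum n x ^ 2 ≤ powSum n y ^ 2 := pow_le_pow_left₀ hxp.le (hmono hx hy hxy.le) 2
  have h3 : 4 * n * (1 - y ^ 2) ^ (n - 1) / powSum n y ^ 2 <
      4 * n * (1 - x ^ 2) ^ (n - 1) / powSum n x ^ 2 :=
    div_lt_div₀ (by nlinarith) h2 (by have := h0.trans h1.le; positivity) (by positivity)
  have := mul_lt_mul_of_pos_left h3 hnpos
  simp only [critFunDeriv]
  linarith

theorem exists_critFunDeriv_eq_zero (hn : n ≠ 0) {a b : ℝ} (ha : 0 ≤ a) (hab : a < b) (hb : b ≤ 1)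
    (h : critFun n a = critFun n b) : ∃ c ∈ Ioo a b, critFunDeriv n c = 0 :=
  exists_hasDerivAt_eq_zero hab
    (fun z hz => (hasDerivAt_critFun hn
      ⟨by linarith [hz.1], hz.2.trans hb⟩).continuousAt.continuousWithinAt) h
    fun z hz => hasDerivAt_critFun hn ⟨by linarith [hz.1], hz.2.le.trans hb⟩

/-- By Rolle between the zeros `0` and `z`, the derivative vanishes before `z`, and it decreases
strictly. This sign is the nondegeneracy of the equilibrium in height. -/
theorem critFunDeriv_neg_of_eq_zero (hn : 2 ≤ n) {z : ℝ} (hz : z ∈ Ioo 0 1)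
    (h : critFun n z = 0) : critFunDeriv n z < 0 := by
  obtain ⟨c, hc, hc0⟩ := exists_critFunDeriv_eq_zero (by omega) le_rfl hz.1 hz.2.le
    (by rw [critFun_zero, h] : critFun n 0 = critFun n z)
  rw [← hc0]
  exact strictAntiOn_critFunDeriv hn ⟨hc.1.le, hc.2.le.trans hz.2.le⟩ ⟨hz.1.le, hz.2.le⟩ hc.2

/-- A second zero would make the derivative vanish again after it has become negative. -/
theorem critFun_unique (hn : 2 ≤ n) {x y : ℝ} (hx : x ∈ Ioo 0 1) (hy : y ∈ Ioo 0 1)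
    (hx0 : critFun n x = 0) (hy0 : critFun n y = 0) : x = y := by
  have key : ∀ x ∈ Ioo (0 : ℝ) 1, ∀ y ∈ Ioo (0 : ℝ) 1, critFun n x = 0 → critFun n y = 0 →
      ¬x < y := by
    intro x hx y hy hx0 hy0 hxy
    obtain ⟨c, hc, hc0⟩ := exists_critFunDeriv_eq_zero (n := n) (by omega) hx.1.le hxy hy.2.le
      (by rw [hx0, hy0])
    have h1 := critFunDeriv_neg_of_eq_zero hn hx hx0
    have h2 := strictAntiOn_critFunDeriv hn ⟨hx.1.le, hx.2.le⟩
      ⟨hx.1.le.trans hc.1.le, hc.2.le.trans hy.2.le⟩ hc.1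
    linarith
  exact le_antisymm (not_lt.mp (key y hy x hx hy0 hx0)) (not_lt.mp (key x hx y hy hx0 hy0))

theorem exists_critFun_eq_zero (hn : 2 ≤ n) : ∃ z ∈ Ioo (0 : ℝ) 1, critFun n z = 0 := by
  have hn0 : n ≠ 0 := by omega
  have hn2 : (2 : ℝ) ≤ n := by exact_mod_cast hn
  have h1 : critFun n 1 < 0 := by
    have : critFun n 1 = 1 - n := by
      simp only [critFun, powSum, sub_self, zero_pow hn0, sub_zero, add_zero]
      rw [div_self (by positivity)]
      ring
    rw [this]; linarith
  have hd := hasDerivAt_critFun hn0 (z := 0) ⟨by norm_num, by norm_num⟩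
  have hd0 : 0 < critFunDeriv n 0 := by
    have : critFunDeriv n 0 = (n - 1) ^ 2 := by
      simp [critFunDeriv, powSum]; ring
    rw [this]
    have : (0 : ℝ) < n - 1 := by linarith
    positivity
  have hs := (hasDerivAt_iff_tendsto_slope.mp hd).mono_left
    (nhdsWithin_mono (s := Ioi 0) 0 fun x hx => ne_of_gt hx)
  obtain ⟨z, hz1, hz2⟩ := ((hs.eventually_const_lt hd0).and
    (Ioo_mem_nhdsGT (one_pos : (0 : ℝ) < 1))).exists
  rw [slope_def_field, critFun_zero, sub_zero, sub_zero] at hz1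
  have hz3 : 0 < critFun n z := by
    rcases div_pos_iff.mp hz1 with h | h
    · exact h.1
    · linarith [hz2.1, h.2]
  have hc : ContinuousOn (critFun n) (Icc z 1) := fun x hx =>
    (hasDerivAt_critFun hn0 ⟨by linarith [hx.1, hz2.1], hx.2⟩).continuousAt.continuousWithinAt
  obtain ⟨x, hx, hx0⟩ := intermediate_value_Ioo' hz2.2.le hc ⟨h1, hz3⟩
  exact ⟨x, ⟨hz2.1.trans hx.1, hx.2⟩, hx0⟩

theorem critFun_neg (n : ℕ) (z : ℝ) : critFun n (-z) = -critFun n z := by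
  simp only [critFun, powSum, ← sub_eq_add_neg, sub_neg_eq_add]
  rw [add_comm ((1 - z) ^ n)]
  ring

theorem critFunDeriv_neg (n : ℕ) (z : ℝ) : critFunDeriv n (-z) = critFunDeriv n z := by
  simp only [critFunDeriv, powSum, ← sub_eq_add_neg, sub_neg_eq_add, neg_sq]
  rw [add_comm ((1 - z) ^ n)]

theorem hasDerivAt_profile (hn : n ≠ 0) {z : ℝ} (hz : z ∈ Ioo (-1) 1) :
    HasDerivAt (profile n) (2 / (1 - z ^ 2) * critFun n z) z := by
  have h0 := (powSum_pos (n := n) ⟨hz.1, hz.2.le⟩).ne'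
  have h1 : 1 - z ^ 2 ≠ 0 := by nlinarith [hz.1, hz.2]
  have h2 : HasDerivAt (fun z : ℝ => 1 - z ^ 2) (-(2 * z)) z := by
    simpa using (hasDerivAt_pow 2 z).const_sub 1
  refine (((h2.log h1).const_mul ((n : ℝ) - 1)).add
    (((hasDerivAt_powSum n z).log h0).const_mul 2)).congr_deriv ?_
  obtain ⟨m, rfl⟩ := Nat.exists_eq_succ_of_ne_zero hn
  rw [critFun]
  have h3 : ((1 + z) ^ m - (1 - z) ^ m) * (1 - z ^ 2) =
      ((1 + z) ^ (m + 1) - (1 - z) ^ (m + 1)) - z * powSum (m + 1) z := by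
    simp only [powSum, pow_succ]; ring
  simp only [Nat.succ_eq_add_one, Nat.add_sub_cancel] at h0 ⊢
  have hS : powSum (m + 1) z = (1 + z) ^ (m + 1) + (1 - z) ^ (m + 1) := rfl
  generalize powSum (m + 1) z = S at h0 h3 hS ⊢
  field_simp
  push_cast
  linear_combination (2 * ((m : ℝ) + 1)) * h3 - ((m : ℝ) + 1) * z * hS

theorem profile_sub_le (hn : n ≠ 0) {z₀ : ℝ} (hz : z₀ ∈ Ioo (-1) 1) (h0 : critFun n z₀ = 0)
    (h1 : critFunDeriv n z₀ < 0) :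
    ∃ η > 0, ∀ᶠ z in 𝓝 z₀, profile n z - profile n z₀ ≤ -(η * (z - z₀) ^ 2) := by
  have hz2 : 0 < 1 - z₀ ^ 2 := by nlinarith [hz.1, hz.2]
  set q := 2 / (1 - z₀ ^ 2) * critFunDeriv n z₀ with hq
  have hq0 : q < 0 := mul_neg_of_pos_of_neg (by positivity) h1
  refine ⟨-q / 4, by linarith, ?_⟩
  -- Here `q` is the second derivative of `profile` at `z₀`; adding `-q / 4 * (z - z₀)²` uses up
  -- half of it, so `D` still has a strict local maximum.
  set D : ℝ → ℝ := fun z => profile n z + -q / 4 * (z - z₀) ^ 2 with hD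
  have hD1 : ∀ᶠ z in 𝓝 z₀, HasDerivAt D (2 / (1 - z ^ 2) * critFun n z + -q / 2 * (z - z₀)) z := by
    filter_upwards [Ioo_mem_nhds hz.1 hz.2] with z hz
    refine ((hasDerivAt_profile hn hz).add
      ((((hasDerivAt_id z).sub_const z₀).pow 2).const_mul (-q / 4))).congr_deriv ?_
    simp
    ring
  have hD2 : HasDerivAt (fun z => 2 / (1 - z ^ 2) * critFun n z + -q / 2 * (z - z₀)) (q / 2) z₀ := by
    have h2 : HasDerivAt (fun z : ℝ => 1 - z ^ 2) (-(2 * z₀)) z₀ := by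
      simpa using (hasDerivAt_pow 2 z₀).const_sub 1
    have h3 := (hasDerivAt_const z₀ (2 : ℝ)).div h2 hz2.ne'
    have h4 := h3.mul (hasDerivAt_critFun hn (z := z₀) ⟨hz.1, hz.2.le⟩)
    refine (h4.add (((hasDerivAt_id z₀).sub_const z₀).const_mul (-q / 2))).congr_deriv ?_
    rw [h0, mul_zero, zero_add, Pi.div_apply, ← hq]
    ring
  have hdD : deriv D =ᶠ[𝓝 z₀] fun z => 2 / (1 - z ^ 2) * critFun n z + -q / 2 * (z - z₀) := by
    filter_upwards [hD1] with z hz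
    exact hz.deriv
  have hmax : IsLocalMax D z₀ := by
    refine isLocalMax_of_deriv_deriv_neg ?_ ?_ hD1.self_of_nhds.continuousAt
    · rw [hdD.deriv_eq, hD2.deriv]; linarith
    · rw [hD1.self_of_nhds.deriv, h0]; ring
  filter_upwards [hmax] with z hz
  simp only [hD] at hz
  linarith

/-! ### The Chebyshev polynomial -/

/-- It follows from `T_{2n} (cosh s) = cosh (2ns)` and `U_{2n} (cosh s) sinh s = sinh ((2n + 1) s)`
by the addition and doubling formulas. -/
theorem antiprismPoly_eval_cosh (n : ℕ) (s : ℝ) :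
    (antiprismPoly n).eval (Real.cosh s) * Real.sinh s =
      -2 * Real.cosh (n * s) ^ 2 * Real.cosh s *
        (n * Real.tanh (n * s) - (2 * n - 1) * Real.tanh s) := by
  have hU := Polynomial.Chebyshev.U_real_cosh s (2 * (n : ℤ))
  have hT := Polynomial.Chebyshev.T_real_cosh s (2 * (n : ℤ))
  push_cast at hU hT
  rw [antiprismPoly]
  simp only [Polynomial.eval_add, Polynomial.eval_sub, Polynomial.eval_mul, Polynomial.eval_C, hT]
  have e1 : Real.cosh (2 * n * s) = Real.cosh (n * s) ^ 2 + Real.sinh (n * s) ^ 2 := by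
    rw [mul_assoc, Real.cosh_two_mul]
  have e2 : Real.sinh ((2 * n + 1) * s) = 2 * Real.sinh (n * s) * Real.cosh (n * s) * Real.cosh s
      + (Real.cosh (n * s) ^ 2 + Real.sinh (n * s) ^ 2) * Real.sinh s := by
    rw [add_mul, one_mul, Real.sinh_add, mul_assoc, Real.sinh_two_mul, Real.cosh_two_mul]
  have e3 := Real.cosh_sq (n * s)
  rw [e2] at hU
  have hc1 := (Real.cosh_pos s).ne'
  have hc2 := (Real.cosh_pos (n * s)).ne'
  rw [e1, Real.tanh_eq_sinh_div_cosh, Real.tanh_eq_sinh_div_cosh]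
  field_simp
  linear_combination (-(n : ℝ)) * hU - (2 * (n : ℝ) - 1) * Real.sinh s * e3

/-- Since `1 ± tanh s = exp (± s) / cosh s`, the quotient of `n`-th powers in `critFun` becomes
`tanh (n s)`. -/
theorem critFun_tanh (n : ℕ) (s : ℝ) :
    critFun n (Real.tanh s) = n * Real.tanh (n * s) - (2 * n - 1) * Real.tanh s := by
  have hc := (Real.cosh_pos s).ne'
  have h1 : 1 + Real.tanh s = Real.exp s / Real.cosh s := by
    rw [Real.tanh_eq_sinh_div_cosh, ← Real.cosh_add_sinh]; field_simp
  have h2 : 1 - Real.tanh s = Real.exp (-s) / Real.cosh s := by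
    rw [Real.tanh_eq_sinh_div_cosh, ← Real.cosh_sub_sinh]; field_simp
  have h3 : Real.exp s ^ n = Real.exp (n * s) := (Real.exp_nat_mul s n).symm
  have h4 : Real.exp (-s) ^ n = Real.exp (-(n * s)) := by
    rw [← Real.exp_nat_mul]; congr 1; ring
  rw [critFun, powSum, h1, h2, div_pow, div_pow, h3, h4, Real.tanh_eq_sinh_div_cosh (n * s),
    Real.sinh_eq (n * s), Real.cosh_eq (n * s)]
  have hp : Real.exp (n * s) + Real.exp (-(n * s)) ≠ 0 := by positivity
  congr 2
  field_simp

/-- The root is `cosh (artanh z)`, because `tanh² = 1 - 1 / cosh²`. Every `mu > 1` is `cosh s` with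
`s > 0`, so uniqueness of the root is uniqueness of the zero of `critFun`. -/
theorem isAntiprismHalfHeight_of_critFun (hn : 2 ≤ n) {z : ℝ} (hz : z ∈ Ioo 0 1)
    (h0 : critFun n z = 0) : IsAntiprismHalfHeight n z := by
  have htanh : ∀ s : ℝ, 0 < s → Real.tanh s ∈ Ioo (0 : ℝ) 1 := fun s hs => by
    have h1 := Real.sinh_pos_iff.mpr hs
    rw [Real.tanh_eq_sinh_div_cosh]
    exact ⟨div_pos h1 (Real.cosh_pos s), (div_lt_one (Real.cosh_pos s)).mpr (Real.sinh_lt_cosh s)⟩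
  have hroot : ∀ s : ℝ, 0 < s →
      ((antiprismPoly n).eval (Real.cosh s) = 0 ↔ critFun n (Real.tanh s) = 0) := by
    intro s hs
    have h1 := antiprismPoly_eval_cosh n s
    rw [← critFun_tanh] at h1
    have h2 := (Real.sinh_pos_iff.mpr hs).ne'
    have h3 := (Real.cosh_pos s).ne'
    have h4 := (Real.cosh_pos (n * s)).ne'
    constructor
    · intro h
      rw [h, zero_mul] at h1
      have h5 : -2 * Real.cosh (n * s) ^ 2 * Real.cosh s ≠ 0 :=
        mul_ne_zero (mul_ne_zero (by norm_num) (pow_ne_zero 2 h4)) h3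
      exact (mul_eq_zero.mp h1.symm).resolve_left h5
    · intro h
      rw [h, mul_zero] at h1
      exact (mul_eq_zero.mp h1).resolve_right h2
  have hcosh : ∀ s : ℝ, Real.tanh s ^ 2 = 1 - 1 / Real.cosh s ^ 2 := fun s => by
    have h1 := Real.cosh_sq s
    have h3 := (Real.cosh_pos s).ne'
    rw [Real.tanh_eq_sinh_div_cosh, div_pow]
    field_simp
    linarith
  set s₀ := Real.artanh z with hs₀
  have hzI : z ∈ Ioo (-1) 1 := ⟨by linarith [hz.1], hz.2⟩
  have hzs : Real.tanh s₀ = z := Real.tanh_artanh hzI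
  have hs₀pos : 0 < s₀ := by
    rw [← Real.sinh_pos_iff, Real.sinh_artanh hzI]
    exact div_pos hz.1 (Real.sqrt_pos.mpr (by nlinarith [hz.1, hz.2]))
  refine ⟨hz.1, hz.2, Real.cosh s₀, ⟨Real.one_lt_cosh.mpr hs₀pos.ne',
    (hroot s₀ hs₀pos).mpr (by rw [hzs, h0])⟩, fun mu hmu h => ?_, by rw [← hcosh, hzs]⟩
  have h1 := Real.arcosh_pos hmu
  rw [← Real.cosh_arcosh hmu.le] at h ⊢
  have h2 := critFun_unique hn (htanh _ h1) hz ((hroot _ h1).mp h) h0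
  rw [hs₀, ← h2, Real.artanh_tanh]


/-! ### The anti-prism equilibria -/

/-- The unit vector pointing east at longitude `θ`. -/
def eastVec (θ : ℝ) : R3 := !₂[-Real.sin θ, Real.cos θ, 0]

/-- The unit vector pointing north at longitude `θ` and height `z`. -/
def northVec (θ z : ℝ) : R3 := !₂[-z * Real.cos θ, -z * Real.sin θ, Real.sqrt (1 - z ^ 2)]

theorem isFrame_spherePoint (θ : ℝ) {z : ℝ} (hz : z ^ 2 ≤ 1) :
    IsFrame (eastVec θ) (northVec θ z) (spherePoint θ z) := by
  have h1 := Real.sin_sq_add_cos_sq θ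
  have h2 : Real.sqrt (1 - z ^ 2) ^ 2 = 1 - z ^ 2 := Real.sq_sqrt (by linarith)
  refine ⟨?_, ?_, ?_, ?_⟩
  · rw [inner_eq_sum]; simp [eastVec]; linarith
  · rw [inner_eq_sum]; simp [northVec]; linear_combination z ^ 2 * h1 + h2
  · rw [inner_eq_sum]; simp [eastVec, northVec]; ring
  · apply ext_coord <;>
      simp [eastVec, northVec, spherePoint, cross_zero_coord, cross_one_coord, cross_two_coord] <;>
      first | ring1 | linear_combination z * h1

theorem norm_spherePoint (θ : ℝ) {z : ℝ} (hz : z ^ 2 ≤ 1) : ‖spherePoint θ z‖ = 1 :=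
  (isFrame_spherePoint θ hz).norm₃

/-- A nontrivial rotation moves every point off the axis, and a half-turn changes the sign of the
height. -/
theorem isFree_spherePoint (hn : n ≠ 0) (θ : ℝ) {z : ℝ} (hz0 : z ≠ 0) (hz : z ^ 2 < 1) :
    IsFree n (spherePoint θ z) := by
  intro γ hγ heq
  rcases exists_rot_or_flip hn γ with ⟨k, hk, rfl⟩ | ⟨k, hk, rfl⟩
  · have hk0 : k ≠ 0 := by rintro rfl; exact hγ (pow_zero _)
    have h1 := normSq_sub_rot (n := n) k (spherePoint θ z)
    have h2 : ‖spherePoint θ z‖ ^ 2 = 1 := by rw [norm_spherePoint θ hz.le]; norm_num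
    rw [normSq_eq_sum] at h2
    have h3 : spherePoint θ z 2 = z := by simp [spherePoint]
    rw [h3] at h2
    rw [heq, sub_self, norm_zero] at h1
    have h4 := mul_ne_zero (two_sub_cos_ne_zero hk0 hk)
      (show spherePoint θ z 0 ^ 2 + spherePoint θ z 1 ^ 2 ≠ 0 by nlinarith)
    exact h4 (by rw [← h1]; norm_num)
  · have h1 := (act_flip_coord (n := n) k (spherePoint θ z)).2.2
    rw [heq] at h1
    simp only [spherePoint] at h1
    simp at h1
    exact hz0 (by linarith)

/-- The constant part of the reduced energy. -/
def logSumConst (n : ℕ) : ℝ :=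
  ∑ k : Fin n, Real.log (2 - 2 * Real.cos ((k : ℕ) * (2 * Real.pi / n)))

theorem logSum_eq_profile [Fintype (dihedral n)] (hn : n ≠ 0) {u : R3} (hfree : IsFree n u)
    (hu : ‖u‖ = 1) (hz : u 2 ^ 2 < 1) {e : ℂ} (he : ‖e‖ = 1) (he2 : e ^ (2 * n) = -1)
    (hY : ((((u 0 : ℂ) + u 1 * Complex.I) * e) ^ n).im = 0) :
    logSum n u = logSumConst n + profile n (u 2) := by
  rw [logSum_eq_log hn hfree hu hz he he2, hY, profile, logSumConst, powSum]
  rw [show ((1 + u 2) ^ n + (1 - u 2) ^ n) ^ 2 - 4 * (0 : ℝ) ^ 2 =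
    ((1 + u 2) ^ n + (1 - u 2) ^ n) ^ 2 by ring, Real.log_pow]
  push_cast
  ring

/-- With `S = powSum n (u 2)`, the inequality `log t ≤ t - 1` gives `log (S² - 4Y²) ≤ 2 log S - 4Y²
/ S²`, and `S ≤ 2 * 2^n` turns the last term into `Y² / 4^n`. -/
theorem logSum_le_profile [Fintype (dihedral n)] (hn : n ≠ 0) {u : R3} (hfree : IsFree n u)
    (hu : ‖u‖ = 1) (hz : u 2 ^ 2 < 1) {e : ℂ} (he : ‖e‖ = 1) (he2 : e ^ (2 * n) = -1) :
    logSum n u ≤ logSumConst n + profile n (u 2)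
      - 1 / 4 ^ n * ((((u 0 : ℂ) + u 1 * Complex.I) * e) ^ n).im ^ 2 := by
  have hpos : 0 < ((1 + u 2) ^ n + (1 - u 2) ^ n) ^ 2
      - 4 * ((((u 0 : ℂ) + u 1 * Complex.I) * e) ^ n).im ^ 2 := by
    rw [← prod_flip hn hu hz he he2]
    refine Finset.prod_pos fun k _ => lt_of_le_of_ne (sq_nonneg _)
      (hfree.normSq_ne_zero fun h => rotGen_pow_ne_mul_flipGen (n := n) 0 k ?_).symm
    rw [pow_zero, h]
  rw [logSum_eq_log hn hfree hu hz he he2]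
  have hzz := (sq_lt_one_iff_abs_lt_one _).mp hz
  rw [abs_lt] at hzz
  set Y := ((((u 0 : ℂ) + u 1 * Complex.I) * e) ^ n).im
  have hS : 0 < powSum n (u 2) := powSum_pos ⟨hzz.1, hzz.2.le⟩
  have hS2 : powSum n (u 2) ≤ 2 * 2 ^ n := by
    have h1 : (1 + u 2) ^ n ≤ 2 ^ n := pow_le_pow_left₀ (by linarith) (by linarith) n
    have h2 : (1 - u 2) ^ n ≤ 2 ^ n := pow_le_pow_left₀ (by linarith) (by linarith) n
    unfold powSum
    linarith
  change 0 < powSum n (u 2) ^ 2 - 4 * Y ^ 2 at hpos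
  change logSumConst n + _ + Real.log (powSum n (u 2) ^ 2 - 4 * Y ^ 2) ≤ _
  rw [profile]
  set S := powSum n (u 2)
  have h3 := Real.log_le_sub_one_of_pos (div_pos hpos (pow_pos hS 2))
  rw [Real.log_div hpos.ne' (pow_pos hS 2).ne', Real.log_pow, sub_div,
    div_self (pow_pos hS 2).ne'] at h3
  have h4 : 1 / 4 ^ n * Y ^ 2 ≤ 4 * Y ^ 2 / S ^ 2 := by
    rw [one_div, ← div_eq_inv_mul, div_le_div_iff₀ (by positivity) (by positivity)]
    have h5 : S ^ 2 ≤ 4 * 4 ^ n := by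
      calc S ^ 2 ≤ (2 * 2 ^ n) ^ 2 := pow_le_pow_left₀ hS.le hS2 2
        _ = 4 * 4 ^ n := by
          rw [mul_pow, ← pow_mul, mul_comm n 2, pow_mul]; norm_num
    nlinarith [sq_nonneg Y]
  push_cast at h3
  linarith

/-- The horizontal position, rotated by `-θ`, along a great circle through `spherePoint θ z`. -/
def horizontalPos (z φ ρ : ℝ) : ℂ :=
  ((Real.cos ρ * Real.sqrt (1 - z ^ 2) - Real.sin ρ * (Real.sin φ * z) : ℝ) : ℂ)
    + ((Real.sin ρ * Real.cos φ : ℝ) : ℂ) * Complex.I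

theorem horizontalPos_eq (θ z φ ρ : ℝ) :
    ((polarPt (eastVec θ) (northVec θ z) (spherePoint θ z) ρ φ 0 : ℂ)
      + (polarPt (eastVec θ) (northVec θ z) (spherePoint θ z) ρ φ 1 : ℂ) * Complex.I)
      * Complex.exp ((-θ : ℝ) * Complex.I) = horizontalPos z φ ρ := by
  have h1 := Real.sin_sq_add_cos_sq θ
  have hre : (Complex.exp ((-θ : ℝ) * Complex.I)).re = Real.cos θ := by
    rw [Complex.exp_ofReal_mul_I_re, Real.cos_neg]
  have him : (Complex.exp ((-θ : ℝ) * Complex.I)).im = -Real.sin θ := by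
    rw [Complex.exp_ofReal_mul_I_im, Real.sin_neg]
  apply Complex.ext
  · rw [Complex.mul_re, hre, him]
    simp [horizontalPos, polarPt, dirVec, eastVec, northVec, spherePoint, -Complex.ofReal_cos,
      -Complex.ofReal_sin]
    linear_combination (Real.cos ρ * Real.sqrt (1 - z ^ 2) - Real.sin ρ * (Real.sin φ * z)) * h1
  · rw [Complex.mul_im, hre, him]
    simp [horizontalPos, polarPt, dirVec, eastVec, northVec, spherePoint, -Complex.ofReal_cos,
      -Complex.ofReal_sin]
    linear_combination (Real.sin ρ * Real.cos φ) * h1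

theorem hasDerivAt_horizontalPos (z φ : ℝ) : HasDerivAt (horizontalPos z φ)
    ((-(Real.sin φ * z) : ℝ) + (Real.cos φ : ℝ) * Complex.I) 0 := by
  have h1 : HasDerivAt (fun ρ : ℝ => Real.cos ρ * Real.sqrt (1 - z ^ 2)
      - Real.sin ρ * (Real.sin φ * z)) (-(Real.sin φ * z)) 0 := by
    refine (((Real.hasDerivAt_cos 0).mul_const _).sub
      ((Real.hasDerivAt_sin 0).mul_const _)).congr_deriv ?_
    simp
  have h2 : HasDerivAt (fun ρ : ℝ => Real.sin ρ * Real.cos φ) (Real.cos φ) 0 := by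
    refine ((Real.hasDerivAt_sin 0).mul_const _).congr_deriv ?_
    simp
  exact h1.ofReal_comp.add (h2.ofReal_comp.mul_const Complex.I)

theorem horizontalPos_zero (z φ : ℝ) :
    horizontalPos z φ 0 = ((Real.sqrt (1 - z ^ 2) : ℝ) : ℂ) := by
  simp [horizontalPos]

theorem hasDerivAt_im_horizontalPos_pow (n : ℕ) (z φ : ℝ) :
    HasDerivAt (fun ρ => (horizontalPos z φ ρ ^ n).im)
      (n * Real.sqrt (1 - z ^ 2) ^ (n - 1) * Real.cos φ) 0 := by
  have h := Complex.imCLM.hasFDerivAt.comp_hasDerivAt 0 ((hasDerivAt_horizontalPos z φ).fun_pow n)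
  refine h.congr_deriv ?_
  rw [horizontalPos_zero, Complex.imCLM_apply]
  have : (n : ℂ) * ((Real.sqrt (1 - z ^ 2) : ℝ) : ℂ) ^ (n - 1) =
      ((n * Real.sqrt (1 - z ^ 2) ^ (n - 1) : ℝ) : ℂ) := by push_cast; ring
  rw [this, Complex.im_ofReal_mul]
  simp [-Complex.ofReal_cos, -Complex.ofReal_sin]

theorem im_horizontalPos_zero_pow (n : ℕ) (z φ : ℝ) : (horizontalPos z φ 0 ^ n).im = 0 := by
  rw [horizontalPos_zero, ← Complex.ofReal_pow, Complex.ofReal_im]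

theorem tendsto_sq_div_sq {f : ℝ → ℝ} {f' : ℝ} (hf : HasDerivAt f f' 0) :
    Tendsto (fun ρ => (f ρ - f 0) ^ 2 / ρ ^ 2) (𝓝[≠] 0) (𝓝 (f' ^ 2)) := by
  refine ((hasDerivAt_iff_tendsto_slope.mp hf).pow 2).congr fun ρ => ?_
  rw [slope_def_field, sub_zero, div_pow]

/-- The first derivative of the reduced energy vanishes and the second one is definite at the
vertices of the anti-prism. -/
theorem logSumDeriv_antiprism [Fintype (dihedral n)] (hn : n ≠ 0) {z θ : ℝ} (hz0 : z ≠ 0)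
    (hz : z ^ 2 < 1) (hcrit : critFun n z = 0) (hneg : critFunDeriv n z < 0)
    (hθ : Complex.exp ((-θ : ℝ) * Complex.I) ^ (2 * n) = -1) (φ : ℝ) :
    logSumDeriv n (spherePoint θ z) (dirVec (eastVec θ) (northVec θ z) φ) = 0 ∧
    logSumDeriv₂ n (spherePoint θ z) (dirVec (eastVec θ) (northVec θ z) φ) < 0 := by
  have hF := isFrame_spherePoint θ hz.le
  have hp := isFree_spherePoint hn θ hz0 hz
  have hzz : |z| < 1 := (sq_lt_one_iff_abs_lt_one _).mp hz
  have hzI : z ∈ Ioo (-1) 1 := abs_lt.mp hzz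
  set e₁ := eastVec θ
  set e₂ := northVec θ z
  set p := spherePoint θ z with hpdef
  set e := Complex.exp ((-θ : ℝ) * Complex.I)
  have he : ‖e‖ = 1 := Complex.norm_exp_ofReal_mul_I _
  obtain ⟨d, hd0, hd⟩ := exists_separation (n := n) p
  have hfree : ∀ᶠ ρ in 𝓝 (0 : ℝ), IsFree n (polarPt e₁ e₂ p ρ φ) := by
    filter_upwards [Metric.ball_mem_nhds (0 : ℝ) (show 0 < d / 4 by positivity)] with ρ hρ
    refine isFree_polarPt_of_isFree hF hd0 hd hp ?_ φ
    rw [mem_ball_zero_iff, Real.norm_eq_abs] at hρ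
    exact hρ.le
  set ζ : ℝ → ℝ := fun ρ => polarPt e₁ e₂ p ρ φ 2 with hζdef
  set Y : ℝ → ℝ := fun ρ => (horizontalPos z φ ρ ^ n).im with hYdef
  have hζ0 : ζ 0 = z := by simp [hζdef, polarPt_zero, hpdef, spherePoint]
  have hY0 : Y 0 = 0 := im_horizontalPos_zero_pow n z φ
  have hζd : HasDerivAt ζ (Real.sin φ * Real.sqrt (1 - z ^ 2)) 0 := by
    have : ζ = fun ρ => Real.sin ρ * (Real.sin φ * Real.sqrt (1 - z ^ 2)) + Real.cos ρ * z := by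
      funext ρ
      simp [hζdef, polarPt, dirVec, e₁, e₂, hpdef, eastVec, northVec, spherePoint]
    rw [this]
    refine (((Real.hasDerivAt_sin 0).mul_const _).add
      ((Real.hasDerivAt_cos 0).mul_const _)).congr_deriv ?_
    simp
  have hYd : HasDerivAt Y (n * Real.sqrt (1 - z ^ 2) ^ (n - 1) * Real.cos φ) 0 :=
    hasDerivAt_im_horizontalPos_pow n z φ
  have hYeq : ∀ ρ, ((((polarPt e₁ e₂ p ρ φ 0 : ℝ) : ℂ)
      + (polarPt e₁ e₂ p ρ φ 1 : ℝ) * Complex.I) * e) ^ n = horizontalPos z φ ρ ^ n := fun ρ => by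
    rw [← horizontalPos_eq θ z φ ρ]
  obtain ⟨η, hη, hprof⟩ := profile_sub_le hn hzI hcrit hneg
  set κ : ℝ := 1 / 4 ^ n with hκ
  have hκ0 : 0 < κ := by positivity
  have hζt : Tendsto ζ (𝓝 0) (𝓝 z) := by
    have := hζd.continuousAt.tendsto
    rwa [hζ0] at this
  -- The Hessian is never computed: `F` bounds the decrease of `logSum` from below by the squared
  -- changes of the height and of `Y`, and `second_deriv_le_of_le` turns its quadratic growth into a
  -- bound for the second derivative.
  set F : ℝ → ℝ := fun ρ => η * (ζ ρ - ζ 0) ^ 2 + κ * (Y ρ - Y 0) ^ 2 with hFdef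
  set k : ℝ → ℝ := fun ρ => logSum n (polarPt e₁ e₂ p ρ φ) with hk
  have hk0 : k 0 = logSumConst n + profile n z := by
    have h2 : p 2 = z := by simp [hpdef, spherePoint]
    have h1 := logSum_eq_profile hn (u := p) hp hF.norm₃ (by rw [h2]; exact hz) he hθ
      (by have := hYeq 0; simp only [polarPt_zero] at this; rw [this]; exact hY0)
    rw [h2] at h1
    simp only [hk, polarPt_zero]
    exact h1
  have hle : ∀ᶠ ρ in 𝓝 0, k ρ - k 0 ≤ -F ρ := by
    filter_upwards [hfree, hζt.eventually hprof,
      hζt.eventually (Ioo_mem_nhds hzI.1 hzI.2)] with ρ h1 h2 h3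
    have h4 : ζ ρ ^ 2 < 1 := by nlinarith [h3.1, h3.2]
    have h5 := logSum_le_profile hn (u := polarPt e₁ e₂ p ρ φ) h1 (hF.norm_polarPt ρ φ) h4 he hθ
    rw [hYeq ρ] at h5
    change k ρ ≤ logSumConst n + profile n (ζ ρ) - κ * Y ρ ^ 2 at h5
    simp only [hFdef, hζ0, hY0, sub_zero]
    linarith
  have hFlim : Tendsto (fun ρ => F ρ / ρ ^ 2) (𝓝[≠] 0)
      (𝓝 (η * (Real.sin φ * Real.sqrt (1 - z ^ 2)) ^ 2
        + κ * (n * Real.sqrt (1 - z ^ 2) ^ (n - 1) * Real.cos φ) ^ 2)) := by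
    refine (((tendsto_sq_div_sq hζd).const_mul η).add
      ((tendsto_sq_div_sq hYd).const_mul κ)).congr fun ρ => ?_
    simp only [hFdef]
    ring
  have hkd : ∀ᶠ ρ in 𝓝 0, HasDerivAt k
      (logSumDeriv n (polarPt e₁ e₂ p ρ φ) (radVec e₁ e₂ p ρ φ)) ρ := by
    filter_upwards [hfree] with ρ hρ
    exact hasDerivAt_logSum (hasDerivAt_polarPt_left e₁ e₂ p ρ φ) hρ
  have hmax : IsLocalMax k 0 := by
    filter_upwards [hle] with ρ hρ
    have : 0 ≤ F ρ := by positivity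
    linarith
  have h1 := hmax.hasDerivAt_eq_zero hkd.self_of_nhds
  have h2 := second_deriv_le_of_le hkd (hasDerivAt_logSumDeriv
    (hasDerivAt_polarPt_left e₁ e₂ p 0 φ) (hasDerivAt_radVec_left e₁ e₂ p 0 φ)
    hfree.self_of_nhds) h1 hle hFlim
  simp only [polarPt_zero, radVec_zero] at h1 h2
  refine ⟨h1, h2.trans_lt ?_⟩
  have hr : 0 < Real.sqrt (1 - z ^ 2) := Real.sqrt_pos.mpr (by linarith)
  have hn' : (0 : ℝ) < n := by exact_mod_cast Nat.pos_of_ne_zero hn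
  have hA : 0 < η * Real.sqrt (1 - z ^ 2) ^ 2 := by positivity
  have hB : 0 < κ * (n * Real.sqrt (1 - z ^ 2) ^ (n - 1)) ^ 2 := by positivity
  have hsc := Real.sin_sq_add_cos_sq φ
  generalize η * Real.sqrt (1 - z ^ 2) ^ 2 = A at hA
  -- The height detects the direction `e₂` and `Y` the direction `e₁`; `sin φ` and `cos φ` do not
  -- vanish together.
  have hpos : 0 < η * (Real.sin φ * Real.sqrt (1 - z ^ 2)) ^ 2
      + κ * (n * Real.sqrt (1 - z ^ 2) ^ (n - 1) * Real.cos φ) ^ 2 := by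
    rcases eq_or_ne (Real.sin φ) 0 with h | h
    · have : Real.cos φ ≠ 0 := by rintro h'; rw [h, h'] at hsc; norm_num at hsc
      positivity
    · positivity
  linarith


/-! ### Orbits of the dihedral group -/

theorem spherePoint_add_mul_two_pi (θ z : ℝ) (m : ℤ) :
    spherePoint (θ + m * (2 * Real.pi)) z = spherePoint θ z := by
  simp only [spherePoint, Real.cos_add_int_mul_two_pi, Real.sin_add_int_mul_two_pi]

theorem neg_spherePoint (θ z : ℝ) : -spherePoint θ z = spherePoint (θ + Real.pi) (-z) := by
  apply ext_coord <;> simp [spherePoint]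

theorem act_rotGen_pow_spherePoint (k : ℕ) (θ z : ℝ) :
    act (rotGen n ^ k) (spherePoint θ z) = spherePoint (θ + k * (2 * Real.pi / n)) z := by
  obtain ⟨h0, h1, h2⟩ := act_rotGen_pow_coord (n := n) k (spherePoint θ z)
  apply ext_coord
  · rw [h0]; simp [spherePoint, Real.cos_add]; ring
  · rw [h1]; simp [spherePoint, Real.sin_add]; ring
  · rw [h2]; simp [spherePoint]

theorem act_flip_spherePoint (k : ℕ) (θ z : ℝ) :
    act (rotGen n ^ k * flipGen n) (spherePoint θ z) =
      spherePoint (-θ + k * (2 * Real.pi / n)) (-z) := by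
  obtain ⟨h0, h1, h2⟩ := act_flip_coord (n := n) k (spherePoint θ z)
  apply ext_coord
  · rw [h0]; simp [spherePoint, Real.cos_add]; ring
  · rw [h1]; simp [spherePoint, Real.sin_add]; ring
  · rw [h2]; simp [spherePoint]

theorem range_spherePoint_shift (n : ℕ) (α z : ℝ) (m : ℤ) :
    range (fun k : ℤ => spherePoint (α + m * (2 * Real.pi / n) + k * (2 * Real.pi / n)) z) =
      range (fun k : ℤ => spherePoint (α + k * (2 * Real.pi / n)) z) := by
  have h : (fun k : ℤ => spherePoint (α + m * (2 * Real.pi / n) + k * (2 * Real.pi / n)) z) =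
      (fun k : ℤ => spherePoint (α + k * (2 * Real.pi / n)) z) ∘ Equiv.addLeft m := by
    funext k
    simp only [Function.comp_apply, Equiv.coe_addLeft]
    congr 1
    push_cast
    ring
  rw [h, (Equiv.addLeft m).surjective.range_comp]

theorem exists_nat_spherePoint (hn : n ≠ 0) (α z : ℝ) (k : ℤ) : ∃ l : ℕ, l < n ∧
    spherePoint (α + k * (2 * Real.pi / n)) z = spherePoint (α + l * (2 * Real.pi / n)) z := by
  obtain ⟨l, hl, m, hm⟩ := exists_nat_lt_angle hn k
  exact ⟨l, hl, by rw [hm, ← add_assoc, spherePoint_add_mul_two_pi]⟩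

theorem range_config_spherePoint (hn : n ≠ 0) (g : Fin (2 * n) ≃ dihedral n) (θ z : ℝ) :
    range (config g (spherePoint θ z)) =
      range (fun k : ℤ => spherePoint (θ + k * (2 * Real.pi / n)) z) ∪
      range (fun k : ℤ => spherePoint (-θ + k * (2 * Real.pi / n)) (-z)) := by
  apply Subset.antisymm
  · rintro _ ⟨j, rfl⟩
    rcases exists_rot_or_flip hn (g j) with ⟨k, -, hk⟩ | ⟨k, -, hk⟩
    · exact Or.inl ⟨k, by simp only [config, hk, act_rotGen_pow_spherePoint]; norm_cast⟩
    · exact Or.inr ⟨k, by simp only [config, hk, act_flip_spherePoint]; norm_cast⟩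
  · rintro _ (⟨k, rfl⟩ | ⟨k, rfl⟩)
    · obtain ⟨l, -, hl⟩ := exists_nat_spherePoint hn θ z k
      exact ⟨g.symm (rotGen n ^ l), by
        simp only [config, Equiv.apply_symm_apply, act_rotGen_pow_spherePoint, hl]⟩
    · obtain ⟨l, -, hl⟩ := exists_nat_spherePoint hn (-θ) (-z) k
      exact ⟨g.symm (rotGen n ^ l * flipGen n), by
        simp only [config, Equiv.apply_symm_apply, act_flip_spherePoint, hl]⟩

theorem isAntiprism_range_config (hn : n ≠ 0) (g : Fin (2 * n) ≃ dihedral n) (z : ℝ) (j : ℤ)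
    {σ : ℝ} (hσ : σ = 1 ∨ σ = -1) :
    IsAntiprism n z
      (range (config g (spherePoint ((2 * j - 1) * (2 * Real.pi / n) / 4) (σ * z)))) := by
  set θ : ℝ := (2 * j - 1) * (2 * Real.pi / n) / 4 with hθ
  have hn' : (n : ℝ) ≠ 0 := by exact_mod_cast hn
  rw [range_config_spherePoint hn]
  rcases hσ with rfl | rfl
  · refine ⟨θ, ?_⟩
    -- As `θ = (2j - 1)π / (2n)`, shifting `-θ` by `j` steps gives `θ + π / n`. For `σ = -1` the
    -- shift of `θ` by `1 - j` steps gives `-θ + π / n`.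
    rw [← range_spherePoint_shift n (-θ) (-(1 * z)) j, one_mul]
    congr! 5
    rw [hθ]
    field_simp
    ring
  · refine ⟨-θ, ?_⟩
    rw [union_comm, ← range_spherePoint_shift n θ (-1 * z) (1 - j), neg_mul, neg_neg, one_mul]
    congr! 5
    rw [hθ]
    push_cast
    field_simp
    ring

theorem isEquatorialPolygon_range_config (hn : n ≠ 0) (g : Fin (2 * n) ≃ dihedral n) (j : ℤ) :
    IsEquatorialPolygon n (range (config g (spherePoint ((j - 1) * (2 * Real.pi / n) / 2) 0))) := by
  set θ : ℝ := (j - 1) * (2 * Real.pi / n) / 2 with hθ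
  refine ⟨θ, ?_⟩
  rw [range_config_spherePoint hn, neg_zero, ← range_spherePoint_shift n (-θ) 0 (j - 1)]
  have : -θ + ((j - 1 : ℤ) : ℝ) * (2 * Real.pi / n) = θ := by rw [hθ]; push_cast; ring
  rw [this, union_self]

/-- The longitude is `(2j - 1)π / (2n)`, so the power has argument an odd multiple of `π`. -/
theorem exp_antiprism_pow (hn : n ≠ 0) (j : ℤ) :
    Complex.exp ((-((2 * j - 1) * (2 * Real.pi / n) / 4) : ℝ) * Complex.I) ^ (2 * n) = -1 := by
  have hn' : (n : ℂ) ≠ 0 := by exact_mod_cast hn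
  rw [← Complex.exp_nat_mul]
  have : ((2 * n : ℕ) : ℂ) * (((-((2 * j - 1) * (2 * Real.pi / n) / 4) : ℝ) : ℂ) * Complex.I) =
      Real.pi * Complex.I + (-j : ℤ) * (2 * Real.pi * Complex.I) := by
    push_cast
    field_simp
    ring
  rw [this, Complex.exp_periodic.int_mul, Complex.exp_pi_mul_I]

/-! ### The tetrahedron and the octahedron -/

theorem sq_eq_of_critFun_two {z : ℝ} (hz : z ∈ Ioo 0 1) (h : critFun 2 z = 0) : z ^ 2 = 1 / 3 := by
  have h0 := (powSum_pos (n := 2) ⟨by linarith [hz.1], hz.2.le⟩).ne'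
  rw [critFun] at h
  rw [powSum] at *
  field_simp at h
  push_cast at h
  have : z * (1 - 3 * z ^ 2) = 0 := by linear_combination h / 2
  rcases mul_eq_zero.mp this with h1 | h1
  · exact absurd h1 hz.1.ne'
  · linarith

theorem sq_eq_of_critFun_three {z : ℝ} (hz : z ∈ Ioo 0 1) (h : critFun 3 z = 0) :
    z ^ 2 = 1 / 3 := by
  have h0 := (powSum_pos (n := 3) ⟨by linarith [hz.1], hz.2.le⟩).ne'
  rw [critFun] at h
  rw [powSum] at *
  field_simp at h
  push_cast at h
  have : z * (1 - 3 * z ^ 2) = 0 := by linear_combination h / 8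
  rcases mul_eq_zero.mp this with h1 | h1
  · exact absurd h1 hz.1.ne'
  · linarith

theorem isRegularTetrahedron_range_config (g : Fin (2 * 2) ≃ dihedral 2) (j : ℤ) {z : ℝ}
    (hz : z ^ 2 = 1 / 3) : IsRegularTetrahedron
      (range (config g (spherePoint ((2 * j - 1) * (2 * Real.pi / (2 : ℕ)) / 4) z))) := by
  set θ : ℝ := (2 * j - 1) * (2 * Real.pi / (2 : ℕ)) / 4 with hθ
  set u := spherePoint θ z with hu
  have hz0 : z ≠ 0 := by rintro rfl; norm_num at hz
  have hfree : IsFree 2 u := isFree_spherePoint two_ne_zero θ hz0 (by rw [hz]; norm_num)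
  have hnorm : ‖u‖ = 1 := norm_spherePoint θ (by rw [hz]; norm_num)
  have hs : Real.sqrt (1 - z ^ 2) ^ 2 = 2 / 3 := by
    rw [Real.sq_sqrt (by rw [hz]; norm_num), hz]; norm_num
  have hcs := Real.sin_sq_add_cos_sq θ
  -- For `n = 2` the longitude is an odd multiple of `π / 4`, so `cos (2θ) = 0`; with `z² = 1/3` all
  -- three nontrivial elements then displace the vertex equally.
  have hc2 : Real.cos θ ^ 2 - Real.sin θ ^ 2 = 0 := by
    have h1 : Real.cos (2 * θ) = 0 := by
      rw [show 2 * θ = j * Real.pi - Real.pi / 2 by rw [hθ]; push_cast; ring,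
        Real.cos_sub_pi_div_two, Real.sin_int_mul_pi]
    rw [Real.cos_two_mul] at h1
    linarith
  have hu0 : u 0 = Real.sqrt (1 - z ^ 2) * Real.cos θ := rfl
  have hu1 : u 1 = Real.sqrt (1 - z ^ 2) * Real.sin θ := rfl
  have hu2 : u 2 = z := rfl
  have key : ∀ γ : dihedral 2, γ ≠ 1 → ‖u - act γ u‖ ^ 2 = 8 / 3 := by
    intro γ hγ
    rcases exists_rot_or_flip two_ne_zero γ with ⟨k, hk, rfl⟩ | ⟨k, hk, rfl⟩
    · have hk1 : k = 1 := by
        interval_cases k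
        · exact absurd (pow_zero _) hγ
        · rfl
      rw [normSq_sub_rot, hk1, hu0, hu1,
        show ((1 : ℕ) : ℝ) * (2 * Real.pi / (2 : ℕ)) = Real.pi by push_cast; ring, Real.cos_pi]
      linear_combination 4 * Real.sqrt (1 - z ^ 2) ^ 2 * hcs + 4 * hs
    · have hsin : Real.sin (k * (2 * Real.pi / (2 : ℕ))) = 0 := by
        rw [show (k : ℝ) * (2 * Real.pi / (2 : ℕ)) = k * Real.pi by push_cast; ring,
          Real.sin_nat_mul_pi]
      rw [normSq_sub_flip k hnorm, hsin, hu0, hu1, hu2]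
      linear_combination 2 * hz - 2 * Real.cos (k * (2 * Real.pi / (2 : ℕ))) *
        Real.sqrt (1 - z ^ 2) ^ 2 * hc2
  refine ⟨?_, Real.sqrt (8 / 3), by positivity, ?_⟩
  · rw [← image_univ, ncard_image_of_injective _ fun i j h => config_injective_of_isFree g hfree h,
      ncard_univ]
    simp
  · rintro _ ⟨i, rfl⟩ _ ⟨k, rfl⟩ hik
    have hne : (g i)⁻¹ * g k ≠ 1 := by
      intro h
      rw [inv_mul_eq_one] at h
      exact hik (by simp only [config, h])
    have h1 : dist (config g u i) (config g u k) = ‖u - act ((g i)⁻¹ * g k) u‖ := by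
      rw [← dist_eq_norm, ← dist_act (g i) u, ← act_mul, mul_inv_cancel_left]
      rfl
    rw [h1, ← key _ hne, Real.sqrt_sq (norm_nonneg _)]

/-- For `z² = 1/3` two vertices of one triangle, at longitudes `2π / 3` apart, are orthogonal. As `π
/ 3 + 2π / 3 = π`, the other triangle consists of their antipodes. -/
theorem IsAntiprism.isRegularOctahedron {S : Set R3} {z : ℝ} (hz : z ^ 2 = 1 / 3)
    (h : IsAntiprism 3 z S) : IsRegularOctahedron S := by
  obtain ⟨α, rfl⟩ := h
  have hs : Real.sqrt (1 - z ^ 2) ^ 2 = 2 / 3 := by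
    rw [Real.sq_sqrt (by rw [hz]; norm_num), hz]; norm_num
  set ζ : ℝ := 2 * Real.pi / (3 : ℕ) with hζ
  have hc : Real.cos ζ = -1 / 2 := by
    rw [show ζ = Real.pi - Real.pi / 3 by rw [hζ]; push_cast; ring, Real.cos_pi_sub,
      Real.cos_pi_div_three]
    norm_num
  have hc2 : Real.cos (2 * ζ) = -1 / 2 := by rw [Real.cos_two_mul, hc]; norm_num
  have hinner : ∀ β γ : ℝ, inner ℝ (spherePoint β z) (spherePoint γ z) =
      2 / 3 * Real.cos (γ - β) + 1 / 3 := by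
    intro β γ
    rw [inner_eq_sum, Real.cos_sub]
    simp only [spherePoint, PiLp.toLp_apply, Matrix.cons_val]
    linear_combination hz + (Real.cos γ * Real.cos β + Real.sin γ * Real.sin β) * hs
  have horth : ∀ β γ : ℝ, Real.cos (γ - β) = -1 / 2 →
      inner ℝ (spherePoint β z) (spherePoint γ z) = 0 := by
    intro β γ h
    rw [hinner, h]; norm_num
  have hnorm : ∀ β, ‖spherePoint β z‖ = 1 := fun β => norm_spherePoint β (by rw [hz]; norm_num)
  have hneg : ∀ k : ℤ, spherePoint (α + Real.pi / (3 : ℕ) + k * ζ) (-z) =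
      -spherePoint (α + (k - 1 : ℤ) * ζ) z := by
    intro k
    rw [neg_spherePoint]
    congr 1
    rw [hζ]; push_cast; ring
  have hmem : ∀ k : ℤ, spherePoint (α + k * ζ) z = spherePoint α z ∨
      spherePoint (α + k * ζ) z = spherePoint (α + ζ) z ∨
      spherePoint (α + k * ζ) z = spherePoint (α + 2 * ζ) z := by
    intro k
    obtain ⟨l, hl, h⟩ := exists_nat_spherePoint (n := 3) (by norm_num) α z k
    rw [h]
    interval_cases l
    · left; simp
    · right; left; simp [hζ]
    · right; right; simp [hζ]
  refine ⟨spherePoint α z, spherePoint (α + ζ) z, spherePoint (α + 2 * ζ) z, ?_, ?_⟩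
  · have h01 := horth α (α + ζ) (by rw [add_sub_cancel_left, hc])
    have h02 := horth α (α + 2 * ζ) (by rw [add_sub_cancel_left, hc2])
    have h12 := horth (α + ζ) (α + 2 * ζ) (by rw [show α + 2 * ζ - (α + ζ) = ζ by ring, hc])
    refine ⟨fun i => by fin_cases i <;> exact hnorm _, fun i k hik => ?_⟩
    fin_cases i <;> fin_cases k <;> first | exact absurd rfl hik | assumption |
      (rw [real_inner_comm]; assumption)
  · apply Subset.antisymm
    · rintro _ (⟨k, rfl⟩ | ⟨k, rfl⟩)
      · rcases hmem k with h | h | h <;> simp [h]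
      · simp only [hneg]
        rcases hmem (k - 1) with h | h | h <;> simp only [h] <;> simp
    · have hpos : ∀ k : ℤ, spherePoint (α + k * ζ) z ∈
          range (fun k : ℤ => spherePoint (α + k * ζ) z) ∪
          range (fun k : ℤ => spherePoint (α + Real.pi / (3 : ℕ) + k * ζ) (-z)) :=
        fun k => Or.inl ⟨k, rfl⟩
      have hnegm : ∀ k : ℤ, -spherePoint (α + k * ζ) z ∈
          range (fun k : ℤ => spherePoint (α + k * ζ) z) ∪
          range (fun k : ℤ => spherePoint (α + Real.pi / (3 : ℕ) + k * ζ) (-z)) :=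
        fun k => Or.inr ⟨k + 1, by simp only [hneg, add_sub_cancel_right]⟩
      have e0 : α + ((0 : ℤ) : ℝ) * ζ = α := by simp
      have e1 : α + ((1 : ℤ) : ℝ) * ζ = α + ζ := by simp
      have e2 : α + ((2 : ℤ) : ℝ) * ζ = α + 2 * ζ := by simp
      rintro _ (rfl | rfl | rfl | rfl | rfl | rfl)
      · simpa only [e0] using hpos 0
      · simpa only [e0] using hnegm 0
      · simpa only [e1] using hpos 1
      · simpa only [e1] using hnegm 1
      · simpa only [e2] using hpos 2
      · simpa only [e2] using hnegm 2

/-! ### Stabilizers -/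

theorem ncard_setOf_apply {α β : Type*} (g : α ≃ β) (P : β → Prop) :
    {j | P (g j)}.ncard = {γ | P γ}.ncard := by
  rw [← ncard_image_of_injective {j | P (g j)} g.injective]
  congr 1
  ext γ
  exact ⟨by rintro ⟨j, hj, rfl⟩; exact hj, fun h => ⟨g.symm γ, by simpa using h, by simp⟩⟩

theorem rotGen_pow_act_inj {q : R3} (hq : q 0 ^ 2 + q 1 ^ 2 ≠ 0) {k l : ℕ} (hk : k < n)
    (hl : l < n) (h : act (rotGen n ^ k) q = act (rotGen n ^ l) q) : k = l := by
  obtain ⟨hk0, hk1, -⟩ := act_rotGen_pow_coord (n := n) k q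
  obtain ⟨hl0, hl1, -⟩ := act_rotGen_pow_coord (n := n) l q
  rw [h, hl0] at hk0
  rw [h, hl1] at hk1
  have hc : Real.cos (k * (2 * Real.pi / n)) = Real.cos (l * (2 * Real.pi / n)) :=
    mul_right_cancel₀ hq (by linear_combination (-q 0) * hk0 - q 1 * hk1)
  have hs : Real.sin (k * (2 * Real.pi / n)) = Real.sin (l * (2 * Real.pi / n)) :=
    mul_right_cancel₀ hq (by linear_combination q 1 * hk0 - q 0 * hk1)
  exact rotGen_pow_inj hk hl (by rw [rotMat, rotMat, hc, hs])

theorem rotGen_ne_one (hn : 2 ≤ n) : rotGen n ≠ 1 := by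
  intro h
  have h1 := rotGen_pow_inj (n := n) (k := 1) (l := 0) (by omega) (by omega)
    (by rw [← coe_rotGen_pow, ← coe_rotGen_pow, pow_one, pow_zero, h])
  omega

theorem spherePoint_one (θ : ℝ) : spherePoint θ 1 = north := by
  apply ext_coord <;> simp [spherePoint, north]

theorem spherePoint_neg_one (θ : ℝ) : spherePoint θ (-1) = south := by
  apply ext_coord <;> simp [spherePoint, south]

theorem neg_north : -north = south := by
  apply ext_coord <;> simp [north, south]

theorem neg_south : -south = north := by rw [← neg_north, neg_neg]

theorem north_ne_south : north ≠ south := by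
  intro h
  have : (1 : ℝ) = -1 := congrArg (fun x : R3 => x 2) h
  norm_num at this

theorem act_rotGen_pow_north (k : ℕ) : act (rotGen n ^ k) north = north := by
  rw [← spherePoint_one 0, act_rotGen_pow_spherePoint, spherePoint_one, spherePoint_one]

theorem act_flip_north (k : ℕ) : act (rotGen n ^ k * flipGen n) north = south := by
  rw [← spherePoint_one 0, act_flip_spherePoint, spherePoint_neg_one]

theorem ncard_act_north_eq_north (hn : n ≠ 0) : {γ : dihedral n | act γ north = north}.ncard = n := by
  have : {γ : dihedral n | act γ north = north} =
      range (fun k : Fin n => rotGen n ^ (k : ℕ)) := by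
    ext γ
    constructor
    · intro h
      rcases exists_rot_or_flip hn γ with ⟨k, hk, rfl⟩ | ⟨k, hk, rfl⟩
      · exact ⟨⟨k, hk⟩, rfl⟩
      · exact absurd ((act_flip_north k).symm.trans h).symm north_ne_south
    · rintro ⟨k, rfl⟩
      exact act_rotGen_pow_north _
  have hinj : Function.Injective fun k : Fin n => rotGen n ^ (k : ℕ) :=
    (bijective_enumDihedral hn).injective.comp Sum.inl_injective
  rw [this, ← image_univ, ncard_image_of_injective _ hinj, ncard_univ]
  simp

theorem ncard_act_north_eq_south (hn : n ≠ 0) : {γ : dihedral n | act γ north = south}.ncard = n := by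
  have : {γ : dihedral n | act γ north = south} =
      range (fun k : Fin n => rotGen n ^ (k : ℕ) * flipGen n) := by
    ext γ
    constructor
    · intro h
      rcases exists_rot_or_flip hn γ with ⟨k, hk, rfl⟩ | ⟨k, hk, rfl⟩
      · exact absurd ((act_rotGen_pow_north k).symm.trans h) north_ne_south
      · exact ⟨⟨k, hk⟩, rfl⟩
    · rintro ⟨k, rfl⟩
      exact act_flip_north _
  have hinj : Function.Injective fun k : Fin n => rotGen n ^ (k : ℕ) * flipGen n :=
    (bijective_enumDihedral hn).injective.comp Sum.inr_injective
  rw [this, ← image_univ, ncard_image_of_injective _ hinj, ncard_univ]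
  simp

theorem ncard_polar (hn : n ≠ 0) (g : Fin (2 * n) ≃ dihedral n) {u : R3}
    (hu : u = north ∨ u = south) :
    {j | config g u j = north}.ncard = n ∧ {j | config g u j = south}.ncard = n := by
  have hN := ncard_act_north_eq_north hn
  have hS := ncard_act_north_eq_south hn
  rw [← ncard_setOf_apply g] at hN hS
  rcases hu with rfl | rfl
  · exact ⟨hN, hS⟩
  · have h1 : ∀ j, config g south j = -config g north j := fun j => by
      simp only [config, ← neg_north, act_neg]
    refine ⟨?_, ?_⟩
    · simp only [h1, neg_eq_iff_eq_neg, neg_north]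
      exact hS
    · simp only [h1, neg_eq_iff_eq_neg, neg_south]
      exact hN

/-- A half-turn of the dihedral group fixing the given point of the equator. -/
theorem exists_flip_fixing (hn : n ≠ 0) (j : ℤ) : ∃ k : ℕ, k < n ∧
    act (rotGen n ^ k * flipGen n) (spherePoint ((j - 1) * (2 * Real.pi / n) / 2) 0) =
      spherePoint ((j - 1) * (2 * Real.pi / n) / 2) 0 := by
  set θ : ℝ := (j - 1) * (2 * Real.pi / n) / 2 with hθ
  obtain ⟨k, hk, h⟩ := exists_nat_spherePoint hn (-θ) 0 (j - 1)
  refine ⟨k, hk, ?_⟩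
  rw [act_flip_spherePoint, neg_zero, ← h]
  congr 1
  rw [hθ]; push_cast; ring

/-- The stabilizer consists of the identity and one half-turn: rotations act freely on the equator,
and two half-turns with the same image differ by a rotation. The indices sharing a position form a
coset of it. -/
theorem ncard_config_equator (hn : n ≠ 0) (g : Fin (2 * n) ≃ dihedral n) (θ : ℝ) {k : ℕ}
    (hk : k < n)
    (hfix : act (rotGen n ^ k * flipGen n) (spherePoint θ 0) = spherePoint θ 0)
    (i : Fin (2 * n)) :
    {j | config g (spherePoint θ 0) j = config g (spherePoint θ 0) i}.ncard = 2 := by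
  have hq : ∀ β, spherePoint β 0 0 ^ 2 + spherePoint β 0 1 ^ 2 ≠ 0 := by
    intro β
    simp [spherePoint]
  have hne : rotGen n ^ k * flipGen n ≠ 1 := fun h =>
    rotGen_pow_ne_mul_flipGen (n := n) 0 k (by rw [h, pow_zero])
  have hstab : ∀ γ : dihedral n, act γ (spherePoint θ 0) = spherePoint θ 0 →
      γ = 1 ∨ γ = rotGen n ^ k * flipGen n := by
    intro γ h
    rcases exists_rot_or_flip hn γ with ⟨l, hl, rfl⟩ | ⟨l, hl, rfl⟩
    · left
      rw [rotGen_pow_act_inj (hq θ) hl (Nat.pos_of_ne_zero hn) (by rw [h, pow_zero, act_one]),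
        pow_zero]
    · right
      have h := h.trans hfix.symm
      rw [act_flip_spherePoint, act_flip_spherePoint, neg_zero, ← act_rotGen_pow_spherePoint, ← act_rotGen_pow_spherePoint] at h
      rw [rotGen_pow_act_inj (hq _) hl hk h]
  rw [show {j | config g (spherePoint θ 0) j = config g (spherePoint θ 0) i} =
    {j | act (g j) (spherePoint θ 0) = act (g i) (spherePoint θ 0)} from rfl,
    ncard_setOf_apply g fun γ => act γ (spherePoint θ 0) = act (g i) (spherePoint θ 0)]
  have : {γ | act γ (spherePoint θ 0) = act (g i) (spherePoint θ 0)} =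
      {g i, g i * (rotGen n ^ k * flipGen n)} := by
    ext γ
    constructor
    · intro h
      have h1 : act ((g i)⁻¹ * γ) (spherePoint θ 0) = spherePoint θ 0 := by
        rw [act_mul, show act γ (spherePoint θ 0) = _ from h, act_inv_act]
      rcases hstab _ h1 with h2 | h2
      · exact Or.inl (inv_mul_eq_one.mp h2).symm
      · exact Or.inr (inv_mul_eq_iff_eq_mul.mp h2)
    · rintro (rfl | rfl)
      · rfl
      · change act _ _ = _
        rw [act_mul, hfix]
  rw [this, ncard_pair fun h => hne (left_eq_mul.mp h)]


/-! ### The three families -/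

theorem antiprism_family [Fintype (dihedral n)] (hn : 2 ≤ n) {z : ℝ} (hz : z ∈ Ioo 0 1)
    (hcrit : critFun n z = 0) (g : Fin (2 * n) ≃ dihedral n) (j : ℤ) {σ : ℝ}
    (hσ : σ = 1 ∨ σ = -1) :
    let v₀ := config g (spherePoint ((2 * j - 1) * (2 * Real.pi / n) / 4) (σ * z))
    IsEquilibrium v₀ ∧ IsAntiprism n z (range v₀) ∧
    (n = 2 → IsRegularTetrahedron (range v₀)) ∧ (n = 3 → IsRegularOctahedron (range v₀)) ∧
    ∃ h₁ : ℝ, energy v₀ < h₁ ∧ ∃ (v : ℝ → ℝ → Fin (2 * n) → R3) (T : ℝ → ℝ),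
      IsSymmetricPeriodicFamily g v₀ (Ioo (energy v₀) h₁) v T ∧
      TendstoUniformly v (fun _ => v₀) (𝓝[>] (energy v₀)) := by
  intro v₀
  have hn0 : n ≠ 0 := by omega
  have hsq : (σ * z) ^ 2 = z ^ 2 := by rcases hσ with rfl | rfl <;> ring
  have hlt : (σ * z) ^ 2 < 1 := by rw [hsq]; nlinarith [hz.1, hz.2]
  have hne : σ * z ≠ 0 := by rcases hσ with rfl | rfl <;> simp [hz.1.ne']
  -- `critFun` is odd and `critFunDeriv` even, so both hemispheres are treated alike.
  have hcrit' : critFun n (σ * z) = 0 := by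
    rcases hσ with rfl | rfl <;> simp [critFun_neg, hcrit]
  have hneg : critFunDeriv n (σ * z) < 0 := by
    have := critFunDeriv_neg_of_eq_zero hn hz hcrit
    rcases hσ with rfl | rfl <;> simpa [critFunDeriv_neg] using this
  set θ : ℝ := (2 * j - 1) * (2 * Real.pi / n) / 4 with hθ
  have hF := isFrame_spherePoint θ hlt.le
  have hfree := isFree_spherePoint hn0 θ hne hlt
  have hd := logSumDeriv_antiprism hn0 hne hlt hcrit' hneg (exp_antiprism_pow hn0 j)
  have hA := isAntiprism_range_config hn0 g z j hσ
  refine ⟨isEquilibrium_config g hF hfree fun φ => (hd φ).1, hA, ?_, ?_,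
    exists_family_of_minimum hn0 g hF hfree (fun φ => (hd φ).1) fun φ => (hd φ).2⟩
  · rintro rfl
    exact isRegularTetrahedron_range_config g j (hsq.trans (sq_eq_of_critFun_two hz hcrit))
  · rintro rfl
    exact hA.isRegularOctahedron (sq_eq_of_critFun_three hz hcrit)

theorem polar_family [Fintype (dihedral n)] (hn : 2 ≤ n) (g : Fin (2 * n) ≃ dihedral n) {u : R3}
    (hu : u = north ∨ u = south) :
    ∃ (h₁ : ℝ) (v : ℝ → ℝ → Fin (2 * n) → R3) (T : ℝ → ℝ),
      IsSymmetricPeriodicFamily g (config g u) (Ioi h₁) v T ∧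
      (∀ h ∈ Ioi h₁, ∃ s : ℤ, (s = 1 ∨ s = -1) ∧
        (∀ j, config g u j = north → TurnsAbout (fun t => v h t j) (T h) north s) ∧
        (∀ j, config g u j = south → TurnsAbout (fun t => v h t j) (T h) north (-s))) ∧
      TendstoUniformly v (fun _ => config g u) atTop ∧ Tendsto T atTop (𝓝 0) := by
  have hfix : act (rotGen n) u = u := by
    have h := act_rotGen_pow_north (n := n) 1
    rw [pow_one] at h
    rcases hu with rfl | rfl
    · exact h
    · rw [← neg_north, act_neg, h]
  obtain ⟨e₁, e₂, hF⟩ : ∃ e₁ e₂, IsFrame e₁ e₂ u := by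
    rcases hu with rfl | rfl
    · exact ⟨_, _, spherePoint_one 0 ▸ isFrame_spherePoint 0 (by norm_num)⟩
    · exact ⟨_, _, spherePoint_neg_one 0 ▸ isFrame_spherePoint 0 (by norm_num)⟩
  obtain ⟨h₁, v, T, hfam, hturn, hlim, hT⟩ :=
    exists_family_of_stabilizer (by omega) g hF (rotGen_ne_one hn) hfix
  refine ⟨h₁, v, T, hfam, fun h hh => ⟨1, Or.inl rfl, fun j hj => ?_, fun j hj => ?_⟩, hlim, hT⟩
  · exact hj ▸ hturn h hh j
  · have := (hturn h hh j).neg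
    rwa [hj, neg_south] at this

theorem polygonal_family [Fintype (dihedral n)] (hn : 2 ≤ n) (g : Fin (2 * n) ≃ dihedral n)
    (j : ℤ) :
    let v₀ := config g (spherePoint ((j - 1) * (2 * Real.pi / n) / 2) 0)
    IsEquatorialPolygon n (range v₀) ∧ (∀ i, {j | v₀ j = v₀ i}.ncard = 2) ∧
    ∃ (h₁ : ℝ) (v : ℝ → ℝ → Fin (2 * n) → R3) (T : ℝ → ℝ),
      IsSymmetricPeriodicFamily g v₀ (Ioi h₁) v T ∧
      TendstoUniformly v (fun _ => v₀) atTop ∧ Tendsto T atTop (𝓝 0) := by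
  intro v₀
  have hn0 : n ≠ 0 := by omega
  obtain ⟨k, hk, hfix⟩ := exists_flip_fixing hn0 j
  have hne : rotGen n ^ k * flipGen n ≠ 1 := fun h =>
    rotGen_pow_ne_mul_flipGen (n := n) 0 k (by rw [h, pow_zero])
  obtain ⟨h₁, v, T, hfam, -, hlim, hT⟩ := exists_family_of_stabilizer hn0 g
    (isFrame_spherePoint _ (by norm_num)) hne hfix
  exact ⟨isEquatorialPolygon_range_config hn0 g j, ncard_config_equator hn0 g _ hk hfix,
    h₁, v, T, hfam, hlim, hT⟩

end SphereVortex
end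

/-! ### The main theorem -/

theorem corollary4p2 (n : ℕ) (hn : 2 ≤ n) :
    -- the group has `2n` elements, so that orderings of it by `Fin (2 * n)` exist
    Nat.card (SphereVortex.dihedral n) = 2 * n ∧
    -- (i) oscillations around the anti-prism equilibria
    (∃ z : ℝ, SphereVortex.IsAntiprismHalfHeight n z ∧
      ∀ g : Fin (2 * n) ≃ SphereVortex.dihedral n,
      ∀ v₀ ∈ SphereVortex.antiprismConfigs g z,
        SphereVortex.IsEquilibrium v₀ ∧
        SphereVortex.IsAntiprism n z (Set.range v₀) ∧
        (n = 2 → SphereVortex.IsRegularTetrahedron (Set.range v₀)) ∧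
        (n = 3 → SphereVortex.IsRegularOctahedron (Set.range v₀)) ∧
        ∃ h₁ : ℝ, SphereVortex.energy v₀ < h₁ ∧
        ∃ (v : ℝ → ℝ → Fin (2 * n) → SphereVortex.R3) (T : ℝ → ℝ),
          SphereVortex.IsSymmetricPeriodicFamily g v₀
            (Set.Ioo (SphereVortex.energy v₀) h₁) v T ∧
          TendstoUniformly v (fun _ => v₀) (𝓝[>] (SphereVortex.energy v₀))) ∧
    -- (ii) the family converging to the polar collision
    (∀ g : Fin (2 * n) ≃ SphereVortex.dihedral n,
      ∀ v₀ ∈ SphereVortex.polarCollisions g,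
        {j | v₀ j = SphereVortex.north}.ncard = n ∧
        {j | v₀ j = SphereVortex.south}.ncard = n ∧
        ∃ (h₁ : ℝ) (v : ℝ → ℝ → Fin (2 * n) → SphereVortex.R3) (T : ℝ → ℝ),
          SphereVortex.IsSymmetricPeriodicFamily g v₀ (Set.Ioi h₁) v T ∧
          (∀ h ∈ Set.Ioi h₁, ∃ s : ℤ, (s = 1 ∨ s = -1) ∧
            (∀ j, v₀ j = SphereVortex.north →
              SphereVortex.TurnsAbout (fun t => v h t j) (T h) SphereVortex.north s) ∧
            (∀ j, v₀ j = SphereVortex.south →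
              SphereVortex.TurnsAbout (fun t => v h t j) (T h) SphereVortex.north (-s))) ∧
          TendstoUniformly v (fun _ => v₀) atTop ∧
          Tendsto T atTop (𝓝 0)) ∧
    -- (iii) the family converging to the polygonal collisions
    (∀ g : Fin (2 * n) ≃ SphereVortex.dihedral n,
      ∀ v₀ ∈ SphereVortex.polygonalCollisions g,
        SphereVortex.IsEquatorialPolygon n (Set.range v₀) ∧
        (∀ i, {j | v₀ j = v₀ i}.ncard = 2) ∧
        ∃ (h₁ : ℝ) (v : ℝ → ℝ → Fin (2 * n) → SphereVortex.R3) (T : ℝ → ℝ),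
          SphereVortex.IsSymmetricPeriodicFamily g v₀ (Set.Ioi h₁) v T ∧
          TendstoUniformly v (fun _ => v₀) atTop ∧
          Tendsto T atTop (𝓝 0)) := by
  have hn0 : n ≠ 0 := by omega
  have hfin := SphereVortex.finite_dihedral hn0
  have hfintype := Fintype.ofFinite (SphereVortex.dihedral n)
  refine ⟨SphereVortex.natCard_dihedral hn0, ?_, ?_, ?_⟩
  · obtain ⟨z, hz, hcrit⟩ := SphereVortex.exists_critFun_eq_zero hn
    refine ⟨z, SphereVortex.isAntiprismHalfHeight_of_critFun hn hz hcrit, ?_⟩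
    rintro g _ ⟨j, σ, hσ, rfl⟩
    exact SphereVortex.antiprism_family hn hz hcrit g j hσ
  · rintro g _ ⟨u, hu, rfl⟩
    exact ⟨(SphereVortex.ncard_polar hn0 g hu).1, (SphereVortex.ncard_polar hn0 g hu).2,
      SphereVortex.polar_family hn g hu⟩
  · rintro g _ ⟨j, rfl⟩
    exact SphereVortex.polygonal_family hn g j
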